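/- Let $A$ be a separable $C^*$-algebra. Let $\mathcal E_A$ be the class of all surjective $*$-homomorphisms $p:C\to A$ with $C$ a separable $C^*$-algebra, preordered by: $(C,p)\le(C',p')$ if there is a surjective $*$-homomorphism $\lambda:C'\to C$ with $p'=p\circ\lambda$. For $(C,p)\in\mathcal E_A$ with $J=\ker p$, and for a stable $\sigma$-unital $C^*$-algebra $B$, let $EN(C,J;B)$ be the semigroup of homotopy classes of pairs $(\psi^+,\psi^-)$ of asymptotic homomorphisms $(\psi^\pm_t)_{t\in[0,\infty)}$ from $C$ to $B$ that agree on $J$, i.e. $\lim_{t\to\infty}\|\psi^+_t(c)-\psi^-_t(c)\|=0$ for all $c\in J$. A homotopy is a pair of asymptotic homomorphisms from $C$ to $C([0,1];B)$ that agree on $J$. The sum is $[(\psi^+,\psi^-)]+[(\varphi^+,\varphi^-)]=[(s_1\psi^+s_1^*+s_2\varphi^+s_2^*,\ s_1\psi^-s_1^*+s_2\varphi^-s_2^*)]$, where $s_1,s_2$ are isometries in the multiplier algebra of $B$ with $s_1s_1^*+s_2s_2^*=1$. Let $EN(A,B)=\varinjlim_{C\in\mathcal E_A}EN(C,J;B)$,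 the direct limit along the maps $\lambda^*$ induced by surjections $\lambda:C'\to C$ over $A$, with the addition that is induced by forming pull-backs over $A$. An extension $(C,p)\in\mathcal E_A$ is called full if the canonical map $EN(C,J;B)\to EN(A,B)$ is an isomorphism (a bijection compatible with addition, for every choice of $s_1,s_2$) for every stable $\sigma$-unital $C^*$-algebra $B$. A universal extension of $A$ is a maximal element of $\mathcal E_A$, i.e. some $(U,p)\in\mathcal E_A$ with $(C,p')\le(U,p)$ for all $(C,p')\in\mathcal E_A$, such that $U$ is free in the sense that every $*$-homomorphism $U\to D$ lifts along every surjective $*$-homomorphism $D'\to D$ of separable $C^*$-algebras. Then: 1. the cone extension $CA=\{f\in C([0,1];A):f(0)=0\}\to A$, $f\mapsto f(1)$, whose kernel is the suspension $SA$, is full; 2. $A$ has a universal extension, and every universal extension of $A$ is full. -/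

import Mathlib

open Filter Topology
open scoped NNReal BoundedContinuousFunction unitInterval MultiplierAlgebra

universe u v w

namespace FullSurj

noncomputable section

/-! ### Asymptotic homomorphisms -/

/-- An asymptotic homomorphism from `A` to `B` (Connes-Higson): a family `φ_t : A → B`, `t ∈ [0,∞)`,
such that `t ↦ φ_t(a)` is continuous and bounded for every `a`, and which is asymptotically
`ℂ`-linear, multiplicative and involutive. Here `φ_t(a)` is written `φ.toFun a t`. -/
structure AsympHom (A : Type u) (B : Type v) [NonUnitalCStarAlgebra A]
    [NonUnitalCStarAlgebra B] where
  toFun : A → (ℝ≥0 →ᵇ B)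
  map_add : ∀ a b : A,
    Tendsto (fun t : ℝ≥0 => toFun (a + b) t - (toFun a t + toFun b t)) atTop (𝓝 0)
  map_smul : ∀ (c : ℂ) (a : A),
    Tendsto (fun t : ℝ≥0 => toFun (c • a) t - c • toFun a t) atTop (𝓝 0)
  map_mul : ∀ a b : A,
    Tendsto (fun t : ℝ≥0 => toFun (a * b) t - toFun a t * toFun b t) atTop (𝓝 0)
  map_star : ∀ a : A,
    Tendsto (fun t : ℝ≥0 => toFun (star a) t - star (toFun a t)) atTop (𝓝 0)

/-- A pair of asymptotic homomorphisms from `C` to `B` that agree (asymptotically, i.e. as maps to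
`C_b(ℝ₊;B)/C₀(ℝ₊;B)`) on the kernel of `p : C → A`. -/
structure AsympPair {A : Type u} {C : Type w} [NonUnitalCStarAlgebra A] [NonUnitalCStarAlgebra C]
    (p : C →⋆ₙₐ[ℂ] A) (B : Type v) [NonUnitalCStarAlgebra B] where
  plus : AsympHom C B
  minus : AsympHom C B
  agree : ∀ c : C, p c = 0 →
    Tendsto (fun t : ℝ≥0 => plus.toFun c t - minus.toFun c t) atTop (𝓝 0)

section Functoriality

variable {A : Type u} {B B' : Type v} {C C' : Type w}
  [NonUnitalCStarAlgebra A] [NonUnitalCStarAlgebra B] [NonUnitalCStarAlgebra B']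
  [NonUnitalCStarAlgebra C] [NonUnitalCStarAlgebra C']

/-- Composition `φ ∘ f` with a `*`-homomorphism of the domains. -/
def AsympHom.comp (φ : AsympHom C B) (f : C' →⋆ₙₐ[ℂ] C) : AsympHom C' B where
  toFun c := φ.toFun (f c)
  map_add a b := by simpa using φ.map_add (f a) (f b)
  map_smul c a := by simpa using φ.map_smul c (f a)
  map_mul a b := by simpa using φ.map_mul (f a) (f b)
  map_star a := by simpa [StarHomClass.map_star] using φ.map_star (f a)

theorem starHom_lipschitz (g : B →⋆ₙₐ[ℂ] B') : LipschitzWith 1 g :=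
  AddMonoidHomClass.lipschitz_of_bound_nnnorm g 1
    (by simpa using NonUnitalStarAlgHom.nnnorm_apply_le g)

theorem tendsto_starHom (g : B →⋆ₙₐ[ℂ] B') {f : ℝ≥0 → B} (hf : Tendsto f atTop (𝓝 0)) :
    Tendsto (fun t => g (f t)) atTop (𝓝 0) := by
  have h := ((starHom_lipschitz g).continuous.tendsto 0).comp hf
  simpa [Function.comp_def] using h

/-- Composition `g ∘ φ` with a `*`-homomorphism of the targets. -/
def AsympHom.map (g : B →⋆ₙₐ[ℂ] B') (φ : AsympHom C B) : AsympHom C B' where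
  toFun c := (φ.toFun c).comp g (starHom_lipschitz g)
  map_add a b := by simpa using tendsto_starHom g (φ.map_add a b)
  map_smul c a := by simpa using tendsto_starHom g (φ.map_smul c a)
  map_mul a b := by simpa using tendsto_starHom g (φ.map_mul a b)
  map_star a := by simpa [StarHomClass.map_star] using tendsto_starHom g (φ.map_star a)

/-- The asymptotic homomorphism `c ↦ (φ_t(c), ψ_t(c))`. -/
def AsympHom.prod (φ ψ : AsympHom C B) : AsympHom C (B × B) where
  toFun c := (BoundedContinuousFunction.mkOfBound
    ⟨fun t => (φ.toFun c t, ψ.toFun c t), by fun_prop⟩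
    (max (2 * ‖φ.toFun c‖) (2 * ‖ψ.toFun c‖))
    (fun s t => by
      rw [Prod.dist_eq]
      exact max_le_max ((φ.toFun c).dist_le_two_norm s t) ((ψ.toFun c).dist_le_two_norm s t)))
  map_add a b := by
    simpa [Prod.zero_eq_mk] using (φ.map_add a b).prodMk_nhds (ψ.map_add a b)
  map_smul c a := by
    simpa [Prod.zero_eq_mk] using (φ.map_smul c a).prodMk_nhds (ψ.map_smul c a)
  map_mul a b := by
    simpa [Prod.zero_eq_mk] using (φ.map_mul a b).prodMk_nhds (ψ.map_mul a b)
  map_star a := by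
    exact (φ.map_star a).prodMk_nhds (ψ.map_star a)

end Functoriality

/-! ### Stability, σ-unitality, sums -/

/-- `B` is stable: `B ≅ B ⊗ 𝕂`. The isomorphism is given by the images `θ i j b` of the elementary
tensors `b ⊗ e_{ij}`, where `e_{ij}` are the matrix units of `𝕂 = 𝕂(ℓ²(ℕ))`; these span a dense
copy of the `*`-algebra of finitely supported matrices over `B`, whose only `C^*`-completion
is `B ⊗ 𝕂`. -/
def IsStable (B : Type v) [NonUnitalCStarAlgebra B] : Prop :=
  ∃ θ : ℕ → ℕ → (B →ₗ[ℂ] B),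
    (∀ i j, Function.Injective (θ i j)) ∧
    (∀ i j k l b c, θ i j b * θ k l c = if j = k then θ i l (b * c) else 0) ∧
    (∀ i j b, star (θ i j b) = θ j i (star b)) ∧
    Dense (Submodule.span ℂ {x : B | ∃ i j b, x = θ i j b} : Set B)

/-- `B` is σ-unital: it has a countable (sequential) approximate unit. -/
def IsSigmaUnital (B : Type v) [NonUnitalCStarAlgebra B] : Prop :=
  ∃ e : ℕ → B, (∀ n, IsSelfAdjoint (e n)) ∧ (∀ n, ‖e n‖ ≤ 1) ∧
    ∀ b : B, Tendsto (fun n => e n * b) atTop (𝓝 b)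

/-- Two isometries `s₁, s₂` in the multiplier algebra of `B` with `s₁ s₁^* + s₂ s₂^* = 1`. -/
structure CuntzPair (B : Type v) [NonUnitalCStarAlgebra B] where
  s₁ : 𝓜(ℂ, B)
  s₂ : 𝓜(ℂ, B)
  isometry₁ : star s₁ * s₁ = 1
  isometry₂ : star s₂ * s₂ = 1
  sum_eq_one : s₁ * star s₁ + s₂ * star s₂ = 1

section Sum

variable {B : Type v} [NonUnitalCStarAlgebra B]

theorem eq_of_forall_mul_left {x y : B} (h : ∀ z : B, z * x = z * y) : x = y := by
  have h1 := h (star (x - y))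
  rw [← sub_eq_zero, ← mul_sub, CStarRing.star_mul_self_eq_zero_iff] at h1
  exact sub_eq_zero.mp h1

theorem fst_mul (s : 𝓜(ℂ, B)) (x y : B) : s.fst (x * y) = s.fst x * y :=
  eq_of_forall_mul_left fun z => by
    rw [← s.central, ← mul_assoc, s.central, mul_assoc]

theorem star_snd_mul (s : 𝓜(ℂ, B)) (x y : B) :
    (star s).snd (x * y) = x * (star s).snd y := by
  simp [fst_mul]

/-- For multipliers `s, r`, the product of `s b s^*` and `r c r^*` in `B`. -/
theorem conj_mul_aux (s r : 𝓜(ℂ, B)) (b c : B) :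
    s.fst ((star s).snd b) * r.fst ((star r).snd c) =
      s.fst ((star s * r).snd b * (star r).snd c) := by
  rw [← fst_mul, ← r.central]; rfl

theorem star_snd_fst (s : 𝓜(ℂ, B)) (x : B) :
    (star s).snd (s.fst x) = s.fst ((star s).snd x) :=
  eq_of_forall_mul_left fun z => by
    rw [← star_snd_mul, ← s.central, star_snd_mul, s.central]

/-- For a multiplier `s`, the map `b ↦ s b s^*` from `B` to `B` (`s.fst` and `s.snd` are left and
right multiplication by `s`). -/
def conj (s : 𝓜(ℂ, B)) (b : B) : B := s.fst ((star s).snd b)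

theorem conj_star (s : 𝓜(ℂ, B)) (b : B) : conj s (star b) = star (conj s b) := by
  rw [conj, conj, ← star_snd_fst]
  simp

namespace CuntzPair

variable (S : CuntzPair B)

theorem orthogonal : star S.s₁ * S.s₂ = 0 := by
  have h : star S.s₁ * (S.s₁ * star S.s₁ + S.s₂ * star S.s₂) * S.s₂ = star S.s₁ * S.s₂ := by
    rw [S.sum_eq_one, mul_one]
  have h2 : star S.s₁ * (S.s₁ * star S.s₁ + S.s₂ * star S.s₂) * S.s₂
      = (star S.s₁ * S.s₁) * (star S.s₁ * S.s₂)
        + (star S.s₁ * S.s₂) * (star S.s₂ * S.s₂) := by noncomm_ring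
  rw [h2, S.isometry₁, S.isometry₂, one_mul, mul_one] at h
  simpa using h

theorem orthogonal' : star S.s₂ * S.s₁ = 0 := by
  simpa using congrArg star S.orthogonal

/-- The `*`-homomorphism `(b, c) ↦ s₁ b s₁^* + s₂ c s₂^*` from `B ⊕ B` to `B`. -/
def sumHom : B × B →⋆ₙₐ[ℂ] B where
  toFun x := conj S.s₁ x.1 + conj S.s₂ x.2
  map_smul' c x := by simp [conj]
  map_zero' := by simp [conj]
  map_add' x y := by simp only [conj, Prod.fst_add, Prod.snd_add, map_add]; abel
  map_mul' x y := by
    simp only [conj, add_mul, mul_add, conj_mul_aux, S.isometry₁, S.isometry₂, S.orthogonal,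
      S.orthogonal', Prod.fst_mul, Prod.snd_mul, star_snd_mul, DoubleCentralizer.one_snd,
      DoubleCentralizer.zero_snd]
    simp
  map_star' x := by
    simp only [Prod.fst_star, Prod.snd_star, star_add, conj_star]

/-- The sum `s₁ φ s₁^* + s₂ ψ s₂^*` of two asymptotic homomorphisms. -/
def add {C : Type w} [NonUnitalCStarAlgebra C] (φ ψ : AsympHom C B) : AsympHom C B :=
  (φ.prod ψ).map S.sumHom

theorem add_apply {C : Type w} [NonUnitalCStarAlgebra C] (φ ψ : AsympHom C B) (c : C) (t : ℝ≥0) :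
    (S.add φ ψ).toFun c t = conj S.s₁ (φ.toFun c t) + conj S.s₂ (ψ.toFun c t) := rfl

/-- The same for continuous functions `[0,1] → B`, pointwise. -/
def sumHomI : C(I, B) × C(I, B) →⋆ₙₐ[ℂ] C(I, B) where
  toFun x := ⟨fun τ => S.sumHom (x.1 τ, x.2 τ),
    (starHom_lipschitz S.sumHom).continuous.comp (by fun_prop)⟩
  map_smul' c x := by ext τ; exact map_smul S.sumHom c (x.1 τ, x.2 τ)
  map_zero' := by ext τ; exact map_zero S.sumHom
  map_add' x y := by ext τ; exact map_add S.sumHom (x.1 τ, x.2 τ) (y.1 τ, y.2 τ)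
  map_mul' x y := by ext τ; exact map_mul S.sumHom (x.1 τ, x.2 τ) (y.1 τ, y.2 τ)
  map_star' x := by ext τ; exact map_star S.sumHom (x.1 τ, x.2 τ)

end CuntzPair

end Sum

/-! ### The semigroup of homotopy classes of pairs -/

section EN

variable {A : Type u} {C C' : Type w} [NonUnitalCStarAlgebra A] [NonUnitalCStarAlgebra C]
  [NonUnitalCStarAlgebra C'] {p : C →⋆ₙₐ[ℂ] A} {B : Type v} [NonUnitalCStarAlgebra B]

/-- Two pairs are homotopic if they are the evaluations at `0` and `1` of a pair of asymptotic
homomorphisms from `C` to `C([0,1];B)` that agree on the kernel of `p`. -/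
def AsympPair.Homotopic (ψ₀ ψ₁ : AsympPair p B) : Prop :=
  ∃ H : AsympPair p C(I, B), ∀ (c : C) (t : ℝ≥0),
    H.plus.toFun c t 0 = ψ₀.plus.toFun c t ∧ H.minus.toFun c t 0 = ψ₀.minus.toFun c t ∧
    H.plus.toFun c t 1 = ψ₁.plus.toFun c t ∧ H.minus.toFun c t 1 = ψ₁.minus.toFun c t

/-- `EN(C,J;B)`, `J = ker p`: the set of homotopy classes of pairs of asymptotic homomorphisms from
`C` to `B` that agree on `J`. -/
def EN (p : C →⋆ₙₐ[ℂ] A) (B : Type v) [NonUnitalCStarAlgebra B] :=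
  Quot (AsympPair.Homotopic (p := p) (B := B))

/-- Restriction of a pair along `f : C' → C` over `A`. -/
def AsympPair.comp {p' : C' →⋆ₙₐ[ℂ] A} (ψ : AsympPair p B) (f : C' →⋆ₙₐ[ℂ] C)
    (hf : ∀ c, p (f c) = p' c) : AsympPair p' B where
  plus := ψ.plus.comp f
  minus := ψ.minus.comp f
  agree c hc := ψ.agree (f c) (by rw [hf, hc])

/-- The map `f^* : EN(C,J;B) → EN(C',J';B)` induced by `f : C' → C` over `A`. -/
def EN.comap {p' : C' →⋆ₙₐ[ℂ] A} (f : C' →⋆ₙₐ[ℂ] C) (hf : ∀ c, p (f c) = p' c) :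
    EN p B → EN p' B :=
  Quot.map (fun ψ => ψ.comp f hf) fun _ _ ⟨H, h⟩ => ⟨H.comp f hf, fun c t => h (f c) t⟩

/-- The sum of two pairs. -/
def AsympPair.add (S : CuntzPair B) (ψ φ : AsympPair p B) : AsympPair p B where
  plus := S.add ψ.plus φ.plus
  minus := S.add ψ.minus φ.minus
  agree c hc := by
    have h := tendsto_starHom S.sumHom ((ψ.agree c hc).prodMk_nhds (φ.agree c hc))
    refine h.congr fun t => ?_
    exact map_sub S.sumHom (ψ.plus.toFun c t, φ.plus.toFun c t)
      (ψ.minus.toFun c t, φ.minus.toFun c t)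

/-- The sum of two homotopies. -/
def AsympPair.addI (S : CuntzPair B) (ψ φ : AsympPair p C(I, B)) : AsympPair p C(I, B) where
  plus := (ψ.plus.prod φ.plus).map S.sumHomI
  minus := (ψ.minus.prod φ.minus).map S.sumHomI
  agree c hc := by
    have h := tendsto_starHom S.sumHomI ((ψ.agree c hc).prodMk_nhds (φ.agree c hc))
    refine h.congr fun t => ?_
    exact map_sub S.sumHomI (ψ.plus.toFun c t, φ.plus.toFun c t)
      (ψ.minus.toFun c t, φ.minus.toFun c t)

/-- The inclusion of `B` into `C([0,1];B)` as constant functions. -/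
def constHom : B →⋆ₙₐ[ℂ] C(I, B) where
  toFun b := ContinuousMap.const I b
  map_smul' _ _ := rfl
  map_zero' := rfl
  map_add' _ _ := rfl
  map_mul' _ _ := rfl
  map_star' _ := rfl

theorem AsympPair.Homotopic.refl (ψ : AsympPair p B) : ψ.Homotopic ψ :=
  ⟨{ plus := ψ.plus.map constHom
     minus := ψ.minus.map constHom
     agree := fun c hc => tendsto_starHom constHom (ψ.agree c hc) },
    fun _ _ => ⟨rfl, rfl, rfl, rfl⟩⟩

theorem AsympPair.Homotopic.add (S : CuntzPair B) {ψ₀ ψ₁ φ₀ φ₁ : AsympPair p B}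
    (hψ : ψ₀.Homotopic ψ₁) (hφ : φ₀.Homotopic φ₁) :
    (AsympPair.add S ψ₀ φ₀).Homotopic (AsympPair.add S ψ₁ φ₁) := by
  obtain ⟨H, h⟩ := hψ
  obtain ⟨K, k⟩ := hφ
  refine ⟨AsympPair.addI S H K, fun c t => ?_⟩
  obtain ⟨h1, h2, h3, h4⟩ := h c t
  obtain ⟨k1, k2, k3, k4⟩ := k c t
  refine ⟨?_, ?_, ?_, ?_⟩
  · exact congrArg S.sumHom (Prod.ext h1 k1)
  · exact congrArg S.sumHom (Prod.ext h2 k2)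
  · exact congrArg S.sumHom (Prod.ext h3 k3)
  · exact congrArg S.sumHom (Prod.ext h4 k4)

/-- Addition in `EN(C,J;B)`:
`[(ψ⁺,ψ⁻)] + [(φ⁺,φ⁻)] = [(s₁ψ⁺s₁^* + s₂φ⁺s₂^*, s₁ψ⁻s₁^* + s₂φ⁻s₂^*)]`. -/
def EN.add (S : CuntzPair B) : EN p B → EN p B → EN p B :=
  Quot.map₂ (AsympPair.add S) (fun ψ _ _ h => (AsympPair.Homotopic.refl ψ).add S h)
    (fun _ _ φ h => h.add S (AsympPair.Homotopic.refl φ))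

end EN

/-! ### The directed set of extensions of `A`, and `EN(A,B)` -/

/-- An element of `𝓔_A`: a separable `C^*`-algebra `alg` with a surjective `*`-homomorphism
`proj : alg → A`. -/
structure Extension (A : Type u) [NonUnitalCStarAlgebra A] where
  alg : Type u
  [cstar : NonUnitalCStarAlgebra alg]
  [separable : TopologicalSpace.SeparableSpace alg]
  proj : alg →⋆ₙₐ[ℂ] A
  surjective : Function.Surjective proj

attribute [instance] Extension.cstar Extension.separable

namespace Extension

variable {A : Type u} [NonUnitalCStarAlgebra A]

/-- A surjective `*`-homomorphism `E' → E` over `A`. -/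
structure Hom (E' E : Extension A) where
  toHom : E'.alg →⋆ₙₐ[ℂ] E.alg
  surjective : Function.Surjective toHom
  comm : ∀ c, E.proj (toHom c) = E'.proj c

/-- The preorder of `𝓔_A`: `E ≤ E'` if there is a surjective `*`-homomorphism `E' → E` over `A`. -/
instance : LE (Extension A) := ⟨fun E E' => Nonempty (Hom E' E)⟩

/-- The semigroup `EN(C,J;B)` of the extension `E = (C → A)`, where `J = ker (C → A)`. -/
abbrev EN (E : Extension A) (B : Type v) [NonUnitalCStarAlgebra B] := FullSurj.EN E.proj B

section FiberProduct

variable (E F : Extension A)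

/-- The `C^*`-algebra `{(c, d) : c ∈ E, d ∈ F, p_E(c) = p_F(d)}`. -/
def fiberSubalgebra : NonUnitalStarSubalgebra ℂ (E.alg × F.alg) where
  carrier := {x | E.proj x.1 = F.proj x.2}
  zero_mem' := by simp
  add_mem' := by
    intro x y hx hy
    simp only [Set.mem_ofPred_eq] at hx hy
    simp [hx, hy]
  mul_mem' := by
    intro x y hx hy
    simp only [Set.mem_ofPred_eq] at hx hy
    simp [hx, hy]
  smul_mem' := by
    intro c x hx
    simp only [Set.mem_ofPred_eq] at hx
    simp [hx]
  star_mem' := by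
    intro x hx
    simp only [Set.mem_ofPred_eq] at hx
    simp [hx, StarHomClass.map_star]

instance : IsClosed (fiberSubalgebra E F : Set (E.alg × F.alg)) :=
  isClosed_eq ((starHom_lipschitz E.proj).continuous.comp continuous_fst)
    ((starHom_lipschitz F.proj).continuous.comp continuous_snd)

/-- The pull-back of two extensions of `A`. -/
def fiberProduct : Extension A where
  alg := fiberSubalgebra E F
  separable :=
    haveI := UniformSpace.secondCountable_of_separable E.alg
    haveI := UniformSpace.secondCountable_of_separable F.alg
    inferInstance
  proj := E.proj.comp
    ((NonUnitalStarAlgHom.fst ℂ E.alg F.alg).comp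
      (NonUnitalStarSubalgebraClass.subtype (fiberSubalgebra E F)))
  surjective a := by
    obtain ⟨c, hc⟩ := E.surjective a
    obtain ⟨d, hd⟩ := F.surjective a
    exact ⟨⟨(c, d), hc.trans hd.symm⟩, hc⟩

/-- The first projection of the pull-back. -/
def fiberProduct.fst : Hom (fiberProduct E F) E where
  toHom := (NonUnitalStarAlgHom.fst ℂ E.alg F.alg).comp
      (NonUnitalStarSubalgebraClass.subtype (fiberSubalgebra E F))
  surjective c := by
    obtain ⟨d, hd⟩ := F.surjective (E.proj c)
    exact ⟨⟨(c, d), hd.symm⟩, rfl⟩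
  comm _ := rfl

/-- The second projection of the pull-back. -/
def fiberProduct.snd : Hom (fiberProduct E F) F where
  toHom := (NonUnitalStarAlgHom.snd ℂ E.alg F.alg).comp
      (NonUnitalStarSubalgebraClass.subtype (fiberSubalgebra E F))
  surjective d := by
    obtain ⟨c, hc⟩ := E.surjective (F.proj d)
    exact ⟨⟨(c, d), hc⟩, rfl⟩
  comm x := x.2.symm

/-- Functoriality of the pull-back. -/
def fiberProduct.map {E E' F F' : Extension A} (f : Hom E' E) (g : Hom F' F) :
    Hom (fiberProduct E' F') (fiberProduct E F) where
  toHom :=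
    { toFun := fun x => ⟨(f.toHom x.1.1, g.toHom x.1.2),
        (f.comm _).trans (x.2.trans (g.comm _).symm)⟩
      map_smul' := fun c x => Subtype.ext (Prod.ext (map_smul f.toHom c x.1.1)
        (map_smul g.toHom c x.1.2))
      map_zero' := Subtype.ext (Prod.ext (map_zero f.toHom) (map_zero g.toHom))
      map_add' := fun x y => Subtype.ext (Prod.ext (map_add f.toHom x.1.1 y.1.1)
        (map_add g.toHom x.1.2 y.1.2))
      map_mul' := fun x y => Subtype.ext (Prod.ext (map_mul f.toHom x.1.1 y.1.1)
        (map_mul g.toHom x.1.2 y.1.2))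
      map_star' := fun x => Subtype.ext (Prod.ext (StarHomClass.map_star f.toHom x.1.1)
        (StarHomClass.map_star g.toHom x.1.2)) }
  surjective := by
    rintro ⟨⟨c, d⟩, h⟩
    obtain ⟨c', rfl⟩ := f.surjective c
    obtain ⟨d', rfl⟩ := g.surjective d
    exact ⟨⟨(c', d'), (f.comm _).symm.trans (Eq.trans h (g.comm _))⟩, rfl⟩
  comm x := f.comm x.1.1

/-- The identity of an extension. -/
def Hom.id (E : Extension A) : Hom E E where
  toHom := NonUnitalStarAlgHom.id ℂ E.alg
  surjective c := ⟨c, rfl⟩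
  comm _ := rfl

end FiberProduct

/-- The relation that identifies `x ∈ EN(C,J;B)` with `λ^* x ∈ EN(C',J';B)` for all
surjections `λ : C' → C` over `A`. -/
def LimRel (A : Type u) [NonUnitalCStarAlgebra A] (B : Type v) [NonUnitalCStarAlgebra B]
    (x y : Σ E : Extension A, E.EN B) : Prop :=
  ∃ f : Hom y.1 x.1, y.2 = FullSurj.EN.comap f.toHom f.comm x.2

end Extension

/-- `EN(A,B)`: the direct limit of `EN(C,J;B)` over `C ∈ 𝓔_A`. -/
def ENLim (A : Type u) [NonUnitalCStarAlgebra A] (B : Type v) [NonUnitalCStarAlgebra B] :=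
  Quot (Extension.LimRel A B)

/-- The canonical map `EN(C,J;B) → EN(A,B)`. -/
def Extension.toLim {A : Type u} [NonUnitalCStarAlgebra A] (E : Extension A) (B : Type v)
    [NonUnitalCStarAlgebra B] (x : E.EN B) : ENLim A B :=
  Quot.mk _ ⟨E, x⟩

section Add

variable {A : Type u} [NonUnitalCStarAlgebra A] {B : Type v} [NonUnitalCStarAlgebra B]

/-- The sum of `x ∈ EN(C,J;B)` and `y ∈ EN(C',J';B)`, formed in the pull-back of `C` and `C'`. -/
def Extension.sum (S : CuntzPair B) (x y : Σ E : Extension A, E.EN B) :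
    Σ E : Extension A, E.EN B :=
  ⟨x.1.fiberProduct y.1,
    EN.add S
      (EN.comap (Extension.fiberProduct.fst x.1 y.1).toHom
        (Extension.fiberProduct.fst x.1 y.1).comm x.2)
      (EN.comap (Extension.fiberProduct.snd x.1 y.1).toHom
        (Extension.fiberProduct.snd x.1 y.1).comm y.2)⟩

theorem Extension.sum_comap (S : CuntzPair B) {E E' F F' : Extension A} (f : Hom E' E)
    (g : Hom F' F) (x : E.EN B) (y : F.EN B) :
    LimRel A B (Extension.sum S ⟨E, x⟩ ⟨F, y⟩)
      (Extension.sum S ⟨E', EN.comap f.toHom f.comm x⟩ ⟨F', EN.comap g.toHom g.comm y⟩) := by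
  refine ⟨fiberProduct.map f g, ?_⟩
  induction x using Quot.ind
  induction y using Quot.ind
  rfl

theorem EN.comap_id {E : Extension A} (x : E.EN B) :
    EN.comap (Extension.Hom.id E).toHom (Extension.Hom.id E).comm x = x := by
  induction x using Quot.ind
  rfl

/-- Addition in `EN(A,B)`. -/
def ENLim.add (S : CuntzPair B) : ENLim A B → ENLim A B → ENLim A B :=
  Quot.map₂ (Extension.sum S)
    (by
      rintro ⟨E, x⟩ ⟨F, y⟩ ⟨F', y'⟩ ⟨f, hf⟩
      have h := Extension.sum_comap S (Extension.Hom.id E) f x y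
      rw [EN.comap_id] at h
      have hf' : EN.comap (p := F.proj) (p' := F'.proj) f.toHom f.comm y = y' := hf.symm
      exact hf' ▸ h)
    (by
      rintro ⟨E, x⟩ ⟨E', x'⟩ ⟨F, y⟩ ⟨f, hf⟩
      have h := Extension.sum_comap S f (Extension.Hom.id F) x y
      rw [EN.comap_id] at h
      have hf' : EN.comap (p := E.proj) (p' := E'.proj) f.toHom f.comm x = x' := hf.symm
      exact hf' ▸ h)

end Add

/-- An extension `C ∈ 𝓔_A` is full if the canonical map `EN(C,J;B) → EN(A,B)` is an isomorphism of
semigroups for every (stable and σ-unital) `B`. -/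
def Extension.IsFull {A : Type u} [NonUnitalCStarAlgebra A] (E : Extension A) : Prop :=
  ∀ (B : Type v) [NonUnitalCStarAlgebra B], IsStable B → IsSigmaUnital B →
    Function.Bijective (E.toLim B) ∧
    ∀ (S : CuntzPair B) (x y : E.EN B),
      E.toLim B (EN.add S x y) = ENLim.add S (E.toLim B x) (E.toLim B y)

/-! ### The cone extension and the universal extension -/

section Cone

variable (A : Type u) [NonUnitalCStarAlgebra A]

/-- The cone `CA = {f ∈ C([0,1];A) : f(0) = 0}`. -/
def coneSubalgebra : NonUnitalStarSubalgebra ℂ C(I, A) where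
  carrier := {f | f 0 = 0}
  zero_mem' := by simp
  add_mem' := by
    intro x y hx hy
    simp only [Set.mem_ofPred_eq] at hx hy
    simp [hx, hy]
  mul_mem' := by
    intro x y hx hy
    simp only [Set.mem_ofPred_eq] at hx hy
    simp [hx]
  smul_mem' := by
    intro c x hx
    simp only [Set.mem_ofPred_eq] at hx
    simp [hx]
  star_mem' := by
    intro x hx
    simp only [Set.mem_ofPred_eq] at hx
    simp [hx]

instance : IsClosed (coneSubalgebra A : Set C(I, A)) :=
  isClosed_eq (by fun_prop) continuous_const

/-- Evaluation at `1`, from `CA` onto `A`. Its kernel is the suspension `SA`. -/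
def coneEval : coneSubalgebra A →⋆ₙₐ[ℂ] A where
  toFun f := (f : C(I, A)) 1
  map_smul' _ _ := rfl
  map_zero' := rfl
  map_add' _ _ := rfl
  map_mul' _ _ := rfl
  map_star' _ := rfl

/-- The cone extension `SA → CA → A` of a separable `C^*`-algebra `A`. -/
def coneExtension [TopologicalSpace.SeparableSpace A] : Extension A where
  alg := coneSubalgebra A
  separable :=
    haveI := UniformSpace.secondCountable_of_separable A
    inferInstance
  proj := coneEval A
  surjective a :=
    ⟨⟨⟨fun τ => ((τ : ℝ) : ℂ) • a, by fun_prop⟩,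
      show (((0 : I) : ℝ) : ℂ) • a = 0 by simp⟩,
      show (((1 : I) : ℝ) : ℂ) • a = a by simp⟩

end Cone

/-- Freeness of a `C^*`-algebra `U`: every `*`-homomorphism from `U` to a separable `C^*`-algebra
lifts along every surjection of separable `C^*`-algebras. -/
def HasLifting (U : Type u) [NonUnitalCStarAlgebra U] : Prop :=
  ∀ (D D' : Type u) [NonUnitalCStarAlgebra D] [NonUnitalCStarAlgebra D']
    [TopologicalSpace.SeparableSpace D] [TopologicalSpace.SeparableSpace D']
    (q : D' →⋆ₙₐ[ℂ] D) (φ : U →⋆ₙₐ[ℂ] D), Function.Surjective q →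
    ∃ ψ : U →⋆ₙₐ[ℂ] D', q.comp ψ = φ

/-- Universal extensions of `A`: the maximal elements of `𝓔_A` whose algebra is free. -/
def Extension.IsUniversal {A : Type u} [NonUnitalCStarAlgebra A] (U : Extension A) : Prop :=
  (∀ E : Extension A, E ≤ U) ∧ HasLifting U.alg

end
end FullSurj

/-! Write Q(B) for the algebra C_b(ℝ₊;B)/C₀(ℝ₊;B). An asymptotic homomorphism C → B, up to functions
vanishing at infinity, is a `*`-homomorphism C → Q(B), and a straight line joins any two
representatives. An element of EN(C,J;B) is therefore given by two `*`-homomorphisms α, β : C → Q(B)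
that agree on J. Everything rests on a map EN(C,J;B) → EN(CA,SA;B), called `EN.toCone`.

It comes from a connecting element: a self-adjoint e in Q(B) that commutes with α(C) and β(C),
annihilates every α(c) - β(c), and is a unit for α(J) (`exists_isConnecting`). A quasicentral
approximate unit (u_n) of J gives approximate solutions α(u_n) = β(u_n), because α(u_n)(α(c) - β(c))
= α(u_n c) - β(u_n c) = 0. A diagonal argument along t → ∞ makes countably many such conditions
exact in Q(B) (`AsympAlg.exists_solution`).

Given e, the rule f ⊗ c ↦ f(1 - e)α(c) is a `*`-homomorphism on C-valued functions. For c in J the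
element 1 - e annihilates α(c), so f(1 - e)α(c) = f(0)α(c), which is 0 on the cone; hence the map
descends to CA. On a difference α(c) - β(c) the element 1 - e acts as 1, so the maps built from α
and β differ at F by α(F(1)) - β(F(1)); on SA this vanishes. The connecting elements form a convex
set, so the class of the new pair does not depend on e. The map is additive and compatible with
surjections over A.

Shrinking e linearly to 0 is a homotopy on the cone CC from the pull-back of the new pair along CC →
CA to the pull-back of (α, β) along the evaluation CC → C (`EN.comap_coneEval`). So x and its image
in EN(CA,SA;B) have the same class in EN(A,B). On EN(CA,SA;B) itself the map is the identity,
because F ↦ F(sr) is a common section of the two maps C(CA) → CA (`EN.toCone_coneEval`). This proves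
that the cone is full. Additivity of every canonical map to EN(A,B) follows by comparison with the
cone.

If U is universal, maximality gives surjectivity. Freeness gives a section g of CU → U, and pulling
the homotopy back along g recovers x from its image in EN(CA,SA;B), hence from its class in EN(A,B).
For existence, U is the universal algebra on countably many self-adjoint contractions: it is free
because self-adjoint contractions lift along surjections to self-adjoint contractions, and it is
maximal because half of the generators can be spent on generating a kernel. -/

namespace FullSurj

noncomputable section

/-! ### The asymptotic algebra `C_b(ℝ₊;B)/C₀(ℝ₊;B)` -/

section AsympAlg

variable (B : Type v) [NonUnitalCStarAlgebra B]

/-- The ideal `C₀(ℝ₊;B)` of functions in `C_b(ℝ₊;B)` that vanish at infinity. -/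
def asympNull : Submodule ℂ (ℝ≥0 →ᵇ B) where
  carrier := {f | Tendsto f atTop (𝓝 0)}
  zero_mem' := tendsto_const_nhds
  add_mem' hf hg := by
    have h := Tendsto.add hf hg
    rwa [add_zero] at h
  smul_mem' c f hf := by simpa using Tendsto.const_smul hf c

variable {B}

theorem mem_asympNull {f : ℝ≥0 →ᵇ B} : f ∈ asympNull B ↔ Tendsto f atTop (𝓝 0) := Iff.rfl

theorem mem_asympNull_iff {f : ℝ≥0 →ᵇ B} :
    f ∈ asympNull B ↔ ∀ ε > 0, ∀ᶠ t in atTop, ‖f t‖ ≤ ε := by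
  rw [mem_asympNull, Metric.tendsto_nhds]
  constructor
  · intro h ε hε
    filter_upwards [h ε hε] with t ht
    simpa using ht.le
  · intro h ε hε
    filter_upwards [h (ε / 2) (by positivity)] with t ht
    simpa using ht.trans_lt (half_lt_self hε)

theorem asympNull_mul_right {f : ℝ≥0 →ᵇ B} (hf : f ∈ asympNull B) (g : ℝ≥0 →ᵇ B) :
    f * g ∈ asympNull B := by
  rw [mem_asympNull] at *
  refine squeeze_zero_norm (a := fun t => ‖f t‖ * ‖g‖) (fun t => ?_)
    (by simpa using (tendsto_norm_zero.comp hf).mul_const ‖g‖)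
  exact (norm_mul_le _ _).trans (by gcongr; exact g.norm_coe_le_norm t)

theorem asympNull_star {f : ℝ≥0 →ᵇ B} (hf : f ∈ asympNull B) : star f ∈ asympNull B := by
  have h := Tendsto.star (mem_asympNull.1 hf)
  rwa [star_zero] at h

theorem asympNull_mul_left {f : ℝ≥0 →ᵇ B} (hf : f ∈ asympNull B) (g : ℝ≥0 →ᵇ B) :
    g * f ∈ asympNull B := by
  simpa using asympNull_star (asympNull_mul_right (asympNull_star hf) (star g))

instance : IsClosed (asympNull B : Set (ℝ≥0 →ᵇ B)) := by
  rw [← closure_subset_iff_isClosed]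
  intro f hf
  rw [SetLike.mem_coe, mem_asympNull_iff]
  intro ε hε
  obtain ⟨g, hg, hfg⟩ := Metric.mem_closure_iff.1 hf (ε / 2) (by positivity)
  filter_upwards [mem_asympNull_iff.1 hg (ε / 2) (by positivity)] with t ht
  have h1 : ‖f t - g t‖ ≤ ε / 2 := by
    rw [← dist_eq_norm]; exact (f.dist_coe_le_dist t).trans hfg.le
  calc ‖f t‖ = ‖(f t - g t) + g t‖ := by simp
    _ ≤ ε / 2 + ε / 2 := (norm_add_le _ _).trans (add_le_add h1 ht)
    _ = ε := by ring

variable (B) in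
/-- The `C^*`-algebra `C_b(ℝ₊;B)/C₀(ℝ₊;B)`. -/
def AsympAlg : Type v := (ℝ≥0 →ᵇ B) ⧸ asympNull B

namespace AsympAlg

instance : NormedAddCommGroup (AsympAlg B) :=
  inferInstanceAs (NormedAddCommGroup ((ℝ≥0 →ᵇ B) ⧸ asympNull B))

instance : NormedSpace ℂ (AsympAlg B) :=
  inferInstanceAs (NormedSpace ℂ ((ℝ≥0 →ᵇ B) ⧸ asympNull B))

instance : CompleteSpace (AsympAlg B) :=
  inferInstanceAs (CompleteSpace ((ℝ≥0 →ᵇ B) ⧸ asympNull B))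

/-- The quotient map as a linear map. -/
def mkL : (ℝ≥0 →ᵇ B) →ₗ[ℂ] AsympAlg B := (asympNull B).mkQ

theorem mkL_surjective : Function.Surjective (mkL (B := B)) := (asympNull B).mkQ_surjective

theorem mkL_eq_mkL {f g : ℝ≥0 →ᵇ B} : mkL f = mkL g ↔ f - g ∈ asympNull B :=
  Submodule.Quotient.eq _

theorem norm_mkL_le (f : ℝ≥0 →ᵇ B) : ‖mkL f‖ ≤ ‖f‖ := Submodule.Quotient.norm_mk_le _ f

theorem exists_norm_lt (x : AsympAlg B) {ε : ℝ} (hε : 0 < ε) :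
    ∃ f, mkL f = x ∧ ‖f‖ < ‖x‖ + ε :=
  Submodule.Quotient.norm_mk_lt (S := asympNull B) x hε

/-- Together with `norm_mkL_le_of_eventually` this identifies the quotient norm with the limit
superior of ‖f t‖, which reduces the C*-identity of the quotient to the pointwise one. -/
theorem eventually_norm_le (f : ℝ≥0 →ᵇ B) {ε : ℝ} (hε : 0 < ε) :
    ∀ᶠ t in atTop, ‖f t‖ ≤ ‖mkL f‖ + ε := by
  obtain ⟨g, hg, hn⟩ := exists_norm_lt (mkL f) (half_pos hε)
  filter_upwards [mem_asympNull_iff.1 (mkL_eq_mkL.1 hg) (ε / 2) (half_pos hε)] with t ht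
  calc ‖f t‖ = ‖g t - (g - f) t‖ := by simp
    _ ≤ ‖g t‖ + ‖(g - f) t‖ := norm_sub_le _ _
    _ ≤ ‖g‖ + ε / 2 := add_le_add (g.norm_coe_le_norm t) ht
    _ ≤ ‖mkL f‖ + ε := by linarith

theorem norm_mkL_le_of_eventually {f : ℝ≥0 →ᵇ B} {r : ℝ} (hr : 0 ≤ r)
    (h : ∀ᶠ t in atTop, ‖f t‖ ≤ r) : ‖mkL f‖ ≤ r := by
  obtain ⟨T, hT⟩ := eventually_atTop.1 h
  -- A cut-off that is 0 up to T and 1 from T + 1 on. Multiplying f by it changes f by a null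
  -- function and makes the eventual bound global.
  let χ : ℝ≥0 → ℝ := fun t => min 1 (max 0 ((t : ℝ) - T))
  have hχc : Continuous χ := by fun_prop
  have hχ0 : ∀ t, 0 ≤ χ t := fun t => by simp [χ]
  have hχ1 : ∀ t, χ t ≤ 1 := fun t => by simp [χ]
  have hb : ∀ t, ‖(χ t : ℂ) • f t‖ ≤ r := by
    intro t
    rw [norm_smul, Complex.norm_real, Real.norm_of_nonneg (hχ0 t)]
    by_cases ht : T ≤ t
    · exact (mul_le_of_le_one_left (norm_nonneg _) (hχ1 t)).trans (hT t ht)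
    · have : χ t = 0 := by
        have : (t : ℝ) < T := by exact_mod_cast not_le.1 ht
        simp [χ, max_eq_left (sub_nonpos.2 this.le)]
      simpa [this] using hr
  let g : ℝ≥0 →ᵇ B := BoundedContinuousFunction.ofNormedAddCommGroup
    (fun t => (χ t : ℂ) • f t) (by fun_prop) r hb
  have hg : mkL f = mkL g := by
    rw [mkL_eq_mkL, mem_asympNull]
    refine tendsto_const_nhds.congr' ?_
    filter_upwards [eventually_ge_atTop (T + 1)] with t ht
    have : χ t = 1 := by
      have : (T : ℝ) + 1 ≤ t := by exact_mod_cast ht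
      have h1 : (1 : ℝ) ≤ max 0 ((t : ℝ) - T) := le_max_of_le_right (by linarith)
      simp [χ, h1]
    simp [g, this]
  rw [hg]
  exact (norm_mkL_le g).trans ((BoundedContinuousFunction.norm_le hr).2 hb)

instance : Mul (AsympAlg B) where
  mul := Quotient.map₂ (· * ·) fun f f' hf g g' hg => by
    rw [← Quotient.eq_iff_equiv] at *
    have hf' := (Submodule.Quotient.eq (asympNull B)).1 hf
    have hg' := (Submodule.Quotient.eq (asympNull B)).1 hg
    refine (Submodule.Quotient.eq (asympNull B)).2 ?_
    have : f * g - f' * g' = (f - f') * g + f' * (g - g') := by noncomm_ring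
    rw [this]
    exact add_mem (asympNull_mul_right hf' g) (asympNull_mul_left hg' f')

instance : Star (AsympAlg B) where
  star := Quotient.map star fun f g h => by
    rw [← Quotient.eq_iff_equiv] at *
    have h' := (Submodule.Quotient.eq (asympNull B)).1 h
    refine (Submodule.Quotient.eq (asympNull B)).2 ?_
    rw [← star_sub]
    exact asympNull_star h'

theorem mkL_mul (f g : ℝ≥0 →ᵇ B) : mkL (f * g) = mkL f * mkL g := rfl

theorem mkL_star (f : ℝ≥0 →ᵇ B) : mkL (star f) = star (mkL f) := rfl

instance : NonUnitalRing (AsympAlg B) where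
  left_distrib x y z := by
    obtain ⟨x, rfl⟩ := mkL_surjective x
    obtain ⟨y, rfl⟩ := mkL_surjective y
    obtain ⟨z, rfl⟩ := mkL_surjective z
    simp only [← mkL_mul, ← map_add, mul_add]
  right_distrib x y z := by
    obtain ⟨x, rfl⟩ := mkL_surjective x
    obtain ⟨y, rfl⟩ := mkL_surjective y
    obtain ⟨z, rfl⟩ := mkL_surjective z
    simp only [← mkL_mul, ← map_add, add_mul]
  zero_mul x := by
    obtain ⟨x, rfl⟩ := mkL_surjective x
    rw [← map_zero (mkL (B := B)), ← mkL_mul, zero_mul]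
  mul_zero x := by
    obtain ⟨x, rfl⟩ := mkL_surjective x
    rw [← map_zero (mkL (B := B)), ← mkL_mul, mul_zero]
  mul_assoc x y z := by
    obtain ⟨x, rfl⟩ := mkL_surjective x
    obtain ⟨y, rfl⟩ := mkL_surjective y
    obtain ⟨z, rfl⟩ := mkL_surjective z
    simp only [← mkL_mul, mul_assoc]

instance : StarRing (AsympAlg B) where
  star_involutive x := by
    obtain ⟨x, rfl⟩ := mkL_surjective x
    simp only [← mkL_star, star_star]
  star_mul x y := by
    obtain ⟨x, rfl⟩ := mkL_surjective x
    obtain ⟨y, rfl⟩ := mkL_surjective y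
    simp only [← mkL_star, ← mkL_mul, star_mul]
  star_add x y := by
    obtain ⟨x, rfl⟩ := mkL_surjective x
    obtain ⟨y, rfl⟩ := mkL_surjective y
    simp only [← mkL_star, ← map_add, star_add]

instance : NonUnitalNormedRing (AsympAlg B) where
  dist_eq := NormedAddCommGroup.dist_eq
  norm_mul_le x y := by
    refine le_of_forall_pos_le_add fun δ hδ => ?_
    have hc : Tendsto (fun ε : ℝ => (‖x‖ + ε) * (‖y‖ + ε)) (𝓝[>] 0) (𝓝 (‖x‖ * ‖y‖)) := by
      have : Continuous fun ε : ℝ => (‖x‖ + ε) * (‖y‖ + ε) := by fun_prop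
      simpa using (this.tendsto 0).mono_left nhdsWithin_le_nhds
    obtain ⟨ε, hε, h0⟩ := ((hc.eventually (gt_mem_nhds (lt_add_of_pos_right _ hδ))).and
      self_mem_nhdsWithin).exists
    obtain ⟨f, rfl, hf⟩ := exists_norm_lt x h0
    obtain ⟨g, rfl, hg⟩ := exists_norm_lt y h0
    calc ‖mkL f * mkL g‖ = ‖mkL (f * g)‖ := rfl
      _ ≤ ‖f‖ * ‖g‖ := (norm_mkL_le _).trans (norm_mul_le f g)
      _ ≤ (‖mkL f‖ + ε) * (‖mkL g‖ + ε) := by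
        gcongr
      _ ≤ _ := hε.le

instance : CStarRing (AsympAlg B) where
  norm_mul_self_le x := by
    obtain ⟨f, rfl⟩ := mkL_surjective x
    rw [← mkL_star, ← mkL_mul]
    refine le_of_forall_pos_le_add fun ε hε => ?_
    rw [← sq, ← Real.le_sqrt (norm_nonneg _) (by positivity)]
    refine norm_mkL_le_of_eventually (Real.sqrt_nonneg _) ?_
    filter_upwards [eventually_norm_le (star f * f) hε] with t ht
    rw [Real.le_sqrt (norm_nonneg _) (by positivity), sq, ← CStarRing.norm_star_mul_self]
    exact ht

instance : IsScalarTower ℂ (AsympAlg B) (AsympAlg B) where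
  smul_assoc c x y := by
    obtain ⟨x, rfl⟩ := mkL_surjective x
    obtain ⟨y, rfl⟩ := mkL_surjective y
    simp only [smul_eq_mul, ← mkL_mul, ← map_smul, smul_mul_assoc]

instance : SMulCommClass ℂ (AsympAlg B) (AsympAlg B) where
  smul_comm c x y := by
    obtain ⟨x, rfl⟩ := mkL_surjective x
    obtain ⟨y, rfl⟩ := mkL_surjective y
    simp only [smul_eq_mul, ← mkL_mul, ← map_smul, mul_smul_comm]

instance : StarModule ℂ (AsympAlg B) where
  star_smul c x := by
    obtain ⟨x, rfl⟩ := mkL_surjective x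
    simp only [← mkL_star, ← map_smul, star_smul]

instance : NonUnitalCStarAlgebra (AsympAlg B) where

/-- The quotient map `C_b(ℝ₊;B) → C_b(ℝ₊;B)/C₀(ℝ₊;B)`. -/
def proj : (ℝ≥0 →ᵇ B) →⋆ₙₐ[ℂ] AsympAlg B where
  toFun := mkL
  map_smul' := map_smul mkL
  map_zero' := map_zero mkL
  map_add' := map_add mkL
  map_mul' := mkL_mul
  map_star' := mkL_star

theorem proj_surjective : Function.Surjective (proj (B := B)) := mkL_surjective

theorem proj_eq_zero {f : ℝ≥0 →ᵇ B} : proj f = 0 ↔ Tendsto f atTop (𝓝 0) := by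
  rw [← map_zero (proj (B := B))]
  exact mkL_eq_mkL.trans (by rw [sub_zero, mem_asympNull])

theorem proj_eq_proj {f g : ℝ≥0 →ᵇ B} :
    proj f = proj g ↔ Tendsto (fun t => f t - g t) atTop (𝓝 0) :=
  mkL_eq_mkL

end AsympAlg

end AsympAlg

end

end FullSurj

namespace FullSurj

noncomputable section

/-! ### Functoriality of the asymptotic algebra -/

section Maps

variable {B B' : Type v} [NonUnitalCStarAlgebra B] [NonUnitalCStarAlgebra B']

namespace AsympAlg

/-- The map of asymptotic algebras that is induced by a bounded linear map. -/
def mapL (g : B →L[ℂ] B') : AsympAlg B →ₗ[ℂ] AsympAlg B' :=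
  (asympNull B).mapQ (asympNull B') (g.compLeftContinuousBounded ℝ≥0).toLinearMap fun f hf => by
    have h := (g.continuous.tendsto 0).comp (mem_asympNull.1 hf)
    rw [map_zero] at h
    exact h

theorem mapL_proj (g : B →L[ℂ] B') (f : ℝ≥0 →ᵇ B) :
    mapL g (proj f) = proj (g.compLeftContinuousBounded ℝ≥0 f) := rfl

/-- A `*`-homomorphism as a bounded linear map. -/
def _root_.FullSurj.starHomL (g : B →⋆ₙₐ[ℂ] B') : B →L[ℂ] B' where
  toFun := g
  map_add' := map_add g
  map_smul' := map_smul g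
  cont := (starHom_lipschitz g).continuous

/-- The `*`-homomorphism of asymptotic algebras that is induced by a `*`-homomorphism. -/
def mapHom (g : B →⋆ₙₐ[ℂ] B') : AsympAlg B →⋆ₙₐ[ℂ] AsympAlg B' where
  toFun := mapL (starHomL g)
  map_smul' := map_smul _
  map_zero' := map_zero _
  map_add' := map_add _
  map_mul' x y := by
    obtain ⟨x, rfl⟩ := proj_surjective x
    obtain ⟨y, rfl⟩ := proj_surjective y
    rw [← map_mul, mapL_proj, mapL_proj, mapL_proj, ← map_mul]
    congr 1
    ext t
    exact map_mul g _ _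
  map_star' x := by
    obtain ⟨x, rfl⟩ := proj_surjective x
    rw [← map_star, mapL_proj, mapL_proj, ← map_star]
    congr 1
    ext t
    exact map_star g _

theorem mapHom_proj (g : B →⋆ₙₐ[ℂ] B') (f : ℝ≥0 →ᵇ B) :
    mapHom g (proj f) = proj (f.comp g (starHom_lipschitz g)) := rfl

/-- Two functions `f, g` in `C_b(ℝ₊;B)` define the function `(f, g)` in `C_b(ℝ₊;B ⊕ B)`. -/
def pairHom : AsympAlg B × AsympAlg B →⋆ₙₐ[ℂ] AsympAlg (B × B) where
  toFun x := mapL (.inl ℂ B B) x.1 + mapL (.inr ℂ B B) x.2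
  map_smul' c x := by simp
  map_zero' := by simp
  map_add' x y := by simp only [Prod.fst_add, Prod.snd_add, map_add]; abel
  map_mul' x y := by
    obtain ⟨x₁, x₂⟩ := x
    obtain ⟨y₁, y₂⟩ := y
    obtain ⟨x₁, rfl⟩ := proj_surjective x₁
    obtain ⟨x₂, rfl⟩ := proj_surjective x₂
    obtain ⟨y₁, rfl⟩ := proj_surjective y₁
    obtain ⟨y₂, rfl⟩ := proj_surjective y₂
    simp only [Prod.mk_mul_mk, ← map_mul, mapL_proj, ← map_add]
    congr 1
    ext t <;> simp
  map_star' x := by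
    obtain ⟨x₁, x₂⟩ := x
    obtain ⟨x₁, rfl⟩ := proj_surjective x₁
    obtain ⟨x₂, rfl⟩ := proj_surjective x₂
    simp only [Prod.star_def, ← map_star, mapL_proj, ← map_add]
    congr 1
    ext t
    · simp
    · simp

theorem pairHom_proj (f g : ℝ≥0 →ᵇ B) (h : ℝ≥0 →ᵇ B × B) (hfg : ∀ t, h t = (f t, g t)) :
    pairHom (proj f, proj g) = proj h := by
  simp only [pairHom, NonUnitalStarAlgHom.coe_mk', NonUnitalAlgHom.coe_mk]
  rw [mapL_proj, mapL_proj, ← map_add]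
  congr 1
  ext t <;> simp [hfg]

/-- The sum `(x, y) ↦ s₁ x s₁^* + s₂ y s₂^*` on asymptotic algebras. -/
def sumHom (S : CuntzPair B) : AsympAlg B × AsympAlg B →⋆ₙₐ[ℂ] AsympAlg B :=
  (mapHom S.sumHom).comp pairHom

/-- Evaluation at a point of `[0,1]`. -/
def _root_.FullSurj.evalHom (s : I) : C(I, B) →⋆ₙₐ[ℂ] B where
  toFun f := f s
  map_smul' _ _ := rfl
  map_zero' := rfl
  map_add' _ _ := rfl
  map_mul' _ _ := rfl
  map_star' _ := rfl

/-- The bounded linear map `b ↦ (s ↦ h(s) b)`. -/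
def _root_.FullSurj.scaleL (h : C(I, ℂ)) : B →L[ℂ] C(I, B) :=
  LinearMap.mkContinuous
    { toFun := fun b => ⟨fun s => h s • b, by fun_prop⟩
      map_add' := fun a b => by ext s; simp
      map_smul' := fun c b => by ext s; exact smul_comm _ _ _ }
    ‖h‖ fun b => by
      rw [ContinuousMap.norm_le _ (by positivity)]
      intro s
      simpa [norm_smul] using mul_le_mul_of_nonneg_right (h.norm_coe_le_norm s) (norm_nonneg b)

@[simp]
theorem _root_.FullSurj.scaleL_apply (h : C(I, ℂ)) (b : B) (s : I) : scaleL h b s = h s • b := rfl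

/-- Multiplication by a scalar function on `[0,1]`, from the asymptotic algebra of `B` to the
asymptotic algebra of `C([0,1];B)`. -/
def scale (h : C(I, ℂ)) : AsympAlg B →ₗ[ℂ] AsympAlg C(I, B) := mapL (scaleL h)

theorem scale_mul_scale (h k : C(I, ℂ)) (x y : AsympAlg B) :
    scale h x * scale k y = scale (h * k) (x * y) := by
  obtain ⟨x, rfl⟩ := proj_surjective x
  obtain ⟨y, rfl⟩ := proj_surjective y
  rw [scale, scale, scale, ← map_mul, mapL_proj, mapL_proj, mapL_proj, ← map_mul]
  congr 1
  ext t s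
  simp [smul_mul_smul_comm]

theorem star_scale (h : C(I, ℂ)) (x : AsympAlg B) :
    star (scale h x) = scale (star h) (star x) := by
  obtain ⟨x, rfl⟩ := proj_surjective x
  rw [scale, scale, mapL_proj, ← map_star proj, ← map_star proj, mapL_proj]
  congr 1
  ext t s
  simp

theorem scale_add_left (h k : C(I, ℂ)) (x : AsympAlg B) :
    scale (h + k) x = scale h x + scale k x := by
  obtain ⟨x, rfl⟩ := proj_surjective x
  rw [scale, scale, scale, mapL_proj, mapL_proj, mapL_proj, ← map_add]
  congr 1
  ext t s
  simp [add_smul]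

theorem scale_one (x : AsympAlg B) : scale 1 x = mapHom constHom x := by
  obtain ⟨x, rfl⟩ := proj_surjective x
  rw [scale, mapL_proj, mapHom_proj]
  congr 1
  ext t s
  exact one_smul ℂ _

theorem eval_scale (h : C(I, ℂ)) (s : I) (x : AsympAlg B) :
    mapHom (evalHom s) (scale h x) = h s • x := by
  obtain ⟨x, rfl⟩ := proj_surjective x
  rw [scale, mapL_proj, mapHom_proj, ← map_smul]
  rfl

theorem eval_const (s : I) (x : AsympAlg B) : mapHom (evalHom s) (mapHom constHom x) = x := by
  obtain ⟨x, rfl⟩ := proj_surjective x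
  rfl

end AsympAlg

end Maps

/-! ### Asymptotic homomorphisms as `*`-homomorphisms to the asymptotic algebra -/

section Hom

open AsympAlg

variable {A : Type u} {C C' : Type w} [NonUnitalCStarAlgebra A] [NonUnitalCStarAlgebra C]
  [NonUnitalCStarAlgebra C'] {p : C →⋆ₙₐ[ℂ] A} {B : Type v} [NonUnitalCStarAlgebra B]

/-- The `*`-homomorphism to the asymptotic algebra that is defined by an asymptotic homomorphism. -/
def AsympHom.toHom (φ : AsympHom C B) : C →⋆ₙₐ[ℂ] AsympAlg B where
  toFun c := proj (φ.toFun c)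
  map_smul' c a := by
    rw [MonoidHom.id_apply, ← _root_.map_smul, proj_eq_proj]; exact φ.map_smul c a
  map_zero' := by
    have h := φ.map_smul 0 0
    rw [zero_smul] at h
    rw [proj_eq_zero]
    simpa using h
  map_add' a b := by rw [← _root_.map_add, proj_eq_proj]; exact φ.map_add a b
  map_mul' a b := by rw [← _root_.map_mul, proj_eq_proj]; exact φ.map_mul a b
  map_star' a := by rw [← StarHomClass.map_star, proj_eq_proj]; exact φ.map_star a

/-- A family of lifts of a `*`-homomorphism to the asymptotic algebra is an asymptotic
homomorphism. -/
def AsympHom.ofLift (α : C →⋆ₙₐ[ℂ] AsympAlg B) (g : C → ℝ≥0 →ᵇ B) (hg : ∀ c, proj (g c) = α c) :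
    AsympHom C B where
  toFun := g
  map_add a b := proj_eq_proj.1
    (by rw [_root_.map_add, hg, hg, hg, _root_.map_add] :
      proj (g (a + b)) = proj (g a + g b))
  map_smul c a := proj_eq_proj.1
    (by rw [_root_.map_smul, hg, hg, _root_.map_smul] :
      proj (g (c • a)) = proj (c • g a))
  map_mul a b := proj_eq_proj.1
    (by rw [_root_.map_mul, hg, hg, hg, _root_.map_mul] :
      proj (g (a * b)) = proj (g a * g b))
  map_star a := proj_eq_proj.1
    (by rw [StarHomClass.map_star, hg, hg, StarHomClass.map_star] :
      proj (g (star a)) = proj (star (g a)))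

/-- An asymptotic homomorphism that represents a `*`-homomorphism to the asymptotic algebra. -/
def AsympHom.ofHom (α : C →⋆ₙₐ[ℂ] AsympAlg B) : AsympHom C B :=
  .ofLift α (fun c => Function.surjInv proj_surjective (α c)) fun _ => Function.surjInv_eq _ _

theorem AsympHom.proj_ofHom (α : C →⋆ₙₐ[ℂ] AsympAlg B) (c : C) :
    AsympAlg.proj ((AsympHom.ofHom α).toFun c) = α c := Function.surjInv_eq _ _

theorem AsympPair.toHom_eq (ψ : AsympPair p B) (c : C) (hc : p c = 0) :
    ψ.plus.toHom c = ψ.minus.toHom c := proj_eq_proj.2 (ψ.agree c hc)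

/-- The pair of asymptotic homomorphisms that is represented by two `*`-homomorphisms to the
asymptotic algebra that agree on the kernel of `p`. -/
def AsympPair.ofHom (α β : C →⋆ₙₐ[ℂ] AsympAlg B) (h : ∀ c, p c = 0 → α c = β c) :
    AsympPair p B where
  plus := .ofHom α
  minus := .ofHom β
  agree c hc := proj_eq_proj.1 (by rw [AsympHom.proj_ofHom, AsympHom.proj_ofHom, h c hc])

/-- The function `s ↦ s` on `[0,1]`. -/
def unitCoord : C(I, ℂ) := ⟨fun s => ((s : ℝ) : ℂ), by fun_prop⟩

@[simp] theorem unitCoord_zero : unitCoord 0 = 0 := by simp [unitCoord]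

@[simp] theorem unitCoord_one : unitCoord 1 = 1 := by simp [unitCoord]

/-- The straight line between two functions in `C_b(ℝ₊;B)`. -/
def straightLine (f g : ℝ≥0 →ᵇ B) : ℝ≥0 →ᵇ C(I, B) :=
  (scaleL (1 - unitCoord)).compLeftContinuousBounded ℝ≥0 f +
    (scaleL unitCoord).compLeftContinuousBounded ℝ≥0 g

theorem straightLine_apply (f g : ℝ≥0 →ᵇ B) (t : ℝ≥0) (s : I) :
    straightLine f g t s = (1 - unitCoord s) • f t + unitCoord s • g t := rfl

theorem proj_straightLine {f g : ℝ≥0 →ᵇ B} (h : proj f = proj g) :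
    proj (straightLine f g) = mapHom constHom (proj f) := by
  have : proj (straightLine f g) = scale (1 - unitCoord) (proj f) + scale unitCoord (proj g) := rfl
  rw [this, ← h, ← scale_add_left, sub_add_cancel, scale_one]

/-- The straight line between two representatives lifts the constant path in the asymptotic algebra
of `C(I, B)`, and being an asymptotic homomorphism depends only on the class that is lifted. Hence
the class in `EN` depends only on the two homomorphisms to the asymptotic algebra. -/
theorem AsympPair.homotopic_of_toHom_eq {ψ φ : AsympPair p B}
    (hp : ∀ c, ψ.plus.toHom c = φ.plus.toHom c) (hm : ∀ c, ψ.minus.toHom c = φ.minus.toHom c) :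
    ψ.Homotopic φ := by
  refine ⟨{ plus := .ofLift ((mapHom constHom).comp ψ.plus.toHom)
              (fun c => straightLine (ψ.plus.toFun c) (φ.plus.toFun c))
              fun c => proj_straightLine (hp c)
            minus := .ofLift ((mapHom constHom).comp ψ.minus.toHom)
              (fun c => straightLine (ψ.minus.toFun c) (φ.minus.toFun c))
              fun c => proj_straightLine (hm c)
            agree := fun c hc => proj_eq_proj.1 ?_ }, fun c t => ?_⟩
  · exact (proj_straightLine (hp c)).trans
      ((congrArg (mapHom constHom) (ψ.toHom_eq c hc)).trans (proj_straightLine (hm c)).symm)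
  · simp [AsympHom.ofLift, straightLine_apply]

variable (p) in
/-- The class in `EN(C,J;B)` of a pair of `*`-homomorphisms to the asymptotic algebra of `B` that
agree on `J`. -/
def EN.ofHom (α β : C →⋆ₙₐ[ℂ] AsympAlg B) (h : ∀ c, p c = 0 → α c = β c) : EN p B :=
  Quot.mk _ (AsympPair.ofHom α β h)

theorem EN.mk_eq_ofHom (ψ : AsympPair p B) (α β : C →⋆ₙₐ[ℂ] AsympAlg B)
    (h : ∀ c, p c = 0 → α c = β c) (hα : ∀ c, ψ.plus.toHom c = α c)
    (hβ : ∀ c, ψ.minus.toHom c = β c) : (Quot.mk _ ψ : EN p B) = EN.ofHom p α β h :=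
  Quot.sound (AsympPair.homotopic_of_toHom_eq
    (fun c => (hα c).trans (AsympHom.proj_ofHom α c).symm)
    (fun c => (hβ c).trans (AsympHom.proj_ofHom β c).symm))

theorem EN.mk_eq_ofHom_toHom (ψ : AsympPair p B) :
    (Quot.mk _ ψ : EN p B) = EN.ofHom p ψ.plus.toHom ψ.minus.toHom ψ.toHom_eq :=
  EN.mk_eq_ofHom ψ _ _ _ (fun _ => rfl) (fun _ => rfl)

theorem EN.exists_eq_ofHom (x : EN p B) : ∃ α β h, x = EN.ofHom p α β h := by
  obtain ⟨ψ⟩ := x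
  exact ⟨_, _, _, EN.mk_eq_ofHom_toHom ψ⟩

/-- Definitional, because the representative chosen at a point depends only on the value of the
homomorphism there. -/
theorem EN.comap_ofHom {p' : C' →⋆ₙₐ[ℂ] A} (f : C' →⋆ₙₐ[ℂ] C) (hf : ∀ c, p (f c) = p' c)
    (α β : C →⋆ₙₐ[ℂ] AsympAlg B) (h : ∀ c, p c = 0 → α c = β c)
    (h' : ∀ c, p' c = 0 → α.comp f c = β.comp f c) :
    EN.comap f hf (EN.ofHom p α β h) = EN.ofHom p' (α.comp f) (β.comp f) h' := rfl

/-- A homotopy, given by `*`-homomorphisms to the asymptotic algebra of `C([0,1];B)`. -/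
theorem EN.ofHom_eq_of_homotopy (H K : C →⋆ₙₐ[ℂ] AsympAlg C(I, B))
    (hHK : ∀ c, p c = 0 → H c = K c) (α₀ β₀ α₁ β₁ : C →⋆ₙₐ[ℂ] AsympAlg B)
    (h₀ : ∀ c, p c = 0 → α₀ c = β₀ c) (h₁ : ∀ c, p c = 0 → α₁ c = β₁ c)
    (hα₀ : ∀ c, mapHom (evalHom 0) (H c) = α₀ c) (hβ₀ : ∀ c, mapHom (evalHom 0) (K c) = β₀ c)
    (hα₁ : ∀ c, mapHom (evalHom 1) (H c) = α₁ c) (hβ₁ : ∀ c, mapHom (evalHom 1) (K c) = β₁ c) :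
    EN.ofHom p α₀ β₀ h₀ = EN.ofHom p α₁ β₁ h₁ := by
  let ψ := AsympPair.ofHom (p := p) H K hHK
  -- The endpoints of the chosen representatives of H and K match the given homomorphisms only
  -- modulo null functions; `EN.mk_eq_ofHom` absorbs the difference.
  let ev (s : I) : AsympPair p B :=
    { plus := ψ.plus.map (evalHom s)
      minus := ψ.minus.map (evalHom s)
      agree := fun c hc => by
        simpa [AsympHom.map] using tendsto_starHom (evalHom s) (ψ.agree c hc) }
  have hev : (ev 0).Homotopic (ev 1) := ⟨ψ, fun c t => ⟨rfl, rfl, rfl, rfl⟩⟩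
  have hp : ∀ s c, (ev s).plus.toHom c = mapHom (evalHom s) (H c) := fun s c => by
    rw [← AsympHom.proj_ofHom H c]; rfl
  have hm : ∀ s c, (ev s).minus.toHom c = mapHom (evalHom s) (K c) := fun s c => by
    rw [← AsympHom.proj_ofHom K c]; rfl
  rw [← EN.mk_eq_ofHom (ev 0) α₀ β₀ h₀ (fun c => (hp 0 c).trans (hα₀ c))
      (fun c => (hm 0 c).trans (hβ₀ c)),
    ← EN.mk_eq_ofHom (ev 1) α₁ β₁ h₁ (fun c => (hp 1 c).trans (hα₁ c))
      (fun c => (hm 1 c).trans (hβ₁ c))]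
  exact Quot.sound hev

theorem AsympPair.Homotopic.exists_hom {ψ₀ ψ₁ : AsympPair p B} (h : ψ₀.Homotopic ψ₁) :
    ∃ H K : C →⋆ₙₐ[ℂ] AsympAlg C(I, B), (∀ c, p c = 0 → H c = K c) ∧
      (∀ c, mapHom (evalHom 0) (H c) = ψ₀.plus.toHom c) ∧
      (∀ c, mapHom (evalHom 0) (K c) = ψ₀.minus.toHom c) ∧
      (∀ c, mapHom (evalHom 1) (H c) = ψ₁.plus.toHom c) ∧
      (∀ c, mapHom (evalHom 1) (K c) = ψ₁.minus.toHom c) := by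
  obtain ⟨H, hH⟩ := h
  refine ⟨H.plus.toHom, H.minus.toHom, H.toHom_eq, ?_, ?_, ?_, ?_⟩
  · exact fun c => congrArg proj (BoundedContinuousFunction.ext fun t => (hH c t).1)
  · exact fun c => congrArg proj (BoundedContinuousFunction.ext fun t => (hH c t).2.1)
  · exact fun c => congrArg proj (BoundedContinuousFunction.ext fun t => (hH c t).2.2.1)
  · exact fun c => congrArg proj (BoundedContinuousFunction.ext fun t => (hH c t).2.2.2)

theorem EN.add_ofHom (S : CuntzPair B) (α β α' β' : C →⋆ₙₐ[ℂ] AsympAlg B)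
    (h : ∀ c, p c = 0 → α c = β c) (h' : ∀ c, p c = 0 → α' c = β' c)
    (h'' : ∀ c, p c = 0 →
      (sumHom S).comp (α.prod α') c = (sumHom S).comp (β.prod β') c) :
    EN.add S (EN.ofHom p α β h) (EN.ofHom p α' β' h') =
      EN.ofHom p ((sumHom S).comp (α.prod α')) ((sumHom S).comp (β.prod β')) h'' := by
  have key : ∀ (γ γ' : C →⋆ₙₐ[ℂ] AsympAlg B) (c : C),
      (S.add (AsympHom.ofHom γ) (AsympHom.ofHom γ')).toHom c = sumHom S (γ c, γ' c) := by
    intro γ γ' c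
    rw [← AsympHom.proj_ofHom γ c, ← AsympHom.proj_ofHom γ' c]
    exact congrArg (mapHom S.sumHom) (pairHom_proj _ _ _ fun t => rfl).symm
  exact EN.mk_eq_ofHom _ _ _ _ (key α α') (key β β')

end Hom

end

end FullSurj

namespace FullSurj

noncomputable section

/-! ### Lifting self-adjoint elements; ranges of `*`-homomorphisms -/

section Lift

variable {C : Type u} {D : Type v} [NonUnitalCStarAlgebra C] [NonUnitalCStarAlgebra D]

/-- A self-adjoint element in the range of a `*`-homomorphism has a self-adjoint lift of the same
norm. -/
theorem exists_selfAdjoint_lift (f : C →⋆ₙₐ[ℂ] D) {a : D} (ha : IsSelfAdjoint a)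
    (hr : a ∈ Set.range f) {r : ℝ} (har : ‖a‖ ≤ r) :
    ∃ c, IsSelfAdjoint c ∧ ‖c‖ ≤ r ∧ f c = a := by
  obtain ⟨b, rfl⟩ := hr
  have hr0 : 0 ≤ r := (norm_nonneg _).trans har
  let c : C := (2⁻¹ : ℝ) • (b + star b)
  have hc : IsSelfAdjoint c := by
    simp [c, IsSelfAdjoint, add_comm]
  have hfc : f c = f b := by
    have h1 : c = (2⁻¹ : ℂ) • (b + star b) := by
      simp only [c, ← Complex.coe_smul]; simp
    rw [h1, map_smul, map_add, StarHomClass.map_star, ha.star_eq, ← two_smul ℂ, smul_smul]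
    norm_num
  -- Truncation to [-r, r]. It is the identity on the spectrum of the given element, whose norm is
  -- at most r, so applying it to a self-adjoint lift does not change the image.
  let g : ℝ → ℝ := fun x => max (-r) (min r x)
  have hg0 : g 0 = 0 := by simp [g, hr0]
  have hgc : Continuous g := by fun_prop
  refine ⟨cfcₙ g c, cfcₙ_predicate g c, ?_, ?_⟩
  · refine norm_cfcₙ_le fun x _ => ?_
    rw [Real.norm_eq_abs, abs_le]
    exact ⟨le_max_left _ _, max_le (by linarith) (min_le_left _ _)⟩
  · have hcont : Continuous f :=
      (AddMonoidHomClass.lipschitz_of_bound_nnnorm f 1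
        (by simpa using NonUnitalStarAlgHom.nnnorm_apply_le f)).continuous
    have hfb : IsSelfAdjoint (f c) := by rw [hfc]; exact ha
    rw [NonUnitalStarAlgHom.map_cfcₙ f g c hgc.continuousOn hg0 hcont hc hfb, hfc]
    conv_rhs => rw [← cfcₙ_id' ℝ (f b) ha]
    refine cfcₙ_congr fun x hx => ?_
    have h1 := norm_apply_le_norm_cfcₙ (fun x : ℝ => x) (f b) hx
    rw [cfcₙ_id' ℝ (f b) ha] at h1
    have h2 := abs_le.1 (h1.trans har)
    simp only [g]
    rw [min_eq_right h2.2, max_eq_right h2.1]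

/-- The range of a `*`-homomorphism is closed. -/
theorem isClosed_range (f : C →⋆ₙₐ[ℂ] D) : IsClosed (Set.range f) := by
  let F : NormedAddGroupHom C D := (f : C →+ D).mkNormedAddGroupHom 1 fun c => by
    simpa using NonUnitalStarAlgHom.norm_apply_le f c
  have hF : ∀ c, F c = f c := fun _ => rfl
  -- The real and imaginary parts lift without increase of norm, which gives lifts with constant 2.
  -- With completeness such a bound puts the closure of the range inside the range.
  have h : F.SurjectiveOnWith F.range 2 := by
    intro a ha
    obtain ⟨b, rfl⟩ := (F.mem_range _).1 ha
    rw [hF]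
    have hre : f ((realPart b : selfAdjoint C) : C) = realPart (f b) := by
      simp [realPart_apply_coe, StarHomClass.map_star, ← Complex.coe_smul]
    have him : f ((imaginaryPart b : selfAdjoint C) : C) = imaginaryPart (f b) := by
      simp [imaginaryPart_apply_coe, StarHomClass.map_star, ← Complex.coe_smul]
    obtain ⟨x, -, hx, hx'⟩ := exists_selfAdjoint_lift f (realPart (f b)).2 ⟨_, hre⟩
      (realPart.norm_le (f b))
    obtain ⟨y, -, hy, hy'⟩ := exists_selfAdjoint_lift f (imaginaryPart (f b)).2 ⟨_, him⟩
      (imaginaryPart.norm_le (f b))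
    refine ⟨x + Complex.I • y, ?_, ?_⟩
    · rw [hF, map_add, map_smul, hx', hy', realPart_add_I_smul_imaginaryPart]
    · calc ‖x + Complex.I • y‖ ≤ ‖x‖ + ‖Complex.I • y‖ := norm_add_le _ _
        _ = ‖x‖ + ‖y‖ := by rw [norm_smul]; simp
        _ ≤ 2 * ‖f b‖ := by linarith
  have h2 := controlled_closure_of_complete two_pos one_pos h
  rw [← closure_subset_iff_isClosed]
  intro a ha
  obtain ⟨c, hc, -⟩ := h2 a ha
  exact ⟨c, hc⟩

theorem surjective_of_denseRange (f : C →⋆ₙₐ[ℂ] D) (h : DenseRange f) :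
    Function.Surjective f := by
  rw [← Set.range_eq_univ, ← (isClosed_range f).closure_eq]
  exact h.closure_eq

end Lift

/-! ### Functional calculus for `C`-valued functions on `[0,1]` -/

section Bernstein

variable {C : Type u} [NonUnitalCStarAlgebra C] {R : Type v} [CStarAlgebra R]

theorem continuous_comp_projIcc (f : C(I, ℝ)) :
    Continuous fun x : ℝ => f (Set.projIcc 0 1 zero_le_one x) :=
  f.continuous.comp continuous_projIcc

/-- The functional calculus `f ↦ f(w)` for functions on `[0,1]`, extended to be constant on both
sides of this interval. -/
def unitCalculus (w : R) (hw : IsSelfAdjoint w) : C(I, ℝ) →ₐ[ℝ] R where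
  toFun f := cfc (fun x : ℝ => f (Set.projIcc 0 1 zero_le_one x)) w
  map_one' := cfc_const_one ℝ w
  map_mul' f g := cfc_mul _ _ w (continuous_comp_projIcc f).continuousOn
    (continuous_comp_projIcc g).continuousOn
  map_zero' := cfc_const_zero ℝ w
  map_add' f g := cfc_add _ _ _ (continuous_comp_projIcc f).continuousOn
    (continuous_comp_projIcc g).continuousOn
  commutes' r := cfc_const r w

variable {w : R} (hw : IsSelfAdjoint w)

theorem norm_unitCalculus_le (f : C(I, ℝ)) : ‖unitCalculus w hw f‖ ≤ ‖f‖ :=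
  norm_cfc_le (norm_nonneg _) fun _ _ => f.norm_coe_le_norm _

theorem unitCalculus_isSelfAdjoint (f : C(I, ℝ)) : IsSelfAdjoint (unitCalculus w hw f) :=
  cfc_predicate _ w

theorem unitCalculus_commute (f : C(I, ℝ)) {x : R} (hx : Commute w x) :
    Commute (unitCalculus w hw f) x := hx.cfc_real _

theorem unitCalculus_nonneg [PartialOrder R] [StarOrderedRing R] {f : C(I, ℝ)}
    (hf : ∀ s, 0 ≤ f s) : 0 ≤ unitCalculus w hw f := cfc_nonneg fun _ _ => hf _

theorem map_unitCalculus {R' : Type w} [CStarAlgebra R'] (g : R →⋆ₐ[ℂ] R') (f : C(I, ℝ)) :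
    g (unitCalculus w hw f) = unitCalculus (g w) (hw.map g) f :=
  StarAlgHomClass.map_cfc g _ w (continuous_comp_projIcc f).continuousOn
    (AddMonoidHomClass.continuous_of_bound g 1
      (by simpa using NonUnitalStarAlgHom.norm_apply_le g))
    hw (hw.map g)

/-- If `w x = c x`, then `f(w) x = f(c) x`. -/
theorem cfc_mul_of_mul_eq_smul (hw : IsSelfAdjoint w) {x : R} {c : ℝ} (h : w * x = c • x)
    {f : ℝ → ℝ}
    (hf : Continuous f) : cfc f w * x = f c • x := by
  by_cases hc : c ∈ spectrum ℝ w
  · have key : ∀ g : C(spectrum ℝ w, ℝ), cfcHom hw g * x = g ⟨c, hc⟩ • x := by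
      intro g
      induction g using ContinuousMap.induction_on_of_compact with
      | const r =>
        have : (ContinuousMap.const (spectrum ℝ w) r) = algebraMap ℝ _ r := rfl
        rw [this, AlgHomClass.commutes, Algebra.algebraMap_eq_smul_one, smul_mul_assoc, one_mul]
        simp
      | id =>
        rw [cfcHom_id hw, h]; rfl
      | star_id =>
        rw [map_star, cfcHom_id hw, hw.star_eq, h]; rfl
      | add f g hf hg => simp [add_mul, hf, hg, add_smul]
      | mul f g hf hg => rw [map_mul, mul_assoc, hg, mul_smul_comm, hf, smul_smul]; simp [mul_comm]
      | frequently f hf =>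
        have hcl : IsClosed {g : C(spectrum ℝ w, ℝ) | cfcHom hw g * x = g ⟨c, hc⟩ • x} := by
          have := cfcHom_continuous (R := ℝ) hw
          exact isClosed_eq (by fun_prop) (by fun_prop)
        exact hcl.closure_eq.subset (mem_closure_iff_frequently.2 hf)
    rw [cfc_apply f w hw hf.continuousOn, key]
    rfl
  -- If c is outside the spectrum, w - c is invertible and kills x, so x = 0.
  · have hu : IsUnit (algebraMap ℝ R c - w) := by simpa [spectrum.mem_iff] using hc
    have hx : (algebraMap ℝ R c - w) * x = 0 := by
      rw [sub_mul, h, Algebra.algebraMap_eq_smul_one, smul_mul_assoc, one_mul, sub_self]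
    have : x = 0 := by simpa using hu.mul_right_eq_zero.1 hx
    simp [this]

theorem unitCalculus_mul_of_mul_eq_smul {x : R} (c : I) (h : w * x = (c : ℝ) • x) (f : C(I, ℝ)) :
    unitCalculus w hw f * x = f c • x := by
  have := cfc_mul_of_mul_eq_smul hw h (continuous_comp_projIcc f)
  rwa [Set.projIcc_val] at this

end Bernstein

end

end FullSurj

namespace FullSurj

noncomputable section

/-! ### Calculus for `C`-valued functions as a limit of Bernstein operators. -/

section FunctionCalculus

variable {C : Type u} [NonUnitalCStarAlgebra C] {R : Type v} [CStarAlgebra R]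

/-- A convex combination of elements `x_k` of norm `≤ M`, with positive coefficients `h_k` that
commute with the `x_k` and with each other, has norm `≤ M`. -/
theorem norm_sum_mul_le {ι : Type*} [Fintype ι] [PartialOrder R] [StarOrderedRing R]
    (h x : ι → R) {M : ℝ} (hM : 0 ≤ M) (h0 : ∀ k l, 0 ≤ h k * h l) (hk : ∀ k, 0 ≤ h k)
    (hc : ∀ k l, Commute (h k) (x l)) (hc' : ∀ k l, Commute (h k) (h l)) (h1 : ∑ k, h k = 1)
    (hx : ∀ k, ‖x k‖ ≤ M) : ‖∑ k, h k * x k‖ ≤ M := by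
  have hs : ∀ k, star (h k) = h k := fun k => (IsSelfAdjoint.of_nonneg (hk k)).star_eq
  have hcs : ∀ k l, Commute (h k) (star (x l)) := fun k l => by
    have := (hc k l).star_star
    rwa [hs] at this
  set S := ∑ k, h k * x k with hS
  have hstarS : star S = ∑ k, h k * star (x k) := by
    simp only [hS, star_sum, star_mul, hs]
    exact Finset.sum_congr rfl fun k _ => (hcs k k).eq.symm
  let P : R := ∑ k, h k * (star (x k) * x k)
  have e1 : ∑ k, ∑ l, h k * h l * (star (x k) * x k) = P := by
    refine Finset.sum_congr rfl fun k _ => ?_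
    rw [← Finset.sum_mul, ← Finset.mul_sum, h1, mul_one]
  have e2 : ∑ k, ∑ l, h k * h l * (star (x l) * x l) = P := by
    rw [Finset.sum_comm]
    refine Finset.sum_congr rfl fun k _ => ?_
    rw [← Finset.sum_mul, ← Finset.sum_mul, h1, one_mul]
  have e3 : ∑ k, ∑ l, h k * h l * (star (x k) * x l) = star S * S := by
    rw [hstarS, hS, Finset.sum_mul_sum]
    refine Finset.sum_congr rfl fun k _ => Finset.sum_congr rfl fun l _ => ?_
    rw [mul_assoc, ← mul_assoc (h l), (hcs l k).eq, mul_assoc, mul_assoc]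
  have e4 : ∑ k, ∑ l, h k * h l * (star (x l) * x k) = star S * S := by
    rw [Finset.sum_comm, ← e3]
    refine Finset.sum_congr rfl fun k _ => Finset.sum_congr rfl fun l _ => ?_
    rw [(hc' l k).eq]
  -- The variance identity: the sum of h_k h_l |x_k - x_l|² over k and l equals twice the mean of
  -- the |x_k|² minus twice |S|². Positivity of the left side gives S*S ≤ P.
  have e5 : ∑ k, ∑ l, star (x k - x l) * (h k * h l) * (x k - x l)
      = (P - star S * S) + (P - star S * S) := by
    have : ∀ k l, star (x k - x l) * (h k * h l) * (x k - x l) =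
        (h k * h l * (star (x k) * x k) - h k * h l * (star (x k) * x l))
        + (h k * h l * (star (x l) * x l) - h k * h l * (star (x l) * x k)) := by
      intro k l
      have hcomm : Commute (star (x k - x l)) (h k * h l) := by
        rw [star_sub]
        exact (((hcs k k).symm.sub_left (hcs k l).symm)).mul_right
          ((hcs l k).symm.sub_left (hcs l l).symm)
      rw [hcomm.eq, star_sub]
      noncomm_ring
    simp only [this, Finset.sum_add_distrib, Finset.sum_sub_distrib, e1, e2, e3, e4]
  have h5 : 0 ≤ (P - star S * S) + (P - star S * S) := by
    rw [← e5]
    exact Finset.sum_nonneg fun k _ => Finset.sum_nonneg fun l _ =>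
      star_left_conjugate_nonneg (h0 k l) _
  have h6 : star S * S ≤ P := by
    have : 0 ≤ (2⁻¹ : ℝ) • ((P - star S * S) + (P - star S * S)) :=
      smul_nonneg (by norm_num) h5
    rw [← two_smul ℝ, smul_smul] at this
    norm_num at this
    exact this
  have h7 : P ≤ algebraMap ℝ R (M ^ 2) := by
    have : algebraMap ℝ R (M ^ 2) = ∑ k, h k * algebraMap ℝ R (M ^ 2) := by
      rw [← Finset.sum_mul, h1, one_mul]
    rw [this]
    refine Finset.sum_le_sum fun k _ => ?_
    rw [← sub_nonneg, ← mul_sub]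
    have hle : star (x k) * x k ≤ algebraMap ℝ R (M ^ 2) :=
      CStarAlgebra.star_mul_le_algebraMap_norm_sq.trans
        (algebraMap_mono R (pow_le_pow_left₀ (norm_nonneg _) (hx k) 2))
    refine Commute.mul_nonneg (hk k) (sub_nonneg.2 hle) ?_
    exact (Algebra.commute_algebraMap_right _ _).sub_right ((hcs k k).mul_right (hc k k))
  have h8 : ‖star S * S‖ ≤ M ^ 2 :=
    (CStarAlgebra.norm_le_iff_le_algebraMap _ (by positivity) (star_mul_self_nonneg S)).2
      (h6.trans h7)
  rw [CStarRing.norm_star_mul_self] at h8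
  nlinarith [norm_nonneg S]

open bernstein in
/-- The operator `F ↦ ∑_k b_{n,k}(w) φ(F(k/n))` on `C`-valued functions on `[0,1]`. -/
def bernsteinSum (w : R) (hw : IsSelfAdjoint w) (φ : C →⋆ₙₐ[ℂ] R) (n : ℕ) : C(I, C) →ₗ[ℂ] R where
  toFun F := ∑ k : Fin (n + 1), unitCalculus w hw (bernstein n k) * φ (F (z k))
  map_add' F G := by simp [mul_add, Finset.sum_add_distrib]
  map_smul' c F := by simp [Finset.smul_sum]

variable {w : R} (hw : IsSelfAdjoint w) {φ : C →⋆ₙₐ[ℂ] R}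

open bernstein in
theorem bernsteinSum_apply (n : ℕ) (F : C(I, C)) : bernsteinSum w hw φ n F =
    ∑ k : Fin (n + 1), unitCalculus w hw (bernstein n k) * φ (F (z k)) := rfl

/-- The elements b_{n,k}(w) are positive, commute with each other and with the range of φ, and sum
to 1. The bound is uniform in n, so convergence only needs to be checked on a dense set. -/
theorem norm_bernsteinSum_le (hφ : ∀ c, Commute w (φ c)) (n : ℕ) (F : C(I, C)) :
    ‖bernsteinSum w hw φ n F‖ ≤ ‖F‖ := by
  let _ := CStarAlgebra.spectralOrder R
  let _ := CStarAlgebra.spectralOrderedRing R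
  rw [bernsteinSum_apply]
  refine norm_sum_mul_le (R := R) _ _ (norm_nonneg F) (fun k l => ?_) (fun k => ?_) (fun k l => ?_)
    (fun k l => ?_) ?_ (fun k => ?_)
  · rw [← map_mul]
    exact unitCalculus_nonneg hw fun s => mul_nonneg bernstein_nonneg bernstein_nonneg
  · exact unitCalculus_nonneg hw fun s => bernstein_nonneg
  · exact unitCalculus_commute hw _ (hφ _)
  · rw [commute_iff_eq, ← map_mul, mul_comm, map_mul]
  · rw [← map_sum, ← map_one (unitCalculus w hw)]
    congr 1
    ext s
    simp
  · exact (NonUnitalStarAlgHom.norm_apply_le φ _).trans (F.norm_coe_le_norm _)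

/-- On an elementary tensor the operator gives (B_n f)(w) φ(c), where B_n f is the scalar Bernstein
polynomial, and B_n f converges uniformly to f. -/
theorem tendsto_bernsteinSum_smul_const (f : C(I, ℝ)) (c : C) :
    Tendsto (fun n => bernsteinSum w hw φ n (f • .const I c)) atTop
      (𝓝 (unitCalculus w hw f * φ c)) := by
  have h1 : ∀ n, bernsteinSum w hw φ n (f • .const I c) =
      unitCalculus w hw (bernsteinApproximation n f) * φ c := by
    intro n
    have hφr : ∀ (r : ℝ) (a : C), φ (r • a) = r • φ a := fun r a => by
      rw [← Complex.coe_smul, map_smul, Complex.coe_smul]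
    rw [bernsteinSum_apply, bernsteinApproximation, map_sum, Finset.sum_mul]
    refine Finset.sum_congr rfl fun k _ => ?_
    have h2 : (bernstein n k • ContinuousMap.const I (f (bernstein.z k)) : C(I, ℝ)) =
        f (bernstein.z k) • bernstein n k := by
      ext s; simp [mul_comm]
    rw [h2, map_smul, smul_mul_assoc, ← mul_smul_comm, ← hφr]
    rfl
  have h2 : Continuous (unitCalculus w hw) :=
    AddMonoidHomClass.continuous_of_bound _ 1 (by simp [norm_unitCalculus_le hw])
  simp only [h1]
  exact ((h2.tendsto f).comp (bernsteinApproximation_uniform f)).mul_const _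

/-- The Bernstein approximations of F are finite sums of elementary tensors, where convergence is
known; contractivity carries the Cauchy property over to F. -/
theorem exists_tendsto_bernsteinSum (hφ : ∀ c, Commute w (φ c)) (F : C(I, C)) :
    ∃ l, Tendsto (fun n => bernsteinSum w hw φ n F) atTop (𝓝 l) := by
  refine cauchySeq_tendsto_of_complete (Metric.cauchySeq_iff'.2 fun ε hε => ?_)
  obtain ⟨m, hm⟩ := ((Metric.tendsto_nhds.1 (bernsteinApproximation_uniform F)) (ε / 4)
    (by positivity)).exists
  set G := bernsteinApproximation m F
  have hG : CauchySeq fun n => bernsteinSum w hw φ n G := by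
    have : Tendsto (fun n => bernsteinSum w hw φ n G) atTop (𝓝 (∑ k : Fin (m + 1),
        unitCalculus w hw (bernstein m k) * φ (F (bernstein.z k)))) := by
      simp only [G, bernsteinApproximation, map_sum]
      exact tendsto_finsetSum _ fun k _ => tendsto_bernsteinSum_smul_const hw _ _
    exact this.cauchySeq
  obtain ⟨N, hN⟩ := Metric.cauchySeq_iff'.1 hG (ε / 4) (by positivity)
  have hFG : ∀ n, dist (bernsteinSum w hw φ n F) (bernsteinSum w hw φ n G) < ε / 4 := fun n => by
    rw [dist_eq_norm, ← map_sub]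
    refine (norm_bernsteinSum_le hw hφ n _).trans_lt ?_
    rwa [← dist_eq_norm, dist_comm]
  refine ⟨N, fun n hn => ?_⟩
  have h1 := hFG n
  have h2 := hFG N
  have h3 := hN n hn
  rw [dist_comm] at h2
  linarith [dist_triangle4 (bernsteinSum w hw φ n F) (bernsteinSum w hw φ n G)
    (bernsteinSum w hw φ N G) (bernsteinSum w hw φ N F)]

variable (hφ : ∀ c, Commute w (φ c))

/-- The limit of the operators `bernsteinSum`. -/
def calculusL : C(I, C) →L[ℂ] R :=
  LinearMap.mkContinuous
    { toFun := fun F => (exists_tendsto_bernsteinSum hw hφ F).choose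
      map_add' := fun F G => tendsto_nhds_unique (exists_tendsto_bernsteinSum hw hφ _).choose_spec
        (by simpa using (exists_tendsto_bernsteinSum hw hφ F).choose_spec.add
              (exists_tendsto_bernsteinSum hw hφ G).choose_spec)
      map_smul' := fun c F => tendsto_nhds_unique
        (exists_tendsto_bernsteinSum hw hφ _).choose_spec
        (by simpa using (exists_tendsto_bernsteinSum hw hφ F).choose_spec.const_smul c) } 1
    fun F => by
      rw [one_mul]
      exact le_of_tendsto (exists_tendsto_bernsteinSum hw hφ F).choose_spec.norm
        (.of_forall fun n => norm_bernsteinSum_le hw hφ n F)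

theorem tendsto_calculusL (F : C(I, C)) :
    Tendsto (fun n => bernsteinSum w hw φ n F) atTop (𝓝 (calculusL hw hφ F)) :=
  (exists_tendsto_bernsteinSum hw hφ F).choose_spec

theorem calculusL_smul_const (f : C(I, ℝ)) (c : C) :
    calculusL hw hφ (f • .const I c) = unitCalculus w hw f * φ c :=
  tendsto_nhds_unique (tendsto_calculusL hw hφ _) (tendsto_bernsteinSum_smul_const hw f c)

/-- On elementary tensors this is multiplicativity of f ↦ f(w) and of φ, plus commutation; Bernstein
approximation and continuity give the general case. -/
theorem calculusL_mul (F G : C(I, C)) :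
    calculusL hw hφ (F * G) = calculusL hw hφ F * calculusL hw hφ G := by
  have h1 : ∀ n, calculusL hw hφ (bernsteinApproximation n F * bernsteinApproximation n G) =
      calculusL hw hφ (bernsteinApproximation n F) *
        calculusL hw hφ (bernsteinApproximation n G) := by
    intro n
    have h2 : ∀ (f g : C(I, ℝ)) (c d : C), (f • .const I c) * (g • .const I d) =
        (f * g) • ContinuousMap.const I (c * d) := by
      intro f g c d; ext s; simp [smul_mul_smul_comm]
    simp only [bernsteinApproximation, Finset.sum_mul_sum, map_sum, h2, calculusL_smul_const,
      map_mul]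
    refine Finset.sum_congr rfl fun k _ => Finset.sum_congr rfl fun l _ => ?_
    rw [mul_assoc, ← mul_assoc _ (φ _), (unitCalculus_commute hw (bernstein n l) (hφ _)).eq]
    simp only [mul_assoc]
  have hF := bernsteinApproximation_uniform F
  have hG := bernsteinApproximation_uniform G
  have hc := (calculusL hw hφ).continuous
  refine tendsto_nhds_unique (((hc.tendsto _).comp (hF.mul hG)).congr h1) ?_
  exact ((hc.tendsto _).comp hF).mul ((hc.tendsto _).comp hG)

theorem calculusL_star (F : C(I, C)) : calculusL hw hφ (star F) = star (calculusL hw hφ F) := by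
  refine tendsto_nhds_unique (tendsto_calculusL hw hφ _) ?_
  refine (tendsto_calculusL hw hφ F).star.congr fun n => ?_
  simp only [bernsteinSum_apply, star_sum, star_mul]
  refine Finset.sum_congr rfl fun k _ => ?_
  rw [(unitCalculus_isSelfAdjoint hw _).star_eq, ← StarHomClass.map_star,
    (unitCalculus_commute hw _ (hφ _)).eq]
  rfl

end FunctionCalculus

end

end FullSurj

namespace FullSurj

noncomputable section

/-! ### Properties of the functional calculus -/

section CalculusProperties

variable {C C' : Type u} [NonUnitalCStarAlgebra C] [NonUnitalCStarAlgebra C']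
  {R : Type v} [CStarAlgebra R] {R' : Type w} [CStarAlgebra R']

/-- Where w acts as the scalar s, f(w) acts as f(s). Two instances matter, with w = 1 - e: s = 1,
when e annihilates the differences of α and β, and s = 0 with ψ = 0, when e is a unit for the values
of α. -/
theorem calculusL_sub_calculusL {w : R} (hw : IsSelfAdjoint w) {φ ψ : C →⋆ₙₐ[ℂ] R}
    (hφ : ∀ c, Commute w (φ c)) (hψ : ∀ c, Commute w (ψ c)) (F : C(I, C)) (s : I)
    (h : ∀ r, w * (φ (F r) - ψ (F r)) = (s : ℝ) • (φ (F r) - ψ (F r))) :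
    calculusL hw hφ F - calculusL hw hψ F = φ (F s) - ψ (F s) := by
  have hr : ∀ (φ : C →⋆ₙₐ[ℂ] R) (r : ℝ) (a : C), φ (r • a) = r • φ a := fun φ r a => by
    rw [← Complex.coe_smul, map_smul, Complex.coe_smul]
  have h1 : ∀ n, bernsteinSum w hw φ n F - bernsteinSum w hw ψ n F =
      φ (bernsteinApproximation n F s) - ψ (bernsteinApproximation n F s) := by
    intro n
    rw [bernsteinSum_apply, bernsteinSum_apply, ← Finset.sum_sub_distrib,
      bernsteinApproximation.apply, map_sum, map_sum, ← Finset.sum_sub_distrib]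
    refine Finset.sum_congr rfl fun k _ => ?_
    rw [← mul_sub, unitCalculus_mul_of_mul_eq_smul hw s (h _), hr, hr, smul_sub]
  have hcont : ∀ φ : C →⋆ₙₐ[ℂ] R, Continuous φ := fun φ =>
    AddMonoidHomClass.continuous_of_bound φ 1 (by simpa using NonUnitalStarAlgHom.norm_apply_le φ)
  have h2 : Tendsto (fun n => bernsteinApproximation n F s) atTop (𝓝 (F s)) :=
    ((continuous_eval_const (F := C(I, C)) s).tendsto F).comp (bernsteinApproximation_uniform F)
  refine tendsto_nhds_unique
    ((tendsto_calculusL hw hφ F).sub (tendsto_calculusL hw hψ F)) ?_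
  simp only [h1]
  exact (((hcont φ).tendsto _).comp h2).sub (((hcont ψ).tendsto _).comp h2)

theorem map_calculusL {w : R} (hw : IsSelfAdjoint w) {φ : C →⋆ₙₐ[ℂ] R}
    (hφ : ∀ c, Commute w (φ c)) (g : R →⋆ₐ[ℂ] R') {w' : R'} (hw' : IsSelfAdjoint w')
    {φ' : C →⋆ₙₐ[ℂ] R'} (hφ' : ∀ c, Commute w' (φ' c)) (hgw : g w = w')
    (hgφ : ∀ c, g (φ c) = φ' c) (F : C(I, C)) :
    g (calculusL hw hφ F) = calculusL hw' hφ' F := by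
  subst hgw
  have hcont : Continuous g :=
    AddMonoidHomClass.continuous_of_bound g 1 (by simpa using NonUnitalStarAlgHom.norm_apply_le g)
  refine tendsto_nhds_unique (((hcont.tendsto _).comp (tendsto_calculusL hw hφ F)).congr
    fun n => ?_) (tendsto_calculusL hw' hφ' F)
  simp [bernsteinSum_apply, map_unitCalculus, hgφ]

/-- Composition of a function on `[0,1]` with a `*`-homomorphism. -/
def compHom (f : C →⋆ₙₐ[ℂ] C') : C(I, C) →⋆ₙₐ[ℂ] C(I, C') where
  toFun F := ⟨fun s => f (F s), (starHom_lipschitz f).continuous.comp F.continuous⟩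
  map_smul' c F := by ext s; exact map_smul f c (F s)
  map_zero' := by ext s; exact map_zero f
  map_add' F G := by ext s; exact map_add f (F s) (G s)
  map_mul' F G := by ext s; exact map_mul f (F s) (G s)
  map_star' F := by ext s; exact map_star f (F s)

@[simp]
theorem compHom_apply (f : C →⋆ₙₐ[ℂ] C') (F : C(I, C)) (s : I) : compHom f F s = f (F s) := rfl

theorem calculusL_compHom {w : R} (hw : IsSelfAdjoint w) {φ : C' →⋆ₙₐ[ℂ] R}
    (hφ : ∀ c, Commute w (φ c)) {φ' : C →⋆ₙₐ[ℂ] R} (hφ' : ∀ c, Commute w (φ' c))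
    (f : C →⋆ₙₐ[ℂ] C') (h : ∀ c, φ' c = φ (f c)) (F : C(I, C)) :
    calculusL hw hφ' F = calculusL hw hφ (compHom f F) :=
  tendsto_nhds_unique (tendsto_calculusL hw hφ' F)
    ((tendsto_calculusL hw hφ _).congr fun n => by simp [bernsteinSum_apply, h])

end CalculusProperties

/-! ### The calculus f ⊗ c ↦ f(1 - e)α(c) in a non-unital algebra, through its unitization. -/

section NonUnital

variable {C C' : Type u} [NonUnitalCStarAlgebra C] [NonUnitalCStarAlgebra C']
  {X : Type v} [NonUnitalCStarAlgebra X] {Y : Type w} [NonUnitalCStarAlgebra Y]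

/-- A `*`-homomorphism as a map to the unitization. -/
def toUnitization (α : C →⋆ₙₐ[ℂ] X) : C →⋆ₙₐ[ℂ] Unitization ℂ X :=
  (Unitization.inrNonUnitalStarAlgHom ℂ X).comp α

@[simp]
theorem toUnitization_apply (α : C →⋆ₙₐ[ℂ] X) (c : C) :
    toUnitization α c = (α c : Unitization ℂ X) :=
  rfl

variable {e : X} {α β : C →⋆ₙₐ[ℂ] X}

theorem one_sub_inr_isSelfAdjoint (he : IsSelfAdjoint e) :
    IsSelfAdjoint (1 - (e : Unitization ℂ X)) :=
  (IsSelfAdjoint.one _).sub (he.inr _)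

theorem one_sub_inr_commute (hα : ∀ c, Commute e (α c)) (c : C) :
    Commute (1 - (e : Unitization ℂ X)) (toUnitization α c) := by
  refine (Commute.one_left _).sub_left ?_
  rw [commute_iff_eq, toUnitization_apply, ← Unitization.inr_mul, (hα c).eq, Unitization.inr_mul]

/-- Every summand of a Bernstein sum has a factor in the ideal X of its unitization; the scalar part
is therefore 0, also in the limit. -/
theorem inr_snd_calculusL (he : IsSelfAdjoint e) (hα : ∀ c, Commute e (α c)) (F : C(I, C)) :
    ((calculusL (one_sub_inr_isSelfAdjoint he) (one_sub_inr_commute hα) F).snd :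
      Unitization ℂ X) = calculusL (one_sub_inr_isSelfAdjoint he) (one_sub_inr_commute hα) F := by
  have h : (calculusL (one_sub_inr_isSelfAdjoint he) (one_sub_inr_commute hα) F).fst = 0 := by
    have := ((Unitization.continuous_fst (𝕜 := ℂ) (A := X)).tendsto _).comp
      (tendsto_calculusL (one_sub_inr_isSelfAdjoint he) (one_sub_inr_commute hα) F)
    refine tendsto_nhds_unique this (tendsto_const_nhds.congr fun n => ?_)
    change _ = Unitization.fstHom ℂ X (bernsteinSum _ _ _ n F)
    rw [bernsteinSum_apply, map_sum]
    refine (Finset.sum_eq_zero fun k _ => ?_).symm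
    rw [map_mul]
    simp
  conv_rhs => rw [← Unitization.inl_fst_add_inr_snd_eq (calculusL _ _ F), h]
  simp

/-- The `*`-homomorphism `f ⊗ c ↦ f(1 - e) α(c)` on `C`-valued functions on `[0,1]`, for a
self-adjoint element `e` that commutes with the range of `α`. -/
def calculus (he : IsSelfAdjoint e) (hα : ∀ c, Commute e (α c)) : C(I, C) →⋆ₙₐ[ℂ] X where
  toFun F := (calculusL (one_sub_inr_isSelfAdjoint he) (one_sub_inr_commute hα) F).snd
  map_smul' c F := by simp
  map_zero' := by simp
  map_add' F G := by simp
  map_mul' F G := by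
    apply Unitization.inr_injective (R := ℂ)
    rw [Unitization.inr_mul, inr_snd_calculusL he hα, inr_snd_calculusL he hα,
      inr_snd_calculusL he hα, calculusL_mul]
  map_star' F := by
    apply Unitization.inr_injective (R := ℂ)
    rw [Unitization.inr_star, inr_snd_calculusL he hα, inr_snd_calculusL he hα, calculusL_star]

theorem inr_calculus (he : IsSelfAdjoint e) (hα : ∀ c, Commute e (α c)) (F : C(I, C)) :
    (calculus he hα F : Unitization ℂ X) =
      calculusL (one_sub_inr_isSelfAdjoint he) (one_sub_inr_commute hα) F :=
  inr_snd_calculusL he hα F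

/-- If `e` annihilates the differences `α(c) - β(c)`, then the `*`-homomorphisms defined by `α` and
`β` differ only by the values at `1`. -/
theorem calculus_sub_calculus (he : IsSelfAdjoint e) (hα : ∀ c, Commute e (α c))
    (hβ : ∀ c, Commute e (β c)) (h : ∀ c, e * (α c - β c) = 0) (F : C(I, C)) :
    calculus he hα F - calculus he hβ F = α (F 1) - β (F 1) := by
  apply Unitization.inr_injective (R := ℂ)
  rw [Unitization.inr_sub, Unitization.inr_sub, inr_calculus, inr_calculus]
  refine calculusL_sub_calculusL _ _ _ F 1 fun r => ?_
  rw [toUnitization_apply, toUnitization_apply, ← Unitization.inr_sub, sub_mul,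
    ← Unitization.inr_mul, h]
  simp

/-- For e = 0 the element 1 - e is the unit, so the calculus is evaluation at 1 followed by α. This
is the end of the homotopy that shrinks e. -/
theorem calculus_zero (hα : ∀ c, Commute (0 : X) (α c)) (F : C(I, C)) :
    calculus (.zero X) hα F = α (F 1) := by
  have h0 : ∀ c, Commute (0 : X) ((0 : C →⋆ₙₐ[ℂ] X) c) := fun c => Commute.zero_left _
  have h1 := calculus_sub_calculus (.zero X) hα h0 (fun c => zero_mul _) F
  have h2 : calculus (.zero X) h0 F = 0 := by
    apply Unitization.inr_injective (R := ℂ)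
    rw [inr_calculus]
    refine tendsto_nhds_unique (tendsto_calculusL _ _ _)
      (tendsto_const_nhds.congr fun n => ?_)
    simp [bernsteinSum_apply]
  simpa [h2] using h1

/-- Here 1 - e annihilates all α(F(s)), so only the value F(0) = 0 counts. This is what lets the
calculus descend from the cone of C to the cone of A. -/
theorem calculus_eq_zero (he : IsSelfAdjoint e) (hα : ∀ c, Commute e (α c)) (F : C(I, C))
    (h0 : F 0 = 0) (h : ∀ s, e * α (F s) = α (F s)) : calculus he hα F = 0 := by
  apply Unitization.inr_injective (R := ℂ)
  rw [inr_calculus]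
  have hz : ∀ c, Commute (1 - (e : Unitization ℂ X)) (toUnitization (0 : C →⋆ₙₐ[ℂ] X) c) :=
    fun c => by simp
  have h1 := calculusL_sub_calculusL (one_sub_inr_isSelfAdjoint he) (one_sub_inr_commute hα)
    hz F 0 fun r => ?_
  · have h2 : calculusL (one_sub_inr_isSelfAdjoint he) hz F = 0 :=
      tendsto_nhds_unique (tendsto_calculusL _ _ _)
        (tendsto_const_nhds.congr fun n => by simp [bernsteinSum_apply])
    simpa [h2, h0] using h1
  · have := h r
    rw [toUnitization_apply, toUnitization_apply, ← Unitization.inr_sub, sub_mul,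
      ← Unitization.inr_mul, NonUnitalStarAlgHom.zero_apply, sub_zero, this]
    simp

theorem map_calculus (he : IsSelfAdjoint e) (hα : ∀ c, Commute e (α c)) (g : X →⋆ₙₐ[ℂ] Y)
    {e' : Y} (he' : IsSelfAdjoint e') {α' : C →⋆ₙₐ[ℂ] Y} (hα' : ∀ c, Commute e' (α' c))
    (hge : g e = e') (hgα : ∀ c, g (α c) = α' c) (F : C(I, C)) :
    g (calculus he hα F) = calculus he' hα' F := by
  apply Unitization.inr_injective (R := ℂ)
  rw [inr_calculus, ← map_calculusL (one_sub_inr_isSelfAdjoint he) (one_sub_inr_commute hα)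
    (Unitization.starMap g), ← inr_calculus, Unitization.starMap_inr]
  · rw [map_sub, map_one, Unitization.starMap_inr, hge]
  · intro c
    rw [toUnitization_apply, Unitization.starMap_inr, hgα, toUnitization_apply]

theorem calculus_compHom {α : C' →⋆ₙₐ[ℂ] X} (he : IsSelfAdjoint e) (hα : ∀ c, Commute e (α c))
    {α' : C →⋆ₙₐ[ℂ] X} (hα' : ∀ c, Commute e (α' c)) (f : C →⋆ₙₐ[ℂ] C')
    (h : ∀ c, α' c = α (f c)) (F : C(I, C)) :
    calculus he hα' F = calculus he hα (compHom f F) := by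
  apply Unitization.inr_injective (R := ℂ)
  rw [inr_calculus, inr_calculus]
  exact calculusL_compHom _ _ _ f (fun c => by simp [h]) F

end NonUnital

/-! ### Cones -/

section Cone

variable {C C' : Type u} [NonUnitalCStarAlgebra C] [NonUnitalCStarAlgebra C']

/-- The `*`-homomorphism `CC → CC'` of cones that is induced by a `*`-homomorphism `C → C'`. -/
def coneMap (f : C →⋆ₙₐ[ℂ] C') : coneSubalgebra C →⋆ₙₐ[ℂ] coneSubalgebra C' where
  toFun F := ⟨compHom f F, by
    have h : (F : C(I, C)) 0 = 0 := F.2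
    exact (congrArg f h).trans (map_zero f)⟩
  map_smul' c F := Subtype.ext (map_smul (compHom f) c (F : C(I, C)))
  map_zero' := Subtype.ext (map_zero (compHom f))
  map_add' F G := Subtype.ext (map_add (compHom f) (F : C(I, C)) G)
  map_mul' F G := Subtype.ext (map_mul (compHom f) (F : C(I, C)) G)
  map_star' F := Subtype.ext (map_star (compHom f) (F : C(I, C)))

theorem coneMap_coe (f : C →⋆ₙₐ[ℂ] C') (F : coneSubalgebra C) (s : I) :
    (coneMap f F : C(I, C')) s = f ((F : C(I, C)) s) := rfl

/-- The range is closed, so it suffices to reach the Bernstein approximations of a function in the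
cone. Their finitely many coefficients are lifted separately, and the value of the lift at 0, which
lies in the kernel of f, is subtracted. -/
theorem coneMap_surjective {f : C →⋆ₙₐ[ℂ] C'} (hf : Function.Surjective f) :
    Function.Surjective (coneMap f) := by
  refine surjective_of_denseRange _ fun F => ?_
  have hF : (F : C(I, C')) 0 = 0 := F.2
  let G : ℕ → coneSubalgebra C' := fun n => ⟨bernsteinApproximation n (F : C(I, C')), by
    change bernsteinApproximation n (F : C(I, C')) 0 = 0
    rw [bernsteinApproximation.apply_zero, hF]⟩
  have hG : Tendsto G atTop (𝓝 F) :=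
    tendsto_subtype_rng.2 (bernsteinApproximation_uniform (F : C(I, C')))
  refine mem_closure_of_tendsto hG (.of_forall fun n => ?_)
  let K : C(I, C) := ∑ k : Fin (n + 1),
    bernstein n k • ContinuousMap.const I (Function.surjInv hf ((F : C(I, C')) (bernstein.z k)))
  have hK : ∀ s, f (K s) = bernsteinApproximation n (F : C(I, C')) s := by
    intro s
    rw [bernsteinApproximation.apply]
    simp only [K, ContinuousMap.coe_sum, Finset.sum_apply, map_sum]
    refine Finset.sum_congr rfl fun k _ => ?_
    rw [ContinuousMap.smul_apply', ContinuousMap.const_apply, ← Complex.coe_smul, map_smul,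
      Function.surjInv_eq hf, Complex.coe_smul]
  refine ⟨⟨K - ContinuousMap.const I (K 0), ?_⟩, Subtype.ext (ContinuousMap.ext fun s => ?_)⟩
  · change (K - ContinuousMap.const I (K 0)) 0 = 0
    simp
  · rw [coneMap_coe]
    simp only [ContinuousMap.sub_apply, ContinuousMap.const_apply, map_sub, hK,
      bernsteinApproximation.apply_zero, hF, sub_zero]
    rfl

/-- The `*`-homomorphism `F ↦ (s ↦ (r ↦ F(sr)))` from a cone to its cone. -/
def coneDiagonal : coneSubalgebra C →⋆ₙₐ[ℂ] coneSubalgebra (coneSubalgebra C) where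
  toFun F := ⟨⟨fun s => ⟨⟨fun r => (F : C(I, C)) (s * r), by fun_prop⟩, by
      have h : (F : C(I, C)) 0 = 0 := F.2
      change (F : C(I, C)) (s * 0) = 0
      rw [mul_zero, h]⟩, by
      refine Continuous.subtype_mk ?_ _
      exact ContinuousMap.continuous_of_continuous_uncurry _ (by
        simp only [Function.uncurry_def, ContinuousMap.coe_mk]; fun_prop)⟩, by
      have h : (F : C(I, C)) 0 = 0 := F.2
      refine Subtype.ext (ContinuousMap.ext fun r => ?_)
      change (F : C(I, C)) (0 * r) = 0
      rw [zero_mul, h]⟩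
  map_smul' _ _ := rfl
  map_zero' := rfl
  map_add' _ _ := rfl
  map_mul' _ _ := rfl
  map_star' _ := rfl

/-- F(sr) is symmetric in s and r, so setting either variable to 1 gives back F: the diagonal splits
this evaluation and, by `coneMap_coneDiagonal`, also the cone of the evaluation. -/
theorem coneEval_coneDiagonal (F : coneSubalgebra C) :
    coneEval (coneSubalgebra C) (coneDiagonal (C := C) F) = F := by
  refine Subtype.ext (ContinuousMap.ext fun r => ?_)
  change (F : C(I, C)) (1 * r) = (F : C(I, C)) r
  rw [one_mul]

theorem coneMap_coneDiagonal (F : coneSubalgebra C) :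
    coneMap (coneEval C) (coneDiagonal (C := C) F) = F := by
  refine Subtype.ext (ContinuousMap.ext fun s => ?_)
  change (F : C(I, C)) (s * 1) = (F : C(I, C)) s
  rw [mul_one]

theorem coneEval_coneMap (f : C →⋆ₙₐ[ℂ] C') (F : coneSubalgebra C) :
    coneEval C' (coneMap f F) = f (coneEval C F) := rfl

end Cone

/-! ### Factoring `*`-homomorphisms through surjections. -/

section Descend

variable {C D : Type*} [NonUnitalCStarAlgebra C] [NonUnitalCStarAlgebra D]
  {X : Type*} [NonUnitalCStarAlgebra X]

/-- A `*`-homomorphism that vanishes on the kernel of a surjection `q` factors through `q`. -/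
def descend (q : C →⋆ₙₐ[ℂ] D) (hq : Function.Surjective q) (Φ : C →⋆ₙₐ[ℂ] X)
    (h : ∀ c, q c = 0 → Φ c = 0) : D →⋆ₙₐ[ℂ] X :=
  have key : ∀ c d, q c = d → Φ (Function.surjInv hq d) = Φ c := fun c d hcd => by
    rw [← sub_eq_zero, ← map_sub]
    exact h _ (by rw [map_sub, Function.surjInv_eq hq, hcd, sub_self])
  { toFun := fun d => Φ (Function.surjInv hq d)
    map_smul' := fun c d => (key (c • Function.surjInv hq d) _ (by
      rw [map_smul, Function.surjInv_eq hq])).trans (map_smul Φ _ _)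
    map_zero' := (key 0 0 (map_zero q)).trans (map_zero Φ)
    map_add' := fun a b => (key (Function.surjInv hq a + Function.surjInv hq b) _ (by
      rw [map_add, Function.surjInv_eq hq, Function.surjInv_eq hq])).trans (map_add Φ _ _)
    map_mul' := fun a b => (key (Function.surjInv hq a * Function.surjInv hq b) _ (by
      rw [map_mul, Function.surjInv_eq hq, Function.surjInv_eq hq])).trans (map_mul Φ _ _)
    map_star' := fun a => (key (star (Function.surjInv hq a)) _ (by
      rw [map_star, Function.surjInv_eq hq])).trans (map_star Φ _) }

theorem descend_apply {q : C →⋆ₙₐ[ℂ] D} (hq : Function.Surjective q) {Φ : C →⋆ₙₐ[ℂ] X}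
    (h : ∀ c, q c = 0 → Φ c = 0) (c : C) : descend q hq Φ h (q c) = Φ c := by
  change Φ (Function.surjInv hq (q c)) = Φ c
  rw [← sub_eq_zero, ← map_sub]
  exact h _ (by rw [map_sub, Function.surjInv_eq hq, sub_self])

end Descend

end

end FullSurj

namespace FullSurj

noncomputable section

/-! ### Exact solutions of approximately solvable systems in the asymptotic algebra -/

section Diagonal

variable {B : Type v} [NonUnitalCStarAlgebra B]

theorem convex_setOf_norm_mul_add_le (a b c : B) (r : ℝ) :
    Convex ℝ {x : B | ‖a * x + x * b + c‖ ≤ r} := by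
  intro x hx y hy s t hs ht hst
  have h : a * (s • x + t • y) + (s • x + t • y) * b + c =
      s • (a * x + x * b + c) + t • (a * y + y * b + c) := by
    have hc : c = s • c + t • c := by rw [← add_smul, hst, one_smul]
    conv_lhs => rw [hc]
    simp only [mul_add, add_mul, smul_add, mul_smul_comm, smul_mul_assoc]
    abel
  simp only [Set.mem_ofPred_eq] at hx hy ⊢
  rw [h]
  calc _ ≤ ‖s • (a * x + x * b + c)‖ + ‖t • (a * y + y * b + c)‖ := norm_add_le _ _
    _ = s * ‖a * x + x * b + c‖ + t * ‖a * y + y * b + c‖ := by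
      rw [norm_smul, norm_smul, Real.norm_of_nonneg hs, Real.norm_of_nonneg ht]
    _ ≤ s * r + t * r := by gcongr
    _ = r := by rw [← add_mul, hst, one_mul]

open AsympAlg in
/-- If a countable system of equations `a_i x + x b_i + c_i = 0` has approximate solutions among the
self-adjoint contractions of the asymptotic algebra, it has a self-adjoint solution. -/
theorem AsympAlg.exists_solution (x : ℕ → AsympAlg B) (hx : ∀ n, IsSelfAdjoint (x n))
    (hx1 : ∀ n, ‖x n‖ ≤ 1) (a b c : ℕ → AsympAlg B)
    (h : ∀ i, Tendsto (fun n => a i * x n + x n * b i + c i) atTop (𝓝 0)) :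
    ∃ e : AsympAlg B, IsSelfAdjoint e ∧ ∀ i, a i * e + e * b i + c i = 0 := by
  choose y hy hy1 hyx using fun n =>
    exists_selfAdjoint_lift proj (hx n) (proj_surjective (x n)) (hx1 n)
  choose a' ha using fun i => proj_surjective (a i)
  choose b' hb using fun i => proj_surjective (b i)
  choose c' hc using fun i => proj_surjective (c i)
  have hk : ∀ n : ℕ, ∃ k, ∀ i ≤ n, ‖a i * x k + x k * b i + c i‖ < 1 / (n + 1) := by
    intro n
    have h1 : ∀ᶠ k in atTop, ∀ i ∈ Set.Iic n, ‖a i * x k + x k * b i + c i‖ < 1 / (n + 1) := by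
      rw [eventually_all_finite (Set.finite_Iic n)]
      intro i _
      have := (tendsto_norm_zero.comp (h i)).eventually
        (gt_mem_nhds (show (0 : ℝ) < 1 / (n + 1) by positivity))
      simpa using this
    exact h1.exists
  choose k hk using hk
  have hT : ∀ n : ℕ, ∃ T : ℝ≥0, ∀ t ≥ T, ∀ i ≤ n,
      ‖a' i t * y (k n) t + y (k n) t * b' i t + c' i t‖ ≤ 2 / (n + 1) := by
    intro n
    rw [← eventually_atTop]
    have h1 : ∀ᶠ t in atTop, ∀ i ∈ Set.Iic n,
        ‖a' i t * y (k n) t + y (k n) t * b' i t + c' i t‖ ≤ 2 / (n + 1) := by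
      rw [eventually_all_finite (Set.finite_Iic n)]
      intro i hi
      have h2 := eventually_norm_le (a' i * y (k n) + y (k n) * b' i + c' i)
        (show (0 : ℝ) < 1 / (n + 1) by positivity)
      have h3 : ‖mkL (a' i * y (k n) + y (k n) * b' i + c' i)‖ ≤ 1 / (n + 1) := by
        have : mkL (a' i * y (k n) + y (k n) * b' i + c' i) =
            a i * x (k n) + x (k n) * b i + c i := by
          rw [← ha, ← hb, ← hc, ← hyx, ← map_mul, ← map_mul, ← map_add, ← map_add]
          rfl
        rw [this]
        exact (hk n i hi).le
      filter_upwards [h2] with t ht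
      calc _ ≤ _ := ht
        _ ≤ 1 / (n + 1) + 1 / (n + 1) := by gcongr
        _ = 2 / (n + 1) := by ring
    exact h1
  choose T hT using hT
  -- A monotone majorant of T that tends to infinity.
  let T' : ℕ → ℝ≥0 := fun n => n + ∑ m ∈ Finset.range (n + 1), T m
  have hTT' : ∀ n, T n ≤ T' n := fun n =>
    (Finset.single_le_sum (f := T) (fun _ _ => zero_le) (Finset.self_mem_range_succ n)).trans
      le_add_self
  have hnT' : ∀ n : ℕ, (n : ℝ≥0) ≤ T' n := fun n => le_self_add
  have hmono : Monotone T' := fun m n hmn => add_le_add (by exact_mod_cast hmn)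
    (Finset.sum_le_sum_of_subset (Finset.range_mono (by omega)))
  -- The equations are affine in the unknown, so these constraint sets are convex and a continuous
  -- selection exists once there are local ones. Constraint n becomes active only at T' n + 1; this
  -- unit of delay makes room for a window of length 1 around each point.
  let S : ℝ≥0 → Set B := fun t => {z | IsSelfAdjoint z} ∩ (Metric.closedBall 0 1 ∩
    ⋂ (n : ℕ) (_ : T' n + 1 ≤ t) (i : ℕ) (_ : i ≤ n),
      {z | ‖a' i t * z + z * b' i t + c' i t‖ ≤ 2 / (n + 1)})
  have hS : ∀ t, Convex ℝ (S t) := fun t => by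
    refine Convex.inter ?_ ((convex_closedBall _ _).inter ?_)
    · intro p hp q hq r s _ _ _
      exact (IsSelfAdjoint.smul (.all r) hp).add (IsSelfAdjoint.smul (.all s) hq)
    · exact convex_iInter fun n => convex_iInter fun _ => convex_iInter fun i =>
        convex_iInter fun _ => convex_setOf_norm_mul_add_le _ _ _ _
  obtain ⟨g, hg⟩ := exists_continuous_forall_mem_convex_of_local hS (fun t₀ => by
    refine ⟨{t : ℝ≥0 | (t₀ : ℝ) - 1 / 2 < t ∧ (t : ℝ) < t₀ + 1 / 2}, ?_, ?_⟩
    · refine IsOpen.mem_nhds ?_ ⟨by simp, by simp⟩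
      exact (isOpen_lt continuous_const NNReal.continuous_coe).inter
        (isOpen_lt NNReal.continuous_coe continuous_const)
    · have hex : ∃ m : ℕ, (t₀ : ℝ) - 1 / 2 < T' m := by
        obtain ⟨m, hm⟩ := exists_nat_gt (t₀ : ℝ)
        have : (m : ℝ) ≤ T' m := by exact_mod_cast hnT' m
        exact ⟨m, by linarith⟩
      classical
      have hspec := Nat.find_spec hex
      have hlt : ∀ (n : ℕ) (t : ℝ≥0), (t : ℝ) < t₀ + 1 / 2 → T' n + 1 ≤ t → n < Nat.find hex := by
        intro n t ht hn
        by_contra hcon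
        have h1 : (T' (Nat.find hex) : ℝ) ≤ T' n := by exact_mod_cast hmono (not_lt.1 hcon)
        have h2 : (T' n : ℝ) + 1 ≤ t := by exact_mod_cast hn
        linarith
      rcases hm : Nat.find hex with _ | n₀
      · refine ⟨fun _ => 0, continuousOn_const, fun t ht => ⟨.zero B, by simp, ?_⟩⟩
        simp only [Set.mem_iInter]
        intro n hn
        have := hlt n t ht.2 hn
        omega
      -- Here n₀ is the last index with T' n₀ ≤ t₀ - 1/2. No constraint beyond n₀ is active in the
      -- window, and the representative with index `k n₀` already satisfies those up to n₀
      -- throughout it.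
      · refine ⟨y (k n₀), (y (k n₀)).continuous.continuousOn, fun t ht => ⟨?_, ?_, ?_⟩⟩
        · exact congrArg (fun f : ℝ≥0 →ᵇ B => f t) (hy (k n₀))
        · rw [mem_closedBall_zero_iff]
          exact ((y (k n₀)).norm_coe_le_norm t).trans (hy1 _)
        · simp only [Set.mem_iInter]
          intro n hn i hi
          have h1 := hlt n t ht.2 hn
          have h2 : n ≤ n₀ := by omega
          have h3 : (T' n₀ : ℝ) ≤ t₀ - 1 / 2 := not_lt.1 (Nat.find_min hex (m := n₀) (by omega))
          have h4 : T' n₀ ≤ t := by exact_mod_cast h3.trans ht.1.le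
          refine (hT n₀ t ((hTT' n₀).trans h4) i (hi.trans h2)).trans ?_
          gcongr)
  let e : ℝ≥0 →ᵇ B := BoundedContinuousFunction.ofNormedAddCommGroup g g.continuous 1
    fun t => mem_closedBall_zero_iff.1 (hg t).2.1
  refine ⟨proj e, ?_, fun i => ?_⟩
  · refine IsSelfAdjoint.map (f := proj) ?_
    ext t
    exact (hg t).1
  · rw [← ha, ← hb, ← hc, ← map_mul, ← map_mul, ← map_add, ← map_add, proj_eq_zero,
      ← mem_asympNull, mem_asympNull_iff]
    intro ε hε
    obtain ⟨n, hn⟩ := exists_nat_gt (2 / ε)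
    filter_upwards [eventually_ge_atTop (T' (max i n) + 1)] with t ht
    have h1 := (hg t).2.2
    simp only [Set.mem_iInter] at h1
    refine (h1 (max i n) ht i (le_max_left _ _)).trans ?_
    have h2 : (n : ℝ) ≤ (max i n : ℕ) := by exact_mod_cast le_max_right i n
    rw [div_le_iff₀ (by positivity)]
    rw [div_lt_iff₀ hε] at hn
    nlinarith

end Diagonal

/-! ### Quasicentral approximate units -/

section QuasiCentral

variable {C : Type u} [NonUnitalCStarAlgebra C]

/-- An element of a closed ideal `J` that is almost a right unit for finitely many elements of
`J`. -/
theorem exists_approx_unit {A : Type v} [NonUnitalCStarAlgebra A] (p : C →⋆ₙₐ[ℂ] A)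
    (s : Finset C) (hs : ∀ x ∈ s, p x = 0) {ε : ℝ} (hε : 0 < ε) :
    ∃ u, p u = 0 ∧ IsSelfAdjoint u ∧ ‖u‖ ≤ 1 ∧ ∀ x ∈ s, ‖x * u - x‖ < ε := by
  let J : NonUnitalStarSubalgebra ℂ C :=
    { carrier := {x | p x = 0}
      zero_mem' := map_zero p
      add_mem' := fun {x y} hx hy => by
        rw [Set.mem_ofPred_eq] at *; rw [map_add, hx, hy, add_zero]
      mul_mem' := fun {x y} hx hy => by
        rw [Set.mem_ofPred_eq] at *; rw [map_mul, hx, zero_mul]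
      smul_mem' := fun c {x} hx => by
        rw [Set.mem_ofPred_eq] at *; rw [map_smul, hx, smul_zero]
      star_mem' := fun {x} hx => by
        rw [Set.mem_ofPred_eq] at *; rw [map_star, hx, star_zero] }
  have hcont : Continuous p :=
    AddMonoidHomClass.continuous_of_bound p 1 (by simpa using NonUnitalStarAlgHom.norm_apply_le p)
  have hJ : IsClosed (J : Set C) := isClosed_eq hcont continuous_const
  let _ := CStarAlgebra.spectralOrder J
  let _ := CStarAlgebra.spectralOrderedRing J
  have hu := CStarAlgebra.increasingApproximateUnit (A := J)
  have h1 : ∀ᶠ u in CStarAlgebra.approximateUnit J, ∀ x ∈ s.attach,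
      ‖(⟨x, hs x x.2⟩ : J) * u - ⟨x, hs x x.2⟩‖ < ε := by
    rw [Finset.eventually_all]
    intro x _
    have := Metric.tendsto_nhds.1 (hu.tendsto_mul_left (⟨x, hs x x.2⟩ : J)) ε hε
    simpa [dist_eq_norm] using this
  have := hu.neBot
  obtain ⟨u, ⟨hu1, hu2⟩, hu3⟩ :=
    ((h1.and hu.eventually_norm).and hu.eventually_isSelfAdjoint).exists
  exact ⟨u, u.2, congrArg Subtype.val hu3, hu2, fun x hx => hu1 ⟨x, hx⟩ (s.mem_attach _)⟩

end QuasiCentral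

end

end FullSurj

namespace FullSurj

noncomputable section

section QuasiCentral

variable {C : Type u} [NonUnitalCStarAlgebra C] {A : Type v} [NonUnitalCStarAlgebra A]

/-- If `u_l` is almost a right unit for `u_k`, `u_k c`, `u_k c^*` and `u_k c^* c`, then the
commutators of `u_k` and `u_l` with `c` are almost orthogonal. -/
theorem norm_star_commutator_mul_commutator_le {u v c : C} (hu : IsSelfAdjoint u) {δ : ℝ}
    (h1 : ‖u * v - u‖ ≤ δ) (h2 : ‖u * c * v - u * c‖ ≤ δ)
    (h3 : ‖u * star c * v - u * star c‖ ≤ δ)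
    (h4 : ‖u * (star c * c) * v - u * (star c * c)‖ ≤ δ) :
    ‖star (u * c - c * u) * (v * c - c * v)‖ ≤ (‖c‖ + 1) ^ 2 * δ := by
  -- If v were an exact right unit for u, u c, u c* and u c* c, the four terms of the product would
  -- cancel; each bracket measures the error.
  have e : star (u * c - c * u) * (v * c - c * v) =
      star c * ((u * v - u) * c - (u * c * v - u * c)) -
        ((u * star c * v - u * star c) * c - (u * (star c * c) * v - u * (star c * c))) := by
    simp only [star_sub, star_mul, hu.star_eq]
    noncomm_ring
  have b1 : ‖(u * v - u) * c - (u * c * v - u * c)‖ ≤ δ * ‖c‖ + δ :=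
    (norm_sub_le _ _).trans (add_le_add ((norm_mul_le _ _).trans (by gcongr)) h2)
  have b2 : ‖(u * star c * v - u * star c) * c - (u * (star c * c) * v - u * (star c * c))‖ ≤
      δ * ‖c‖ + δ :=
    (norm_sub_le _ _).trans (add_le_add ((norm_mul_le _ _).trans (by gcongr)) h4)
  rw [e]
  calc _ ≤ ‖star c‖ * (δ * ‖c‖ + δ) + (δ * ‖c‖ + δ) :=
        (norm_sub_le _ _).trans (add_le_add ((norm_mul_le _ _).trans (by gcongr)) b2)
    _ = (‖c‖ + 1) ^ 2 * δ := by rw [norm_star]; ring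

/-- In the expansion of S*S the N diagonal terms contribute at most K each, the off-diagonal ones at
most δ. So an average of N almost orthogonal elements has norm of order N^(-1/2). -/
theorem norm_sum_sq_le_of_almost_orthogonal (d : ℕ → C) (N : ℕ) {K δ : ℝ} (hK : ∀ k, ‖d k‖ ^ 2 ≤ K)
    (hd : ∀ k l, k < l → ‖star (d k) * d l‖ ≤ δ) :
    ‖∑ k ∈ Finset.range N, d k‖ ^ 2 ≤ N * K + N ^ 2 * δ := by
  have hd' : ∀ k l, k ≠ l → ‖star (d k) * d l‖ ≤ δ := by
    intro k l hkl
    rcases lt_or_gt_of_ne hkl with h | h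
    · exact hd k l h
    · rw [← norm_star, star_mul, star_star]; exact hd l k h
  have hδ : 0 ≤ δ := (norm_nonneg _).trans (hd 0 1 one_pos)
  have h1 : ∀ k ∈ Finset.range N,
      ‖∑ l ∈ Finset.range N, star (d k) * d l‖ ≤ K + N * δ := by
    intro k hk
    rw [← Finset.add_sum_erase _ _ hk]
    refine (norm_add_le _ _).trans (add_le_add ?_ ?_)
    · rw [CStarRing.norm_star_mul_self, ← sq]; exact hK k
    · refine (norm_sum_le_of_le _ fun l hl => hd' k l (Finset.ne_of_mem_erase hl).symm).trans ?_
      rw [Finset.sum_const, nsmul_eq_mul]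
      gcongr
      exact (Finset.card_erase_le).trans (by simp)
  calc ‖∑ k ∈ Finset.range N, d k‖ ^ 2
      = ‖∑ k ∈ Finset.range N, ∑ l ∈ Finset.range N, star (d k) * d l‖ := by
        rw [sq, ← CStarRing.norm_star_mul_self, star_sum, Finset.sum_mul_sum]
    _ ≤ ∑ k ∈ Finset.range N, (K + N * δ) := norm_sum_le_of_le _ h1
    _ = N * K + N ^ 2 * δ := by rw [Finset.sum_const, Finset.card_range, nsmul_eq_mul]; ring

/-- A quasicentral approximate unit of the kernel of `p`, for finitely many elements. -/
theorem exists_quasicentral (p : C →⋆ₙₐ[ℂ] A) (F G : Finset C) (hG : ∀ x ∈ G, p x = 0) {ε : ℝ}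
    (hε : 0 < ε) : ∃ u, p u = 0 ∧ IsSelfAdjoint u ∧ ‖u‖ ≤ 1 ∧
      (∀ x ∈ G, ‖x * u - x‖ < ε) ∧ ∀ c ∈ F, ‖u * c - c * u‖ < ε := by
  classical
  obtain ⟨M, hM0, hM⟩ : ∃ M : ℝ, 0 < M ∧ ∀ c ∈ F, ‖c‖ + 1 ≤ M :=
    ⟨∑ c ∈ F, ‖c‖ + 1, by positivity, fun c hc => by
      gcongr; exact Finset.single_le_sum (f := fun c => ‖c‖) (fun _ _ => norm_nonneg _) hc⟩
  -- The commutators of the u_k with c have square norm at most 4M² and mutual products of norm at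
  -- most M²δ = ε²/4. With N > 16M²/ε² the bound 4M²N + N²ε²/4 is below N²ε², so the average of the
  -- u_k has commutator of norm below ε.
  let δ : ℝ := ε ^ 2 / (4 * M ^ 2)
  have hδ : 0 < δ := by positivity
  obtain ⟨N, hN⟩ := exists_nat_gt (16 * M ^ 2 / ε ^ 2)
  have hN0 : (0 : ℝ) < N := lt_of_le_of_lt (by positivity) hN
  let P : C → Prop := fun u => p u = 0 ∧ IsSelfAdjoint u ∧ ‖u‖ ≤ 1 ∧ ∀ x ∈ G, ‖x * u - x‖ < ε
  let r : C → C → Prop := fun u v => ‖u * v - u‖ ≤ δ ∧ ∀ c ∈ F, ‖u * c * v - u * c‖ ≤ δ ∧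
    ‖u * star c * v - u * star c‖ ≤ δ ∧ ‖u * (star c * c) * v - u * (star c * c)‖ ≤ δ
  obtain ⟨u, hu, hr⟩ := exists_seq_of_forall_finset_exists P r (by
    intro s hs
    -- The next element has to be almost a unit for the earlier ones and for their products with c,
    -- c* and c* c; these lie in the kernel, so approximate units apply.
    let s' : Finset C := s ∪ (s ×ˢ F).image (fun x => x.1 * x.2) ∪
      (s ×ˢ F).image (fun x => x.1 * star x.2) ∪ (s ×ˢ F).image (fun x => x.1 * (star x.2 * x.2))
    have hs' : ∀ x ∈ s' ∪ G, p x = 0 := by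
      intro x hx
      simp only [s', Finset.mem_union, Finset.mem_image, Finset.mem_product, Prod.exists] at hx
      rcases hx with (((hx | ⟨a, b, ⟨ha, -⟩, rfl⟩) | ⟨a, b, ⟨ha, -⟩, rfl⟩) |
        ⟨a, b, ⟨ha, -⟩, rfl⟩) | hx
      · exact (hs x hx).1
      · rw [map_mul, (hs a ha).1, zero_mul]
      · rw [map_mul, (hs a ha).1, zero_mul]
      · rw [map_mul, (hs a ha).1, zero_mul]
      · exact hG x hx
    obtain ⟨v, hv0, hv1, hv2, hv3⟩ := exists_approx_unit p (s' ∪ G) hs' (lt_min hδ hε)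
    have hv4 : ∀ x ∈ s', ‖x * v - x‖ ≤ δ := fun x hx =>
      ((hv3 x (Finset.mem_union_left _ hx)).trans_le (min_le_left _ _)).le
    refine ⟨v, ⟨hv0, hv1, hv2, fun x hx =>
      (hv3 x (Finset.mem_union_right _ hx)).trans_le (min_le_right _ _)⟩, fun x hx =>
      ⟨hv4 _ ?_, fun c hc => ⟨hv4 _ ?_, hv4 _ ?_, hv4 _ ?_⟩⟩⟩
    all_goals simp only [s', Finset.mem_union, Finset.mem_image, Finset.mem_product, Prod.exists]
    · exact .inl (.inl (.inl hx))
    · exact .inl (.inl (.inr ⟨x, c, ⟨hx, hc⟩, rfl⟩))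
    · exact .inl (.inr ⟨x, c, ⟨hx, hc⟩, rfl⟩)
    · exact .inr ⟨x, c, ⟨hx, hc⟩, rfl⟩)
  have havg : ∀ z : C, (N : ℝ)⁻¹ • ∑ _k ∈ Finset.range N, z = z := fun z => by
    rw [Finset.sum_const, Finset.card_range, ← Nat.cast_smul_eq_nsmul ℝ, smul_smul,
      inv_mul_cancel₀ hN0.ne', one_smul]
  have hnorm : ∀ (z : ℕ → C) {K : ℝ}, (∀ k, ‖z k‖ < K) →
      ‖(N : ℝ)⁻¹ • ∑ k ∈ Finset.range N, z k‖ < K := by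
    intro z K hz
    have hne : (Finset.range N).Nonempty := Finset.nonempty_range_iff.2 (by
      rintro rfl; simp at hN0)
    rw [norm_smul, norm_inv, Real.norm_of_nonneg hN0.le, inv_mul_lt_iff₀ hN0]
    calc _ ≤ ∑ k ∈ Finset.range N, ‖z k‖ := norm_sum_le _ _
      _ < ∑ k ∈ Finset.range N, K := Finset.sum_lt_sum_of_nonempty hne fun k _ => hz k
      _ = N * K := by simp
  refine ⟨(N : ℝ)⁻¹ • ∑ k ∈ Finset.range N, u k, ?_, ?_, ?_, ?_, ?_⟩
  · rw [← Complex.coe_smul, map_smul, map_sum, Finset.sum_eq_zero fun k _ => (hu k).1, smul_zero]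
  · exact IsSelfAdjoint.smul (.all _) (isSelfAdjoint_sum _ fun k _ => (hu k).2.1)
  · rw [norm_smul, norm_inv, Real.norm_of_nonneg hN0.le, inv_mul_le_iff₀ hN0]
    calc _ ≤ ∑ k ∈ Finset.range N, (1 : ℝ) := norm_sum_le_of_le _ fun k _ => (hu k).2.2.1
      _ = N * 1 := by simp
  · intro x hx
    have : x * ((N : ℝ)⁻¹ • ∑ k ∈ Finset.range N, u k) - x =
        (N : ℝ)⁻¹ • ∑ k ∈ Finset.range N, (x * u k - x) := by
      rw [Finset.sum_sub_distrib, smul_sub, havg, mul_smul_comm, Finset.mul_sum]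
    rw [this]
    exact hnorm _ fun k => (hu k).2.2.2 x hx
  · intro c hc
    have : ((N : ℝ)⁻¹ • ∑ k ∈ Finset.range N, u k) * c - c * ((N : ℝ)⁻¹ • ∑ k ∈ Finset.range N, u k)
        = (N : ℝ)⁻¹ • ∑ k ∈ Finset.range N, (u k * c - c * u k) := by
      rw [Finset.sum_sub_distrib, smul_sub, mul_smul_comm, Finset.mul_sum, smul_mul_assoc,
        Finset.sum_mul]
    rw [this]
    have hd1 : ∀ k, ‖u k * c - c * u k‖ ^ 2 ≤ 4 * M ^ 2 := by
      intro k
      have h1 : ‖u k * c - c * u k‖ ≤ 2 * M := by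
        have h2 : ‖u k * c‖ ≤ 1 * ‖c‖ := (norm_mul_le _ _).trans (by gcongr; exact (hu k).2.2.1)
        have h3 : ‖c * u k‖ ≤ ‖c‖ * 1 := (norm_mul_le _ _).trans (by gcongr; exact (hu k).2.2.1)
        linarith [norm_sub_le (u k * c) (c * u k), hM c hc]
      calc _ ≤ (2 * M) ^ 2 := by gcongr
        _ = 4 * M ^ 2 := by ring
    have hd2 : ∀ k l, k < l →
        ‖star (u k * c - c * u k) * (u l * c - c * u l)‖ ≤ M ^ 2 * δ := by
      intro k l hkl
      obtain ⟨h1, h2⟩ := hr k l hkl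
      obtain ⟨h2, h3, h4⟩ := h2 c hc
      refine (norm_star_commutator_mul_commutator_le (hu k).2.1 h1 h2 h3 h4).trans ?_
      gcongr
      exact hM c hc
    have hd3 := norm_sum_sq_le_of_almost_orthogonal (fun k => u k * c - c * u k) N hd1 hd2
    rw [norm_smul, norm_inv, Real.norm_of_nonneg hN0.le]
    refine lt_of_pow_lt_pow_left₀ 2 hε.le ?_
    rw [mul_pow, inv_pow, inv_mul_lt_iff₀ (by positivity)]
    refine hd3.trans_lt ?_
    have h5 : M ^ 2 * δ = ε ^ 2 / 4 := by simp only [δ]; field_simp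
    rw [h5]
    rw [div_lt_iff₀ (by positivity)] at hN
    nlinarith

/-- Separability reduces quasicentrality and the unit property to countably many limits, the form in
which they can be solved exactly in the asymptotic algebra. -/
theorem exists_quasicentral_seq [TopologicalSpace.SeparableSpace C] (p : C →⋆ₙₐ[ℂ] A) :
    ∃ (u : ℕ → C) (c j : ℕ → C), (∀ n, p (u n) = 0 ∧ IsSelfAdjoint (u n) ∧ ‖u n‖ ≤ 1) ∧
      DenseRange c ∧ (∀ n, p (j n) = 0) ∧ (∀ x, p x = 0 → x ∈ closure (Set.range j)) ∧
      (∀ i, Tendsto (fun n => j i * u n - j i) atTop (𝓝 0)) ∧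
      ∀ i, Tendsto (fun n => u n * c i - c i * u n) atTop (𝓝 0) := by
  classical
  have := UniformSpace.secondCountable_of_separable C
  let K : Type u := {x : C // p x = 0}
  have : Nonempty K := ⟨⟨0, map_zero p⟩⟩
  let c := TopologicalSpace.denseSeq C
  let j : ℕ → C := fun n => (TopologicalSpace.denseSeq K n).1
  have hj : ∀ n, p (j n) = 0 := fun n => (TopologicalSpace.denseSeq K n).2
  choose u hu using fun n : ℕ => exists_quasicentral p ((Finset.range (n + 1)).image c)
    ((Finset.range (n + 1)).image j) (by
      intro x hx
      obtain ⟨i, -, rfl⟩ := Finset.mem_image.1 hx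
      exact hj i) (show (0 : ℝ) < 1 / (n + 1) by positivity)
  have hmem : ∀ (f : ℕ → C) (i n : ℕ), i ≤ n → f i ∈ (Finset.range (n + 1)).image f :=
    fun f i n h => Finset.mem_image_of_mem _ (Finset.mem_range.2 (by omega))
  have hlim : Tendsto (fun n : ℕ => 1 / ((n : ℝ) + 1)) atTop (𝓝 0) :=
    tendsto_one_div_add_atTop_nhds_zero_nat
  refine ⟨u, c, j, fun n => ⟨(hu n).1, (hu n).2.1, (hu n).2.2.1⟩,
    TopologicalSpace.denseRange_denseSeq C, hj, fun x hx => ?_, fun i => ?_, fun i => ?_⟩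
  · have h1 : (⟨x, hx⟩ : K) ∈ closure (Set.range (TopologicalSpace.denseSeq K)) :=
      TopologicalSpace.denseRange_denseSeq K _
    have h2 := image_closure_subset_closure_image continuous_subtype_val
      (Set.mem_image_of_mem _ h1)
    rwa [← Set.range_comp] at h2
  · refine squeeze_zero_norm' ?_ hlim
    filter_upwards [eventually_ge_atTop i] with n hn
    exact ((hu n).2.2.2.1 _ (hmem j i n hn)).le
  · refine squeeze_zero_norm' ?_ hlim
    filter_upwards [eventually_ge_atTop i] with n hn
    exact ((hu n).2.2.2.2 _ (hmem c i n hn)).le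

end QuasiCentral

/-! ### Connecting elements -/

section Connecting

variable {C : Type u} [NonUnitalCStarAlgebra C] {A : Type w} [NonUnitalCStarAlgebra A]
  {X : Type v} [NonUnitalCStarAlgebra X]

/-- A self-adjoint element that commutes with the ranges of `α` and `β` and annihilates their
differences. -/
structure IsConnecting (α β : C →⋆ₙₐ[ℂ] X) (e : X) : Prop where
  selfAdjoint : IsSelfAdjoint e
  commute_left : ∀ c, Commute e (α c)
  commute_right : ∀ c, Commute e (β c)
  mul_sub_eq_zero : ∀ c, e * (α c - β c) = 0

/-- For a pair of `*`-homomorphisms to an asymptotic algebra that agree on the kernel `J` of `p`,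
there is a connecting element that is a unit for the image of `J`. -/
theorem exists_isConnecting [TopologicalSpace.SeparableSpace C] (p : C →⋆ₙₐ[ℂ] A) {B : Type v}
    [NonUnitalCStarAlgebra B] (α β : C →⋆ₙₐ[ℂ] AsympAlg B) (h : ∀ c, p c = 0 → α c = β c) :
    ∃ e, IsConnecting α β e ∧ ∀ c, p c = 0 → e * α c = α c := by
  obtain ⟨u, c, j, hu, hc, hj, hjd, hju, hcu⟩ := exists_quasicentral_seq p
  have hcont : ∀ γ : C →⋆ₙₐ[ℂ] AsympAlg B, Continuous γ := fun γ =>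
    AddMonoidHomClass.continuous_of_bound γ 1 (by simpa using NonUnitalStarAlgHom.norm_apply_le γ)
  have hαβ : ∀ n, α (u n) = β (u n) := fun n => h _ (hu n).1
  -- Commutation with α, commutation with β, annihilation of α - β, and the unit property on the
  -- kernel, all written as a e + e b + c = 0.
  let eqs : Fin 4 × ℕ → AsympAlg B × AsympAlg B × AsympAlg B := fun x => match x with
    | (0, i) => (α (c i), -α (c i), 0)
    | (1, i) => (β (c i), -β (c i), 0)
    | (2, i) => (0, α (c i) - β (c i), 0)
    | (3, i) => (α (j i), 0, -α (j i))
  have hcomm : ∀ (γ : C →⋆ₙₐ[ℂ] AsympAlg B) i, Tendsto (fun n => γ (c i) * γ (u n) +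
      γ (u n) * -γ (c i) + 0) atTop (𝓝 0) := by
    intro γ i
    have h1 := (((hcont γ).tendsto 0).comp (hcu i)).neg
    rw [map_zero, neg_zero] at h1
    refine h1.congr fun n => ?_
    simp only [Function.comp_apply, map_sub, map_mul]
    noncomm_ring
  obtain ⟨f, hf⟩ := exists_surjective_nat (Fin 4 × ℕ)
  obtain ⟨e, he, heq⟩ := AsympAlg.exists_solution (fun n => α (u n)) (fun n => (hu n).2.1.map α)
    (fun n => (NonUnitalStarAlgHom.norm_apply_le α _).trans (hu n).2.2)
    (fun i => (eqs (f i)).1) (fun i => (eqs (f i)).2.1) (fun i => (eqs (f i)).2.2) (by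
      intro i
      rcases f i with ⟨k, i⟩
      fin_cases k
      · exact hcomm α i
      · simpa only [hαβ] using hcomm β i
      · refine tendsto_const_nhds.congr fun n => ?_
        -- The element u_n c lies in the kernel, where α and β agree, so this equation holds exactly
        -- and not just in the limit.
        have h1 : α (u n) * (α (c i) - β (c i)) = 0 := by
          have h2 : p (u n * c i) = 0 := by rw [map_mul, (hu n).1, zero_mul]
          have h3 := h _ h2
          rw [map_mul, map_mul, ← hαβ] at h3
          rw [mul_sub, h3, sub_self]
        simp [eqs, h1]
      · have h1 := ((hcont α).tendsto 0).comp (hju i)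
        rw [map_zero] at h1
        refine h1.congr fun n => ?_
        simp [eqs, sub_eq_add_neg])
  have heq' : ∀ x, (eqs x).1 * e + e * (eqs x).2.1 + (eqs x).2.2 = 0 := fun x => by
    obtain ⟨i, rfl⟩ := hf x
    exact heq i
  have hdense : ∀ (g₁ g₂ : C → AsympAlg B), Continuous g₁ → Continuous g₂ →
      (∀ i, g₁ (c i) = g₂ (c i)) → ∀ x, g₁ x = g₂ x := fun g₁ g₂ h₁ h₂ h x =>
    congrFun (hc.equalizer h₁ h₂ (funext h)) x
  have hα := hcont α
  have hβ := hcont β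
  have hcm : ∀ γ : C →⋆ₙₐ[ℂ] AsympAlg B, (∀ i, γ (c i) * e + e * -γ (c i) + 0 = 0) →
      ∀ x, Commute e (γ x) := by
    intro γ hγ
    have := hcont γ
    refine hdense (fun x => e * γ x) (fun x => γ x * e) (by fun_prop) (by fun_prop) fun i => ?_
    have h1 := hγ i
    rw [add_zero, mul_neg, ← sub_eq_add_neg, sub_eq_zero] at h1
    exact h1.symm
  refine ⟨e, ⟨he, hcm α fun i => heq' (0, i), hcm β fun i => heq' (1, i), ?_⟩, fun x hx => ?_⟩
  · refine hdense (fun x => e * (α x - β x)) (fun _ => 0) (by fun_prop) (by fun_prop) fun i => ?_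
    simpa [eqs] using heq' (2, i)
  · have h1 : IsClosed {x | α x * e = α x} := isClosed_eq (by fun_prop) hα
    have h2 : Set.range j ⊆ {x | α x * e = α x} := by
      rintro _ ⟨i, rfl⟩
      have h3 := heq' (3, i)
      simp only [eqs, mul_zero, add_zero] at h3
      rwa [← sub_eq_add_neg, sub_eq_zero] at h3
    have h3 := closure_minimal h2 h1 (hjd x hx)
    rw [(hcm α (fun i => heq' (0, i)) x).eq]
    exact h3

end Connecting

end

end FullSurj

namespace FullSurj

noncomputable section

/-! ### Descent of the calculus to the cone of `A`, and its naturality. -/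

section ConeCalculus

variable {C C' A : Type u} [NonUnitalCStarAlgebra C] [NonUnitalCStarAlgebra C']
  [NonUnitalCStarAlgebra A] {X : Type v} [NonUnitalCStarAlgebra X]
  {Y : Type w} [NonUnitalCStarAlgebra Y]

theorem IsConnecting.map {α β : C →⋆ₙₐ[ℂ] X} {e : X} (he : IsConnecting α β e) (g : X →⋆ₙₐ[ℂ] Y)
    {α' β' : C →⋆ₙₐ[ℂ] Y} (hα : ∀ c, g (α c) = α' c) (hβ : ∀ c, g (β c) = β' c) :
    IsConnecting α' β' (g e) where
  selfAdjoint := he.selfAdjoint.map g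
  commute_left c := by rw [← hα]; exact (he.commute_left c).map g
  commute_right c := by rw [← hβ]; exact (he.commute_right c).map g
  mul_sub_eq_zero c := by rw [← hα, ← hβ, ← map_sub, ← map_mul, he.mul_sub_eq_zero, map_zero]

theorem IsConnecting.comp {α β : C →⋆ₙₐ[ℂ] X} {e : X} (he : IsConnecting α β e)
    (f : C' →⋆ₙₐ[ℂ] C) : IsConnecting (α.comp f) (β.comp f) e where
  selfAdjoint := he.selfAdjoint
  commute_left c := he.commute_left (f c)
  commute_right c := he.commute_right (f c)
  mul_sub_eq_zero c := he.mul_sub_eq_zero (f c)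

theorem isConnecting_zero (α β : C →⋆ₙₐ[ℂ] X) : IsConnecting α β 0 where
  selfAdjoint := .zero X
  commute_left _ := Commute.zero_left _
  commute_right _ := Commute.zero_left _
  mul_sub_eq_zero _ := zero_mul _

variable {p : C →⋆ₙₐ[ℂ] A} (hp : Function.Surjective p)

/-- The `*`-homomorphism `f ⊗ p(c) ↦ f(1 - e) α(c)` on the cone of `A`, for a self-adjoint element
`e` that commutes with the range of `α` and is a unit for the image of the kernel of `p`. -/
def coneCalculus {α : C →⋆ₙₐ[ℂ] X} {e : X} (he : IsSelfAdjoint e) (hα : ∀ c, Commute e (α c))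
    (hu : ∀ c, p c = 0 → e * α c = α c) : coneSubalgebra A →⋆ₙₐ[ℂ] X :=
  descend (coneMap p) (coneMap_surjective hp)
    ((calculus he hα).comp (NonUnitalStarSubalgebraClass.subtype (coneSubalgebra C)))
    fun F hF => calculus_eq_zero he hα F F.2 fun s => hu _ (by
      have h : (coneMap p F : C(I, A)) s = 0 := by rw [hF]; rfl
      exact h)

theorem coneCalculus_coneMap {α : C →⋆ₙₐ[ℂ] X} {e : X} (he : IsSelfAdjoint e)
    (hα : ∀ c, Commute e (α c)) (hu : ∀ c, p c = 0 → e * α c = α c) (F : coneSubalgebra C) :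
    coneCalculus hp he hα hu (coneMap p F) = calculus he hα F := descend_apply _ _ F

theorem map_coneCalculus {α : C →⋆ₙₐ[ℂ] X} {e : X} (he : IsSelfAdjoint e)
    (hα : ∀ c, Commute e (α c)) (hu : ∀ c, p c = 0 → e * α c = α c) (g : X →⋆ₙₐ[ℂ] Y)
    {α' : C →⋆ₙₐ[ℂ] Y} {e' : Y} (he' : IsSelfAdjoint e') (hα' : ∀ c, Commute e' (α' c))
    (hu' : ∀ c, p c = 0 → e' * α' c = α' c) (hge : g e = e') (hgα : ∀ c, g (α c) = α' c)
    (G : coneSubalgebra A) :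
    g (coneCalculus hp he hα hu G) = coneCalculus hp he' hα' hu' G := by
  obtain ⟨F, rfl⟩ := coneMap_surjective hp G
  rw [coneCalculus_coneMap, coneCalculus_coneMap, map_calculus he hα g he' hα' hge hgα]

theorem coneCalculus_comp {α : C →⋆ₙₐ[ℂ] X} {e : X} (he : IsSelfAdjoint e)
    (hα : ∀ c, Commute e (α c)) (hu : ∀ c, p c = 0 → e * α c = α c) {p' : C' →⋆ₙₐ[ℂ] A}
    (hp' : Function.Surjective p') (f : C' →⋆ₙₐ[ℂ] C) (hf : ∀ c, p (f c) = p' c)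
    (hα' : ∀ c, Commute e (α.comp f c)) (hu' : ∀ c, p' c = 0 → e * α.comp f c = α.comp f c)
    (G : coneSubalgebra A) : coneCalculus hp' he hα' hu' G = coneCalculus hp he hα hu G := by
  obtain ⟨F, rfl⟩ := coneMap_surjective hp' G
  have h : coneMap p' F = coneMap p (coneMap f F) :=
    Subtype.ext (ContinuousMap.ext fun s => (hf _).symm)
  rw [coneCalculus_coneMap, h, coneCalculus_coneMap]
  exact calculus_compHom he hα hα' f (fun _ => rfl) F

/-- The two homomorphisms differ by α(F(1)) - β(F(1)) for a lift F of G. If G(1) = 0 then F(1) is in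
the kernel of p, and the difference vanishes. -/
theorem coneCalculus_eq {α β : C →⋆ₙₐ[ℂ] X} (h : ∀ c, p c = 0 → α c = β c) {e : X}
    (he : IsConnecting α β e) (hu : ∀ c, p c = 0 → e * α c = α c)
    (hu' : ∀ c, p c = 0 → e * β c = β c) (G : coneSubalgebra A) (hG : coneEval A G = 0) :
    coneCalculus hp he.selfAdjoint he.commute_left hu G =
      coneCalculus hp he.selfAdjoint he.commute_right hu' G := by
  obtain ⟨F, rfl⟩ := coneMap_surjective hp G
  rw [coneCalculus_coneMap, coneCalculus_coneMap, ← sub_eq_zero,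
    calculus_sub_calculus _ _ _ he.mul_sub_eq_zero, sub_eq_zero]
  exact h _ hG

end ConeCalculus

/-! ### The map from `EN(C,J;B)` to `EN(CA,SA;B)` -/

section ToCone

open AsympAlg

variable {C C' A : Type u} [NonUnitalCStarAlgebra C] [NonUnitalCStarAlgebra C']
  [NonUnitalCStarAlgebra A] {B : Type v} [NonUnitalCStarAlgebra B]

/-- The straight line between two elements of an asymptotic algebra. -/
def lineElement (e₀ e₁ : AsympAlg B) : AsympAlg C(I, B) :=
  scale (1 - unitCoord) e₀ + scale unitCoord e₁

theorem eval_zero_lineElement (e₀ e₁ : AsympAlg B) :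
    mapHom (evalHom 0) (lineElement e₀ e₁) = e₀ := by
  rw [lineElement, map_add, eval_scale, eval_scale]; simp

theorem eval_one_lineElement (e₀ e₁ : AsympAlg B) :
    mapHom (evalHom 1) (lineElement e₀ e₁) = e₁ := by
  rw [lineElement, map_add, eval_scale, eval_scale]; simp

theorem star_unitCoord : star unitCoord = unitCoord := by
  ext s; simp [unitCoord]

theorem lineElement_mul_const (e₀ e₁ x : AsympAlg B) :
    lineElement e₀ e₁ * mapHom constHom x = lineElement (e₀ * x) (e₁ * x) := by
  rw [lineElement, lineElement, ← scale_one, add_mul, scale_mul_scale, scale_mul_scale, mul_one,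
    mul_one]

theorem const_mul_lineElement (e₀ e₁ x : AsympAlg B) :
    mapHom constHom x * lineElement e₀ e₁ = lineElement (x * e₀) (x * e₁) := by
  rw [lineElement, lineElement, ← scale_one, mul_add, scale_mul_scale, scale_mul_scale, one_mul,
    one_mul]

theorem lineElement_self (x : AsympAlg B) : lineElement x x = mapHom constHom x := by
  rw [lineElement, ← scale_add_left, sub_add_cancel, scale_one]

/-- The conditions on a connecting element are real-linear, so they survive on the segment between
two of them. This gives independence of the choice and, with endpoint 0, the comparison of C with
its cone. -/
theorem IsConnecting.line {α β : C →⋆ₙₐ[ℂ] AsympAlg B} {e₀ e₁ : AsympAlg B}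
    (h₀ : IsConnecting α β e₀) (h₁ : IsConnecting α β e₁) :
    IsConnecting ((mapHom constHom).comp α) ((mapHom constHom).comp β) (lineElement e₀ e₁) where
  selfAdjoint := by
    rw [isSelfAdjoint_iff, lineElement, star_add, star_scale, star_scale, h₀.selfAdjoint.star_eq,
      h₁.selfAdjoint.star_eq, star_sub, star_one, star_unitCoord]
  commute_left c := by
    rw [commute_iff_eq, NonUnitalStarAlgHom.comp_apply, lineElement_mul_const,
      const_mul_lineElement, (h₀.commute_left c).eq, (h₁.commute_left c).eq]
  commute_right c := by
    rw [commute_iff_eq, NonUnitalStarAlgHom.comp_apply, lineElement_mul_const,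
      const_mul_lineElement, (h₀.commute_right c).eq, (h₁.commute_right c).eq]
  mul_sub_eq_zero c := by
    rw [NonUnitalStarAlgHom.comp_apply, NonUnitalStarAlgHom.comp_apply, ← map_sub,
      lineElement_mul_const, h₀.mul_sub_eq_zero, h₁.mul_sub_eq_zero, lineElement_self, map_zero]

variable {p : C →⋆ₙₐ[ℂ] A} (hp : Function.Surjective p)

/-- The element of `EN(CA,SA;B)` that is defined by a pair of `*`-homomorphisms on `C` and a
connecting element. -/
def EN.coneClass {α β : C →⋆ₙₐ[ℂ] AsympAlg B} (h : ∀ c, p c = 0 → α c = β c) {e : AsympAlg B}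
    (he : IsConnecting α β e) (hu : ∀ c, p c = 0 → e * α c = α c) : EN (coneEval A) B :=
  have hu' : ∀ c, p c = 0 → e * β c = β c := fun c hc => by rw [← h c hc, hu c hc]
  EN.ofHom (coneEval A) (coneCalculus hp he.selfAdjoint he.commute_left hu)
    (coneCalculus hp he.selfAdjoint he.commute_right hu') (coneCalculus_eq hp h he hu hu')

theorem EN.coneClass_eq_of_homotopy (H K : C →⋆ₙₐ[ℂ] AsympAlg C(I, B))
    (h : ∀ c, p c = 0 → H c = K c) {e : AsympAlg C(I, B)} (he : IsConnecting H K e)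
    (hu : ∀ c, p c = 0 → e * H c = H c) {α₀ β₀ α₁ β₁ : C →⋆ₙₐ[ℂ] AsympAlg B} {e₀ e₁ : AsympAlg B}
    (h₀ : ∀ c, p c = 0 → α₀ c = β₀ c) (h₁ : ∀ c, p c = 0 → α₁ c = β₁ c)
    (he₀ : IsConnecting α₀ β₀ e₀) (he₁ : IsConnecting α₁ β₁ e₁)
    (hu₀ : ∀ c, p c = 0 → e₀ * α₀ c = α₀ c) (hu₁ : ∀ c, p c = 0 → e₁ * α₁ c = α₁ c)
    (hα₀ : ∀ c, mapHom (evalHom 0) (H c) = α₀ c) (hβ₀ : ∀ c, mapHom (evalHom 0) (K c) = β₀ c)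
    (hα₁ : ∀ c, mapHom (evalHom 1) (H c) = α₁ c) (hβ₁ : ∀ c, mapHom (evalHom 1) (K c) = β₁ c)
    (hev₀ : mapHom (evalHom 0) e = e₀) (hev₁ : mapHom (evalHom 1) e = e₁) :
    EN.coneClass hp h₀ he₀ hu₀ = EN.coneClass hp h₁ he₁ hu₁ := by
  have hu' : ∀ c, p c = 0 → e * K c = K c := fun c hc => by rw [← h c hc, hu c hc]
  refine EN.ofHom_eq_of_homotopy _ _ (coneCalculus_eq hp h he hu hu') _ _ _ _ _ _ ?_ ?_ ?_ ?_
  · exact map_coneCalculus hp _ _ _ _ _ _ _ hev₀ hα₀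
  · exact map_coneCalculus hp _ _ _ _ _ _ _ hev₀ hβ₀
  · exact map_coneCalculus hp _ _ _ _ _ _ _ hev₁ hα₁
  · exact map_coneCalculus hp _ _ _ _ _ _ _ hev₁ hβ₁

/-- The class in `EN(CA,SA;B)` does not depend on the connecting element. -/
theorem EN.coneClass_eq {α β α' β' : C →⋆ₙₐ[ℂ] AsympAlg B} (h : ∀ c, p c = 0 → α c = β c)
    (h' : ∀ c, p c = 0 → α' c = β' c) {e e' : AsympAlg B} (he : IsConnecting α β e)
    (he' : IsConnecting α' β' e') (hu : ∀ c, p c = 0 → e * α c = α c)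
    (hu' : ∀ c, p c = 0 → e' * α' c = α' c) (hα : ∀ c, α c = α' c) (hβ : ∀ c, β c = β' c) :
    EN.coneClass hp h he hu = EN.coneClass hp h' he' hu' := by
  obtain rfl : α = α' := NonUnitalStarAlgHom.ext hα
  obtain rfl : β = β' := NonUnitalStarAlgHom.ext hβ
  refine EN.coneClass_eq_of_homotopy hp _ _ ?_ (he.line he') ?_ h h' he he' hu hu'
    (fun c => eval_const 0 _) (fun c => eval_const 0 _) (fun c => eval_const 1 _)
    (fun c => eval_const 1 _) (eval_zero_lineElement e e') (eval_one_lineElement e e')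
  · exact fun c hc => congrArg (mapHom constHom) (h c hc)
  · intro c hc
    rw [NonUnitalStarAlgHom.comp_apply, lineElement_mul_const, hu c hc, hu' c hc, lineElement_self]

theorem EN.comap_comap_of_leftInverse {p' : C' →⋆ₙₐ[ℂ] A} (f : C' →⋆ₙₐ[ℂ] C)
    (hf : ∀ c, p (f c) = p' c) (g : C →⋆ₙₐ[ℂ] C') (hg : ∀ c, p' (g c) = p c)
    (hfg : ∀ c, f (g c) = c) (x : EN p B) : EN.comap g hg (EN.comap f hf x) = x := by
  obtain ⟨α, β, h, rfl⟩ := EN.exists_eq_ofHom x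
  have h' : ∀ c, p' c = 0 → α.comp f c = β.comp f c := fun c hc => h (f c) (by rw [hf, hc])
  have h'' : ∀ c, p c = 0 → (α.comp f).comp g c = (β.comp f).comp g c :=
    fun c hc => h' (g c) (by rw [hg, hc])
  rw [EN.comap_ofHom f hf α β h h', EN.comap_ofHom g hg _ _ h' h'']
  congr 1 <;> exact NonUnitalStarAlgHom.ext fun c => by simp [hfg]

variable [TopologicalSpace.SeparableSpace C] [TopologicalSpace.SeparableSpace C']

/-- The map `EN(C,J;B) → EN(CA,SA;B)`. -/
def EN.toCone (x : EN p B) : EN (coneEval A) B :=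
  Quot.lift (fun ψ : AsympPair p B =>
    EN.coneClass hp ψ.toHom_eq
      (exists_isConnecting p ψ.plus.toHom ψ.minus.toHom ψ.toHom_eq).choose_spec.1
      (exists_isConnecting p ψ.plus.toHom ψ.minus.toHom ψ.toHom_eq).choose_spec.2)
    (by
      intro ψ₀ ψ₁ hψ
      obtain ⟨H, K, hHK, h1, h2, h3, h4⟩ := hψ.exists_hom
      -- A connecting element for the homotopy itself. Its two evaluations are connecting elements
      -- for the endpoints, which `EN.coneClass_eq` compares with the chosen ones.
      obtain ⟨e, he, hu⟩ := exists_isConnecting p H K hHK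
      have hu₀ : ∀ c, p c = 0 →
          mapHom (evalHom 0) e * ψ₀.plus.toHom c = ψ₀.plus.toHom c := fun c hc => by
        rw [← h1, ← map_mul, hu c hc]
      have hu₁ : ∀ c, p c = 0 →
          mapHom (evalHom 1) e * ψ₁.plus.toHom c = ψ₁.plus.toHom c := fun c hc => by
        rw [← h3, ← map_mul, hu c hc]
      have key := EN.coneClass_eq_of_homotopy hp H K hHK he hu ψ₀.toHom_eq ψ₁.toHom_eq
        (he.map _ h1 h2) (he.map _ h3 h4) hu₀ hu₁ h1 h2 h3 h4 rfl rfl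
      refine (EN.coneClass_eq hp _ _ _ _ _ _ (fun _ => rfl) fun _ => rfl).trans (key.trans ?_)
      exact EN.coneClass_eq hp _ _ _ _ _ _ (fun _ => rfl) fun _ => rfl) x

theorem EN.toCone_ofHom {α β : C →⋆ₙₐ[ℂ] AsympAlg B} (h : ∀ c, p c = 0 → α c = β c)
    {e : AsympAlg B} (he : IsConnecting α β e) (hu : ∀ c, p c = 0 → e * α c = α c) :
    EN.toCone hp (EN.ofHom p α β h) = EN.coneClass hp h he hu :=
  have hψ := (AsympPair.ofHom α β h).toHom_eq
  EN.coneClass_eq hp hψ h (exists_isConnecting p _ _ hψ).choose_spec.1 he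
    (exists_isConnecting p _ _ hψ).choose_spec.2 hu (AsympHom.proj_ofHom α)
    (AsympHom.proj_ofHom β)

/-- A connecting element for (α, β) also serves (α ∘ f, β ∘ f), and both calculi descend to the same
map on the cone of A. Hence the maps to EN(CA,SA;B) fit together on the direct limit. -/
theorem EN.toCone_comap {p' : C' →⋆ₙₐ[ℂ] A} (hp' : Function.Surjective p') (f : C' →⋆ₙₐ[ℂ] C)
    (hf : ∀ c, p (f c) = p' c) (x : EN p B) :
    EN.toCone hp' (EN.comap f hf x) = EN.toCone hp x := by
  obtain ⟨α, β, h, rfl⟩ := EN.exists_eq_ofHom x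
  obtain ⟨e, he, hu⟩ := exists_isConnecting p α β h
  have h' : ∀ c, p' c = 0 → α.comp f c = β.comp f c := fun c hc => h (f c) (by rw [hf, hc])
  have hu' : ∀ c, p' c = 0 → e * α.comp f c = α.comp f c :=
    fun c hc => hu (f c) (by rw [hf, hc])
  rw [EN.comap_ofHom f hf α β h h', EN.toCone_ofHom hp h he hu,
    EN.toCone_ofHom hp' h' (he.comp f) hu']
  simp only [EN.coneClass]
  congr 1 <;> exact NonUnitalStarAlgHom.ext fun G => coneCalculus_comp hp _ _ _ hp' f hf _ _ G

/-- The pair (e, e') connects the direct sums, and its image under the sum homomorphism connects the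
sums; naturality of the calculus does the rest. -/
theorem EN.toCone_add (S : CuntzPair B) (x y : EN p B) :
    EN.toCone hp (EN.add S x y) = EN.add S (EN.toCone hp x) (EN.toCone hp y) := by
  obtain ⟨α, β, h, rfl⟩ := EN.exists_eq_ofHom x
  obtain ⟨α', β', h', rfl⟩ := EN.exists_eq_ofHom y
  obtain ⟨e, he, hu⟩ := exists_isConnecting p α β h
  obtain ⟨e', he', hu'⟩ := exists_isConnecting p α' β' h'
  have hpr : IsConnecting (α.prod α') (β.prod β') (e, e') :=
    { selfAdjoint := Prod.ext he.selfAdjoint he'.selfAdjoint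
      commute_left := fun c => Prod.ext (he.commute_left c).eq (he'.commute_left c).eq
      commute_right := fun c => Prod.ext (he.commute_right c).eq (he'.commute_right c).eq
      mul_sub_eq_zero := fun c => Prod.ext (he.mul_sub_eq_zero c) (he'.mul_sub_eq_zero c) }
  have hupr : ∀ c, p c = 0 → (e, e') * α.prod α' c = α.prod α' c :=
    fun c hc => Prod.ext (hu c hc) (hu' c hc)
  have hus : ∀ c, p c = 0 → sumHom S (e, e') * (sumHom S).comp (α.prod α') c =
      (sumHom S).comp (α.prod α') c := fun c hc => by
    rw [NonUnitalStarAlgHom.comp_apply, ← map_mul, hupr c hc]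
  have hs : ∀ c, p c = 0 →
      (sumHom S).comp (α.prod α') c = (sumHom S).comp (β.prod β') c :=
    fun c hc => congrArg (sumHom S) (Prod.ext (h c hc) (h' c hc))
  rw [EN.add_ofHom S α β α' β' h h' hs, EN.toCone_ofHom hp h he hu, EN.toCone_ofHom hp h' he' hu',
    EN.toCone_ofHom hp hs (hpr.map (sumHom S) (fun _ => rfl) fun _ => rfl) hus]
  have key : ∀ (γ γ' : C →⋆ₙₐ[ℂ] AsympAlg B) (hγ : ∀ c, Commute e (γ c))
      (hγ' : ∀ c, Commute e' (γ' c)) (hv : ∀ c, p c = 0 → e * γ c = γ c)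
      (hv' : ∀ c, p c = 0 → e' * γ' c = γ' c)
      (hs : ∀ c, Commute (sumHom S (e, e')) ((sumHom S).comp (γ.prod γ') c))
      (hvs : ∀ c, p c = 0 → sumHom S (e, e') * (sumHom S).comp (γ.prod γ') c =
        (sumHom S).comp (γ.prod γ') c),
      coneCalculus hp (hpr.selfAdjoint.map (sumHom S)) hs hvs =
        (sumHom S).comp ((coneCalculus hp he.selfAdjoint hγ hv).prod
          (coneCalculus hp he'.selfAdjoint hγ' hv')) := by
    intro γ γ' hγ hγ' hv hv' hs hvs
    refine NonUnitalStarAlgHom.ext fun G => ?_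
    have hc : ∀ c, Commute (e, e') (γ.prod γ' c) := fun c => Prod.ext (hγ c).eq (hγ' c).eq
    have hpv : ∀ c, p c = 0 → (e, e') * γ.prod γ' c = γ.prod γ' c :=
      fun c hc => Prod.ext (hv c hc) (hv' c hc)
    rw [← map_coneCalculus hp hpr.selfAdjoint hc hpv (sumHom S) _ _ _ rfl fun _ => rfl,
      NonUnitalStarAlgHom.comp_apply]
    congr 1
    exact Prod.ext
      (map_coneCalculus hp hpr.selfAdjoint hc hpv (NonUnitalStarAlgHom.fst ℂ _ _) _ _ _ rfl
        (fun _ => rfl) G)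
      (map_coneCalculus hp hpr.selfAdjoint hc hpv (NonUnitalStarAlgHom.snd ℂ _ _) _ _ _ rfl
        (fun _ => rfl) G)
  refine Eq.trans ?_ (EN.add_ofHom S _ _ _ _ _ _ fun G hG => ?_).symm
  · rw [EN.coneClass]
    congr 1
    · exact key _ _ _ _ _ _ _ _
    · exact key _ _ _ _ _ _ _ _
  · exact congrArg (sumHom S) (Prod.ext (coneCalculus_eq hp h he hu _ G hG)
      (coneCalculus_eq hp h' he' hu' _ G hG))

/-- The restriction of `x ∈ EN(C,J;B)` along the evaluation `CC → C` is the restriction of its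
image in `EN(CA,SA;B)` along `CC → CA`. -/
theorem EN.comap_coneEval (x : EN p B) :
    EN.comap (p' := p.comp (coneEval C)) (coneEval C)
        (fun _ => (NonUnitalStarAlgHom.comp_apply ..).symm) x =
      EN.comap (coneMap p) (coneEval_coneMap p) (EN.toCone hp x) := by
  obtain ⟨α, β, h, rfl⟩ := EN.exists_eq_ofHom x
  obtain ⟨e, he, hu⟩ := exists_isConnecting p α β h
  rw [EN.toCone_ofHom hp h he hu]
  -- The homotopy that shrinks e to 0. It exists on the cone of C only: away from the starting point
  -- the connecting element need no longer be a unit on the kernel, so the calculus need not descend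
  -- to the cone of A.
  have hl := he.line (isConnecting_zero α β)
  have hev : ∀ F, p.comp (coneEval C) F = 0 → α.comp (coneEval C) F = β.comp (coneEval C) F :=
    fun F hF => h _ hF
  have hu' : ∀ c, p c = 0 → e * β c = β c := fun c hc => by rw [← h c hc, hu c hc]
  have hcone : ∀ F, p.comp (coneEval C) F = 0 →
      (coneCalculus hp he.selfAdjoint he.commute_left hu).comp (coneMap p) F =
        (coneCalculus hp he.selfAdjoint he.commute_right hu').comp (coneMap p) F :=
    fun F hF => coneCalculus_eq hp h he hu hu' _ ((coneEval_coneMap p F).trans hF)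
  refine (EN.comap_ofHom _ _ _ _ _ hev).trans
    (Eq.trans (Eq.symm ?_) (EN.comap_ofHom _ _ _ _ _ hcone).symm)
  refine EN.ofHom_eq_of_homotopy
    ((calculus hl.selfAdjoint hl.commute_left).comp
      (NonUnitalStarSubalgebraClass.subtype (coneSubalgebra C)))
    ((calculus hl.selfAdjoint hl.commute_right).comp
      (NonUnitalStarSubalgebraClass.subtype (coneSubalgebra C)))
    (fun F hF => ?_) _ _ _ _ _ _ (fun F => ?_) (fun F => ?_) (fun F => ?_) (fun F => ?_)
  · refine sub_eq_zero.1 ((calculus_sub_calculus hl.selfAdjoint hl.commute_left hl.commute_right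
      hl.mul_sub_eq_zero (F : C(I, C))).trans (sub_eq_zero.2 ?_))
    exact congrArg (mapHom constHom) (h _ hF)
  · exact (map_calculus hl.selfAdjoint hl.commute_left _ he.selfAdjoint
      he.commute_left (eval_zero_lineElement e 0) (fun c => eval_const 0 _) _).trans
        (coneCalculus_coneMap hp _ _ hu F).symm
  · exact (map_calculus hl.selfAdjoint hl.commute_right _ he.selfAdjoint
      he.commute_right (eval_zero_lineElement e 0) (fun c => eval_const 0 _) _).trans
        (coneCalculus_coneMap hp _ _ hu' F).symm
  · exact (map_calculus hl.selfAdjoint hl.commute_left _ (.zero _)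
      (fun c => Commute.zero_left _) (eval_one_lineElement e 0) (fun c => eval_const 1 _) _).trans
        (calculus_zero _ _)
  · exact (map_calculus hl.selfAdjoint hl.commute_right _ (.zero _)
      (fun c => Commute.zero_left _) (eval_one_lineElement e 0) (fun c => eval_const 1 _) _).trans
        (calculus_zero _ _)

end ToCone

end

end FullSurj

namespace FullSurj

noncomputable section

/-! ### Comparison with the direct limit, and fullness. -/

section Limit

variable {A : Type u} [NonUnitalCStarAlgebra A] {B : Type v} [NonUnitalCStarAlgebra B]

instance {C : Type u} [NonUnitalCStarAlgebra C] [TopologicalSpace.SeparableSpace C] :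
    TopologicalSpace.SeparableSpace (coneSubalgebra C) :=
  haveI := UniformSpace.secondCountable_of_separable C
  inferInstance

theorem coneEval_surjective (C : Type u) [NonUnitalCStarAlgebra C] :
    Function.Surjective (coneEval C) := fun a =>
  ⟨⟨⟨fun τ => ((τ : ℝ) : ℂ) • a, by fun_prop⟩, show (((0 : I) : ℝ) : ℂ) • a = 0 by simp⟩,
    show (((1 : I) : ℝ) : ℂ) • a = a by simp⟩

/-- The extension `CC → C → A` obtained from an extension `C → A`. -/
def Extension.cone (E : Extension A) : Extension A where
  alg := coneSubalgebra E.alg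
  proj := E.proj.comp (coneEval E.alg)
  surjective := E.surjective.comp (coneEval_surjective E.alg)

/-- The evaluation `CC → C`. -/
def Extension.coneFst (E : Extension A) : Hom E.cone E where
  toHom := coneEval E.alg
  surjective := coneEval_surjective E.alg
  comm _ := rfl

/-- The map `CC → CA` that is induced by an extension `C → A`. -/
def Extension.coneSnd [TopologicalSpace.SeparableSpace A] (E : Extension A) :
    Hom E.cone (coneExtension A) where
  toHom := coneMap E.proj
  surjective := coneMap_surjective E.surjective
  comm := coneEval_coneMap E.proj

theorem Extension.toLim_comap {E E' : Extension A} (f : Hom E' E) (x : E.EN B) :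
    E'.toLim B (EN.comap f.toHom f.comm x) = E.toLim B x :=
  (Quot.sound ⟨f, rfl⟩).symm

/-- An element of `EN(C,J;B)` is determined by its image in `EN(CA,SA;B)` if `C` is a retract of
its cone by the evaluation. -/
theorem EN.comap_comap_toCone {C : Type u} [NonUnitalCStarAlgebra C]
    [TopologicalSpace.SeparableSpace C] {p : C →⋆ₙₐ[ℂ] A} (hp : Function.Surjective p)
    (g : C →⋆ₙₐ[ℂ] coneSubalgebra C) (hg : ∀ c, coneEval C (g c) = c)
    (hg' : ∀ c, p.comp (coneEval C) (g c) = p c) (x : EN p B) :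
    EN.comap g hg' (EN.comap (coneMap p) (coneEval_coneMap p) (EN.toCone hp x)) = x := by
  have h := EN.comap_comap_of_leftInverse (coneEval C)
    (fun _ => (NonUnitalStarAlgHom.comp_apply ..).symm) g hg' hg x
  rw [EN.comap_coneEval hp] at h
  exact h

/-- A section g of the evaluation of the cone of C cancels the evaluation in `EN.comap_coneEval`;
what remains is the pull-back along k, the composite of g with the map to the cone of A. -/
theorem EN.comap_toCone {C : Type u} [NonUnitalCStarAlgebra C]
    [TopologicalSpace.SeparableSpace C] {p : C →⋆ₙₐ[ℂ] A} (hp : Function.Surjective p)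
    (g : C →⋆ₙₐ[ℂ] coneSubalgebra C) (hg : ∀ c, coneEval C (g c) = c)
    (k : C →⋆ₙₐ[ℂ] coneSubalgebra A) (hk : ∀ c, coneMap p (g c) = k c)
    (hk' : ∀ c, coneEval A (k c) = p c) (x : EN p B) :
    EN.comap k hk' (EN.toCone hp x) = x := by
  obtain rfl : (coneMap p).comp g = k := NonUnitalStarAlgHom.ext hk
  refine Eq.trans ?_ (EN.comap_comap_toCone hp g hg (fun c => congrArg p (hg c)) x)
  generalize EN.toCone hp x = y
  induction y using Quot.ind
  rfl

/-- For C = CA and the section F ↦ F(sr), the composite k in `EN.comap_toCone` is the identity. -/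
theorem EN.toCone_coneEval [TopologicalSpace.SeparableSpace A] (x : EN (coneEval A) B) :
    EN.toCone (coneEval_surjective A) x = x := by
  refine Eq.trans ?_ (EN.comap_toCone (coneEval_surjective A) coneDiagonal
    coneEval_coneDiagonal (NonUnitalStarAlgHom.id ℂ _) coneMap_coneDiagonal (fun _ => rfl) x)
  generalize EN.toCone (coneEval_surjective A) x = y
  induction y using Quot.ind
  rfl

/-- The map `EN(A,B) → EN(CA,SA;B)`. -/
def ENLim.toCone (y : ENLim A B) : EN (coneEval A) B :=
  Quot.lift (fun x : Σ E : Extension A, E.EN B => EN.toCone x.1.surjective x.2)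
    (by
      rintro ⟨E, x⟩ ⟨E', y⟩ ⟨f, hf⟩
      have hf' : y = EN.comap (p := E.proj) (p' := E'.proj) f.toHom f.comm x := hf
      exact (EN.toCone_comap E.surjective E'.surjective f.toHom f.comm x).symm.trans
        (congrArg (EN.toCone E'.surjective) hf'.symm)) y

/-- Addition on the limit is addition after pulling both classes back to the fibre product, and
`EN.toCone` does not see such pull-backs. -/
theorem ENLim.toCone_add (S : CuntzPair B) (y z : ENLim A B) :
    (ENLim.add S y z).toCone = EN.add S y.toCone z.toCone := by
  obtain ⟨⟨E, x⟩, rfl⟩ := Quot.exists_rep y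
  obtain ⟨⟨F, x'⟩, rfl⟩ := Quot.exists_rep z
  refine (EN.toCone_add (E.fiberProduct F).surjective S _ _).trans ?_
  rw [EN.toCone_comap E.surjective, EN.toCone_comap F.surjective]
  rfl

variable [TopologicalSpace.SeparableSpace A]

/-- Both classes become equal over the cone of E, which maps onto E by evaluation and onto the cone
of A. -/
theorem toLim_toCone (E : Extension A) (x : E.EN B) :
    (coneExtension A).toLim B (EN.toCone E.surjective x) = E.toLim B x :=
  (Extension.toLim_comap E.coneSnd (EN.toCone E.surjective x)).symm.trans
    ((congrArg (E.cone.toLim B) (EN.comap_coneEval E.surjective x).symm).trans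
      (Extension.toLim_comap E.coneFst x))

theorem ENLim.toLim_toCone (y : ENLim A B) : (coneExtension A).toLim B y.toCone = y := by
  obtain ⟨⟨E, x⟩, rfl⟩ := Quot.exists_rep y
  exact FullSurj.toLim_toCone E x

/-- Every class in the limit comes from its image over the cone of A, where both sides are the same
sum. -/
theorem Extension.toLim_add (E : Extension A) (S : CuntzPair B) (x y : E.EN B) :
    E.toLim B (EN.add S x y) = ENLim.add S (E.toLim B x) (E.toLim B y) := by
  rw [← ENLim.toLim_toCone (ENLim.add _ _ _), ENLim.toCone_add]
  exact (FullSurj.toLim_toCone E _).symm.trans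
    (congrArg _ (EN.toCone_add E.surjective S x y))

theorem coneExtension_isFull : Extension.IsFull.{u, v} (coneExtension A) := fun B _ _ _ => by
  refine ⟨⟨fun x y h => ?_, fun y => ⟨y.toCone, y.toLim_toCone⟩⟩,
    (coneExtension A).toLim_add⟩
  rw [← EN.toCone_coneEval x, ← EN.toCone_coneEval y]
  exact congrArg ENLim.toCone h

/-- Maximality represents every class on U. Lifting the identity of U along the evaluation of its
cone gives a section, which recovers an element from its image over the cone of A and so from its
class in the limit. -/
theorem Extension.IsUniversal.isFull {U : Extension A} (hU : U.IsUniversal) :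
    Extension.IsFull.{u, v} U := fun B _ _ _ => by
  refine ⟨⟨fun x y h => ?_, fun z => ?_⟩, U.toLim_add⟩
  · obtain ⟨g, hg⟩ := hU.2 U.alg (coneSubalgebra U.alg) (coneEval U.alg)
      (NonUnitalStarAlgHom.id ℂ U.alg) (coneEval_surjective U.alg)
    have hg' : ∀ c, coneEval U.alg (g c) = c := fun c => DFunLike.congr_fun hg c
    have hg'' : ∀ c, U.proj.comp (coneEval U.alg) (g c) = U.proj c :=
      fun c => congrArg U.proj (hg' c)
    rw [← EN.comap_comap_toCone U.surjective g hg' hg'' x,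
      ← EN.comap_comap_toCone U.surjective g hg' hg'' y]
    exact congrArg (fun z => EN.comap g hg'' (EN.comap (coneMap U.proj) _ z))
      (congrArg ENLim.toCone h)
  · obtain ⟨⟨E, x⟩, rfl⟩ := Quot.exists_rep z
    obtain ⟨f⟩ := hU.1 E
    exact ⟨EN.comap f.toHom f.comm x, toLim_comap f x⟩

end Limit

end

end FullSurj

namespace FullSurj

noncomputable section

open TopologicalSpace

open scoped ENNReal

/-! ### Transport of the structure of a `C^*`-algebra -/

/-- Needed to replace every separable algebra by a copy on a subset of one fixed set, so that the
product over all of them stays in the universe. -/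
theorem exists_transport {X D : Type*} [NonUnitalCStarAlgebra D] (e : X ≃ D) :
    ∃ (_ : NonUnitalCStarAlgebra X) (φ : X →⋆ₙₐ[ℂ] D),
      Function.Surjective φ ∧ ∀ x, ‖φ x‖ = ‖x‖ := by
  let : NonUnitalRing X := e.nonUnitalRing
  let r : X ≃+* D := e.ringEquiv
  let : NonUnitalNormedRing X := NonUnitalNormedRing.induced X D r r.injective
  let : Module ℂ X := AddEquiv.module ℂ r.toAddEquiv
  have hsmul : ∀ (c : ℂ) (x : X), r (c • x) = c • r x := fun c x => r.apply_symm_apply _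
  let : NormedSpace ℂ X :=
    { norm_smul_le := fun c x => by
        change ‖r (c • x)‖ ≤ ‖c‖ * ‖r x‖
        rw [hsmul]; exact norm_smul_le _ _ }
  let : Star X := ⟨fun x => r.symm (star (r x))⟩
  have hstar : ∀ x : X, r (star x) = star (r x) := fun x => r.apply_symm_apply _
  let : StarRing X :=
    { star_involutive := fun x => r.injective (by rw [hstar, hstar, star_star])
      star_mul := fun x y => r.injective (by rw [hstar, map_mul, map_mul, hstar, hstar, star_mul])
      star_add := fun x y => r.injective (by rw [hstar, map_add, map_add, hstar, hstar, star_add]) }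
  have hiso : Isometry r := AddMonoidHomClass.isometry_of_norm r fun _ => rfl
  have : CompleteSpace X :=
    (completeSpace_congr (e := r.toEquiv) hiso.isUniformEmbedding).2 inferInstance
  have : CStarRing X := ⟨fun x => by
    change ‖r x‖ * ‖r x‖ ≤ ‖r (star x * x)‖
    rw [map_mul, hstar]; exact CStarRing.norm_mul_self_le _⟩
  have : IsScalarTower ℂ X X := ⟨fun c x y => r.injective (by
    simp only [smul_eq_mul, map_mul, hsmul, smul_mul_assoc])⟩
  have : SMulCommClass ℂ X X := ⟨fun c x y => r.injective (by
    simp only [smul_eq_mul, map_mul, hsmul, mul_smul_comm])⟩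
  have : StarModule ℂ X := ⟨fun c x => r.injective (by
    simp only [hstar, hsmul, star_smul])⟩
  refine ⟨{}, { toFun := r, map_smul' := hsmul, map_zero' := map_zero r, map_add' := map_add r,
                map_mul' := map_mul r, map_star' := hstar }, r.surjective, fun _ => rfl⟩

/-- A separable metric space has at most the cardinality of the continuum. -/
theorem exists_equiv_set (D : Type u) [MetricSpace D] [SeparableSpace D] [Nonempty D] :
    ∃ X : Set (ULift.{u} (Set (ℕ × ℚ))), Nonempty (X ≃ D) := by
  -- A point is determined by its distances to a dense sequence, and these by the rationals above
  -- them.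
  let f : D → ULift.{u} (Set (ℕ × ℚ)) := fun d => ⟨{x | dist d (denseSeq D x.1) < x.2}⟩
  have hf : Function.Injective f := fun c d h => by
    have h' : ∀ (n : ℕ) (q : ℚ), dist c (denseSeq D n) < q ↔ dist d (denseSeq D n) < q :=
      fun n q => Set.ext_iff.1 (ULift.up_injective h) (n, q)
    refine dist_le_zero.1 (le_of_forall_pos_lt_add fun ε hε => ?_)
    obtain ⟨n, hn⟩ := (denseRange_denseSeq D).exists_dist_lt c (half_pos hε)
    obtain ⟨q, hq, hq'⟩ := exists_rat_btwn hn
    have := (h' n q).1 hq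
    have := dist_triangle_right c d (denseSeq D n)
    linarith
  exact ⟨Set.range f, ⟨(Equiv.ofInjective f hf).symm⟩⟩

/-! ### Closed subalgebras with countably many generators -/

section Generated

variable {W : Type u} [NonUnitalCStarAlgebra W]

/-- It consists of images of words over a countable alphabet. -/
theorem countable_subsemigroupClosure {M : Type*} [Semigroup M] {s : Set M} (hs : s.Countable) :
    (Subsemigroup.closure s : Set M).Countable := by
  have := hs.to_subtype
  have : Countable (FreeSemigroup s) :=
    Function.Injective.countable (f := fun w : FreeSemigroup s => (w.head, w.tail))
      fun w w' h => FreeSemigroup.ext (Prod.ext_iff.1 h).1 (Prod.ext_iff.1 h).2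
  refine (Set.countable_range (FreeSemigroup.lift (Subtype.val : s → M))).mono fun x hx => ?_
  have hle : Subsemigroup.closure s ≤ (FreeSemigroup.lift (Subtype.val : s → M)).srange :=
    Subsemigroup.closure_le.2 fun y hy =>
      ⟨FreeSemigroup.of ⟨y, hy⟩, FreeSemigroup.lift_of _ _⟩
  exact hle hx

/-- The closed `*`-subalgebra generated by a set. -/
abbrev closedAdjoin (s : Set W) : NonUnitalStarSubalgebra ℂ W :=
  (NonUnitalStarAlgebra.adjoin ℂ s).topologicalClosure

instance (s : Set W) : IsClosed (closedAdjoin s : Set W) :=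
  NonUnitalStarSubalgebra.isClosed_topologicalClosure _

/-- The algebra is the closed span of the countably many words in s and its adjoints. -/
theorem separableSpace_closedAdjoin {s : Set W} (hs : s.Countable) :
    SeparableSpace (closedAdjoin s) := by
  refine IsSeparable.separableSpace (s := (closedAdjoin s : Set W)) ?_
  have h : (closedAdjoin s : Set W) =
      closure ((NonUnitalStarAlgebra.adjoin ℂ s).toSubmodule : Set W) := rfl
  rw [h, NonUnitalStarAlgebra.adjoin_eq_span]
  refine (IsSeparable.span (R := ℂ) (Set.Countable.isSeparable ?_)).closure
  refine countable_subsemigroupClosure (hs.union ?_)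
  exact hs.preimage star_injective

theorem mem_closedAdjoin {s : Set W} {x : W} (hx : x ∈ s) : x ∈ closedAdjoin s :=
  NonUnitalStarSubalgebra.le_topologicalClosure _ (NonUnitalStarAlgebra.subset_adjoin ℂ s hx)

theorem closedAdjoin_hom_ext {s : Set W} {D : Type u} [NonUnitalCStarAlgebra D]
    {φ ψ : closedAdjoin s →⋆ₙₐ[ℂ] D}
    (h : ∀ x (hx : x ∈ s), φ ⟨x, mem_closedAdjoin hx⟩ = ψ ⟨x, mem_closedAdjoin hx⟩) : φ = ψ := by
  have hd : Dense (((↑) : closedAdjoin s → W) ⁻¹' (NonUnitalStarAlgebra.adjoin ℂ s : Set W)) := by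
    rw [Subtype.dense_iff]
    intro x hx
    refine closure_mono (fun y hy => ?_) hx
    exact ⟨⟨y, NonUnitalStarSubalgebra.le_topologicalClosure _ hy⟩, hy, rfl⟩
  refine DFunLike.coe_injective (Continuous.ext_on hd (starHom_lipschitz φ).continuous
    (starHom_lipschitz ψ).continuous ?_)
  rintro ⟨x, hx'⟩ hx
  change x ∈ NonUnitalStarAlgebra.adjoin ℂ s at hx
  induction hx using NonUnitalStarAlgebra.adjoin_induction with
  | mem x hx => exact h x hx
  | add x y hx hy h₁ h₂ =>
    have hx := NonUnitalStarSubalgebra.le_topologicalClosure _ hx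
    have hy := NonUnitalStarSubalgebra.le_topologicalClosure _ hy
    exact ((map_add φ ⟨x, hx⟩ ⟨y, hy⟩).trans (congrArg₂ (· + ·) (h₁ hx) (h₂ hy))).trans
      (map_add ψ ⟨x, hx⟩ ⟨y, hy⟩).symm
  | zero => exact (map_zero φ).trans (map_zero ψ).symm
  | mul x y hx hy h₁ h₂ =>
    have hx := NonUnitalStarSubalgebra.le_topologicalClosure _ hx
    have hy := NonUnitalStarSubalgebra.le_topologicalClosure _ hy
    exact ((map_mul φ ⟨x, hx⟩ ⟨y, hy⟩).trans (congrArg₂ (· * ·) (h₁ hx) (h₂ hy))).trans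
      (map_mul ψ ⟨x, hx⟩ ⟨y, hy⟩).symm
  | smul r x hx h₁ =>
    have hx := NonUnitalStarSubalgebra.le_topologicalClosure _ hx
    exact ((map_smul φ r ⟨x, hx⟩).trans (congrArg (r • ·) (h₁ hx))).trans
      (map_smul ψ r ⟨x, hx⟩).symm
  | star x hx h₁ =>
    have hx := NonUnitalStarSubalgebra.le_topologicalClosure _ hx
    exact ((StarHomClass.map_star φ ⟨x, hx⟩).trans (congrArg star (h₁ hx))).trans
      (StarHomClass.map_star ψ ⟨x, hx⟩).symm

end Generated

end

end FullSurj

namespace FullSurj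

noncomputable section

open TopologicalSpace

open scoped ENNReal

/-! ### The universal `C^*`-algebra generated by countably many self-adjoint contractions -/

/-- A separable `C^*`-algebra on a set of sets of pairs of numbers, together with countably many
self-adjoint contractions. -/
structure Realization : Type u where
  carrier : Set (ULift.{u} (Set (ℕ × ℚ)))
  [cstar : NonUnitalCStarAlgebra carrier]
  gen : ℕ ⊕ ℕ → carrier
  selfAdjoint : ∀ n, IsSelfAdjoint (gen n)
  norm_le : ∀ n, ‖gen n‖ ≤ 1

attribute [instance] Realization.cstar

/-- The product of all realizations. -/
abbrev RealizationProd : Type u := lp (fun R : Realization.{u} => R.carrier) ∞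

/-- The universal sequence of self-adjoint contractions. -/
def universalSeq (n : ℕ ⊕ ℕ) : RealizationProd.{u} :=
  ⟨fun R => R.gen n, memℓp_infty ⟨1, by rintro _ ⟨R, rfl⟩; exact R.norm_le n⟩⟩

/-- The universal `C^*`-algebra generated by countably many self-adjoint contractions. -/
abbrev FreeCStar : Type u := closedAdjoin (Set.range universalSeq.{u})

namespace FreeCStar

/-- The generators. -/
def gen (n : ℕ ⊕ ℕ) : FreeCStar.{u} :=
  ⟨universalSeq n, mem_closedAdjoin ⟨n, rfl⟩⟩

instance : SeparableSpace FreeCStar.{u} := separableSpace_closedAdjoin (Set.countable_range _)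

theorem isSelfAdjoint_gen (n : ℕ ⊕ ℕ) : IsSelfAdjoint (gen.{u} n) :=
  Subtype.ext (Subtype.ext (funext fun R => R.selfAdjoint n))

theorem norm_gen_le (n : ℕ ⊕ ℕ) : ‖gen.{u} n‖ ≤ 1 :=
  lp.norm_le_of_forall_le zero_le_one fun R => R.norm_le n

theorem hom_ext {D : Type u} [NonUnitalCStarAlgebra D] {φ ψ : FreeCStar.{u} →⋆ₙₐ[ℂ] D}
    (h : ∀ n, φ (gen n) = ψ (gen n)) : φ = ψ :=
  closedAdjoin_hom_ext (by rintro _ ⟨n, rfl⟩; exact h n)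

/-- The coordinate homomorphism of a realization. -/
def toRealization (R : Realization.{u}) : FreeCStar.{u} →⋆ₙₐ[ℂ] R.carrier where
  toFun f := (f : RealizationProd) R
  map_smul' _ _ := rfl
  map_zero' := rfl
  map_add' _ _ := rfl
  map_mul' _ _ := rfl
  map_star' _ := rfl

/-- A copy of D, with the elements d as marked contractions, is one of the factors of the product;
the homomorphism is that coordinate. -/
theorem exists_hom {D : Type u} [NonUnitalCStarAlgebra D] [SeparableSpace D] (d : ℕ ⊕ ℕ → D)
    (hd : ∀ n, IsSelfAdjoint (d n)) (hd' : ∀ n, ‖d n‖ ≤ 1) :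
    ∃ φ : FreeCStar.{u} →⋆ₙₐ[ℂ] D, ∀ n, φ (gen n) = d n := by
  obtain ⟨X, ⟨e⟩⟩ := exists_equiv_set D
  obtain ⟨_, φ, hφ, hn⟩ := exists_transport e
  choose x hx using fun n => hφ (d n)
  have hinj : Function.Injective φ := (injective_iff_map_eq_zero φ).2 fun y hy => by
    rw [← norm_eq_zero, ← hn, hy, norm_zero]
  let R : Realization.{u} :=
    { carrier := X
      gen := x
      selfAdjoint := fun n => hinj (by rw [StarHomClass.map_star, hx, (hd n).star_eq])
      norm_le := fun n => by rw [← hn, hx]; exact hd' n }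
  exact ⟨φ.comp (toRealization R), hx⟩

/-- The generators satisfy no relations but self-adjointness and a norm bound, and both can be
preserved when lifting along a surjection. -/
theorem hasLifting : HasLifting FreeCStar.{u} := by
  intro D D' _ _ _ _ q φ hq
  choose d hd hd' hqd using fun n => exists_selfAdjoint_lift q ((isSelfAdjoint_gen n).map φ)
    (hq (φ (gen n))) ((NonUnitalStarAlgHom.norm_apply_le φ _).trans (norm_gen_le n))
  obtain ⟨ψ, hψ⟩ := exists_hom d hd hd'
  exact ⟨ψ, hom_ext fun n => by rw [NonUnitalStarAlgHom.comp_apply, hψ, hqd]⟩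

end FreeCStar

/-! ### The universal extension -/

/-- A sequence of self-adjoint contractions that generates the kernel of a `*`-homomorphism. -/
theorem exists_generating_seq {C D : Type u} [NonUnitalCStarAlgebra C] [SeparableSpace C]
    [NonUnitalCStarAlgebra D] (f : C →⋆ₙₐ[ℂ] D) :
    ∃ d : ℕ → C, (∀ n, IsSelfAdjoint (d n)) ∧ (∀ n, ‖d n‖ ≤ 1) ∧ (∀ n, f (d n) = 0) ∧
      ∀ (U : Type u) [NonUnitalCStarAlgebra U] (g : U →⋆ₙₐ[ℂ] C), (∀ n, d n ∈ Set.range g) →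
        ∀ c, f c = 0 → c ∈ Set.range g := by
  -- A dense sequence in T suffices: ranges of `*`-homomorphisms are closed, and scaling together
  -- with real and imaginary parts reduces the kernel to T.
  let T : Set C := {c | IsSelfAdjoint c ∧ ‖c‖ ≤ 1 ∧ f c = 0}
  have : Nonempty T := ⟨⟨0, .zero C, by simp, map_zero f⟩⟩
  have := UniformSpace.secondCountable_of_separable C
  refine ⟨fun n => (denseSeq T n : C), fun n => (denseSeq T n).2.1, fun n => (denseSeq T n).2.2.1,
    fun n => (denseSeq T n).2.2.2, fun U _ g hg => ?_⟩
  have hT : ∀ c ∈ T, c ∈ Set.range g := fun c hc => by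
    have h := image_closure_subset_closure_image (s := Set.range (denseSeq T))
      continuous_subtype_val (Set.mem_image_of_mem _ (denseRange_denseSeq T ⟨c, hc⟩))
    refine closure_minimal ?_ (isClosed_range g) h
    rintro _ ⟨_, ⟨n, rfl⟩, rfl⟩
    exact hg n
  have hsa : ∀ c, IsSelfAdjoint c → f c = 0 → c ∈ Set.range g := fun c hc hfc => by
    rcases eq_or_ne c 0 with rfl | h0
    · exact ⟨0, map_zero g⟩
    · have hn : (‖c‖ : ℂ) ≠ 0 := by exact_mod_cast norm_ne_zero_iff.2 h0
      obtain ⟨u, hu⟩ := hT ((‖c‖⁻¹ : ℂ) • c) ⟨by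
        rw [isSelfAdjoint_iff, star_smul, hc.star_eq, star_inv₀]; simp, by
        rw [norm_smul, norm_inv, Complex.norm_real, norm_norm,
          inv_mul_cancel₀ (norm_ne_zero_iff.2 h0)], by
        rw [map_smul, hfc, smul_zero]⟩
      exact ⟨(‖c‖ : ℂ) • u, by rw [map_smul, hu, smul_inv_smul₀ hn]⟩
  intro c hfc
  have hfs : f (star c) = 0 := by rw [StarHomClass.map_star, hfc, star_zero]
  obtain ⟨u, hu⟩ := hsa (c + star c) (.add_star_self c) (by rw [map_add, hfc, hfs, add_zero])
  obtain ⟨v, hv⟩ := hsa (Complex.I • (c - star c))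
    (by rw [isSelfAdjoint_iff, star_smul, star_sub, star_star, Complex.star_def, Complex.conj_I,
      neg_smul, ← smul_neg, neg_sub])
    (by rw [map_smul, map_sub, hfc, hfs, sub_zero, smul_zero])
  -- From 2c = (c + c*) - i · i(c - c*).
  refine ⟨(2⁻¹ : ℂ) • (u - Complex.I • v), ?_⟩
  rw [map_smul, map_sub, map_smul, hu, hv, smul_smul, Complex.I_mul_I, neg_one_smul, sub_neg_eq_add,
    add_add_sub_cancel, ← two_smul ℂ, inv_smul_smul₀ two_ne_zero]

/-- Two sequences of generators are used. To map onto an extension E, the first goes to lifts of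
generators of A and the second to generators of the kernel of E → A. -/
theorem exists_isUniversal (A : Type u) [NonUnitalCStarAlgebra A] [SeparableSpace A] :
    ∃ U : Extension A, U.IsUniversal := by
  obtain ⟨a, ha, ha', -, hgen⟩ := exists_generating_seq (0 : A →⋆ₙₐ[ℂ] A)
  -- The second sequence is sent to 0, so that over A its images in an extension can be any
  -- self-adjoint contractions of the kernel.
  obtain ⟨p, hp⟩ := FreeCStar.exists_hom (Sum.elim a fun _ => 0) (by simp [ha]) (by simp [ha'])
  have hps : Function.Surjective p := fun c =>
    hgen _ p (fun n => ⟨_, hp (.inl n)⟩) c rfl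
  refine ⟨⟨FreeCStar, p, hps⟩, fun E => ?_, FreeCStar.hasLifting⟩
  choose b hb hb' hpb using fun n =>
    exists_selfAdjoint_lift E.proj (ha n) (E.surjective (a n)) (ha' n)
  obtain ⟨d, hd, hd', hpd, hgen'⟩ := exists_generating_seq E.proj
  obtain ⟨g, hg⟩ := FreeCStar.exists_hom (Sum.elim b d) (by simp [hb, hd]) (by simp [hb', hd'])
  have hcomm : E.proj.comp g = p := FreeCStar.hom_ext fun n => by
    rw [NonUnitalStarAlgHom.comp_apply, hg, hp]
    cases n <;> simp [hpb, hpd]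
  have hcomm' : ∀ u, E.proj (g u) = p u := fun u => DFunLike.congr_fun hcomm u
  refine ⟨⟨g, fun c => ?_, hcomm'⟩⟩
  obtain ⟨u, hu⟩ := hps (E.proj c)
  obtain ⟨v, hv⟩ := hgen' _ g (fun n => ⟨_, hg (.inr n)⟩) (c - g u)
    (by rw [map_sub, hcomm', hu, sub_self])
  exact ⟨v + u, by rw [map_add, hv, sub_add_cancel]⟩

end

end FullSurj

theorem mainTheorem4 (A : Type u) [NonUnitalCStarAlgebra A] [TopologicalSpace.SeparableSpace A] :
    FullSurj.Extension.IsFull.{u, v} (FullSurj.coneExtension A) ∧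
    (∃ U : FullSurj.Extension A, U.IsUniversal) ∧
    ∀ U : FullSurj.Extension A, U.IsUniversal → FullSurj.Extension.IsFull.{u, v} U :=
  ⟨FullSurj.coneExtension_isFull, FullSurj.exists_isUniversal A, fun _ hU => hU.isFull⟩
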